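/- Let $n\ge 2$ and $p>1$. For a convex body $K\subset\mathbb R^n$ (compact, convex, with nonempty interior) containing the origin in its interior, let $h_K(v)=\sup_{x\in K}\langle x,v\rangle$ be its support function and $S(K,\omega)=\mathcal H^{n-1}\big((\nu^K)^{-1}(\omega)\big)$ its surface area measure, where $\nu^K$ is the ($\mathcal H^{n-1}$-almost everywhere defined) outer unit normal on $\partial K$. The $L_p$-projection body $\Pi_pK$ is the convex body with support function $$h_{\Pi_pK}(v)=\left(\frac1{n\,\omega_n c_{n-2,p}}\int_{\mathbb S^{n-1}}|\langle v,\theta\rangle|^p\,h_K(\theta)^{1-p}\,dS(K,\theta)\right)^{1/p},\qquad c_{r,p}=\frac{\omega_{r+p}}{\omega_2\,\omega_r\,\omega_{p-1}},\quad \omega_r=\frac{\pi^{r/2}}{\Gamma(1+r/2)},$$ and $\Pi_p^*K=\{x:\langle x,y\rangle\le 1\text{ for all }y\in\Pi_pK\}$ is its polar body. Let $K\subset\mathbb R^n$ be an origin-symmetric convex body of class $C^2_+$ (that is, $\partial K$ is a $C^2$ hypersurface with positive curvature everywhere), and let $u\in\mathbb S^{n-1}$. Let $R_u$ be the orthogonal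 reflection in $u^\perp$, and for a set $L$ and $y\in u^\perp$ put $L(y)=\{s\in\mathbb R: y+su\in L\}$. Let $\{K_t\}_{t\in[-1,1]}$ be the linear reflection shadow system of $K$ in direction $u$, that is, the sets $K_t$ with $$K_t(y)=\tfrac{1+t}{2}K(y)+\tfrac{1-t}{2}(R_uK)(y),\qquad y\in u^\perp .$$ Let $S_uK$ be the Steiner symmetral of $K$ in direction $u$, obtained by replacing each nonempty section $K(y)$, $y\in u^\perp$, by the closed segment of the same length centred at $0$. If the left derivative $\frac{d}{dt}\big|_{t=1^-}\operatorname{vol}_n(\Pi_p^*K_t)$ exists and equals $0$, then $\operatorname{vol}_n(\Pi_p^*K_t)$ is constant for $t\in[-1,1]$. In particular, $\operatorname{vol}_n(\Pi_p^*K)=\operatorname{vol}_n(\Pi_p^*S_uK)$. -/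

import Mathlib

open MeasureTheory Set
open scoped Pointwise RealInnerProductSpace

noncomputable section

namespace LpProjection

variable {n : ℕ}

/-- A convex body in `ℝⁿ` symmetric about the origin: compact, convex, with nonempty interior,
and `K = -K`. -/
structure IsSymmetricConvexBody (K : Set (EuclideanSpace ℝ (Fin n))) : Prop where
  isCompact : IsCompact K
  convex : Convex ℝ K
  nonempty_interior : (interior K).Nonempty
  neg_mem : ∀ x ∈ K, -x ∈ K

/-- `K` is of class `C²₊`: its boundary is a `C²` hypersurface with positive curvature everywhere.
Near each boundary point, `K` is a sublevel set `{ρ ≤ 0}` of a `C²` function `ρ` with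
non-vanishing differential there, and the second fundamental form of the boundary at that point,
which is `D²ρ / ‖∇ρ‖` on the tangent space `ker Dρ`, is positive definite (all principal
curvatures are positive). -/
def IsC2Plus (K : Set (EuclideanSpace ℝ (Fin n))) : Prop :=
  ∀ x ∈ frontier K, ∃ (U : Set (EuclideanSpace ℝ (Fin n))) (ρ : EuclideanSpace ℝ (Fin n) → ℝ),
    IsOpen U ∧ x ∈ U ∧ ContDiffOn ℝ 2 ρ U ∧ K ∩ U = {y ∈ U | ρ y ≤ 0} ∧
    fderiv ℝ ρ x ≠ 0 ∧
    ∀ w : EuclideanSpace ℝ (Fin n), w ≠ 0 → fderiv ℝ ρ x w = 0 →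
      0 < fderiv ℝ (fderiv ℝ ρ) x w w

/-- The support function `h_K(v) = sup_{x ∈ K} ⟪x, v⟫`. -/
def supportFn (K : Set (EuclideanSpace ℝ (Fin n))) (v : EuclideanSpace ℝ (Fin n)) : ℝ :=
  sSup ((fun x => ⟪x, v⟫) '' K)

/-- The polar body `K* = {x : ⟪x, y⟫ ≤ 1 for all y ∈ K}`. -/
def polarBody (K : Set (EuclideanSpace ℝ (Fin n))) : Set (EuclideanSpace ℝ (Fin n)) :=
  {x | ∀ y ∈ K, ⟪x, y⟫ ≤ 1}

/-- `v` is an outer unit normal vector of `K` at `x`. -/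
def IsOuterUnitNormal (K : Set (EuclideanSpace ℝ (Fin n))) (x v : EuclideanSpace ℝ (Fin n)) :
    Prop :=
  ‖v‖ = 1 ∧ ∀ y ∈ K, ⟪y, v⟫ ≤ ⟪x, v⟫

/-- The boundary points of `K` that have exactly one outer unit normal vector. For a convex body
these are `𝓗ⁿ⁻¹`-almost all boundary points. -/
def regularBoundary (K : Set (EuclideanSpace ℝ (Fin n))) : Set (EuclideanSpace ℝ (Fin n)) :=
  {x ∈ frontier K | ∃! v, IsOuterUnitNormal K x v}

open Classical in
/-- The Gauss map `ν^K`: the outer unit normal at a regular boundary point (and `0`, a value that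
is never used, at all other points). -/
def gaussMap (K : Set (EuclideanSpace ℝ (Fin n))) (x : EuclideanSpace ℝ (Fin n)) :
    EuclideanSpace ℝ (Fin n) :=
  if h : x ∈ regularBoundary K then h.2.choose else 0

/-- The surface area measure `S(K, ω) = 𝓗ⁿ⁻¹((ν^K)⁻¹(ω))`, as a Borel measure on `ℝⁿ` that is
carried by the unit sphere. `μHE[n - 1]` is the Hausdorff measure with its usual
normalization. See `surfaceAreaMeasure_apply` below. -/
def surfaceAreaMeasure (K : Set (EuclideanSpace ℝ (Fin n))) :
    Measure (EuclideanSpace ℝ (Fin n)) :=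
  ((μHE[n - 1] : Measure (EuclideanSpace ℝ (Fin n))).restrict (regularBoundary K)).map (gaussMap K)

/-- `ω_r = π^{r/2} / Γ(1 + r/2)`. -/
def omega (r : ℝ) : ℝ := Real.pi ^ (r / 2) / Real.Gamma (1 + r / 2)

/-- `c_{r,p} = ω_{r+p} / (ω_2 ω_r ω_{p-1})`. -/
def cConst (r p : ℝ) : ℝ := omega (r + p) / (omega 2 * omega r * omega (p - 1))

/-- The function
`v ↦ ((n ω_n c_{n-2,p})⁻¹ ∫ |⟪v, θ⟫|^p h_K(θ)^{1-p} dS(K, θ))^{1/p}`. -/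
def lpProjectionSupport (p : ℝ) (K : Set (EuclideanSpace ℝ (Fin n)))
    (v : EuclideanSpace ℝ (Fin n)) : ℝ :=
  (1 / (n * omega n * cConst (n - 2) p) *
    ∫ θ, |⟪v, θ⟫| ^ p * supportFn K θ ^ (1 - p) ∂(surfaceAreaMeasure K)) ^ (1 / p)

/-- The `L_p`-projection body `Π_p K`: the convex body whose support function is
`lpProjectionSupport p K`. -/
def lpProjectionBody (p : ℝ) (K : Set (EuclideanSpace ℝ (Fin n))) :
    Set (EuclideanSpace ℝ (Fin n)) :=
  {x | ∀ v, ⟪x, v⟫ ≤ lpProjectionSupport p K v}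

/-- `vol_n(Π_p^* K)`, the volume of the polar of the `L_p`-projection body. -/
def volPolarLpProjection (p : ℝ) (K : Set (EuclideanSpace ℝ (Fin n))) : ℝ :=
  (volume (polarBody (lpProjectionBody p K))).toReal

/-- The one-dimensional section `K(y) = {s : y + s u ∈ K}` of `K` over `y` in direction `u`. -/
def fiber (u : EuclideanSpace ℝ (Fin n)) (K : Set (EuclideanSpace ℝ (Fin n)))
    (y : EuclideanSpace ℝ (Fin n)) : Set ℝ :=
  {s | y + s • u ∈ K}

/-- `R_u K`, the image of `K` under the orthogonal reflection in the hyperplane `u^⊥`. -/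
def reflectBody (u : EuclideanSpace ℝ (Fin n)) (K : Set (EuclideanSpace ℝ (Fin n))) :
    Set (EuclideanSpace ℝ (Fin n)) :=
  (ℝ ∙ u)ᗮ.reflection '' K

/-- The linear reflection shadow system `K_t` of `K` in direction `u`: over each `y ∈ u^⊥`,
`K_t(y) = (1+t)/2 K(y) + (1-t)/2 (R_u K)(y)` (Minkowski combination of sections). -/
def shadowSystem (u : EuclideanSpace ℝ (Fin n)) (K : Set (EuclideanSpace ℝ (Fin n))) (t : ℝ) :
    Set (EuclideanSpace ℝ (Fin n)) :=
  {x | ∃ y, ⟪y, u⟫ = 0 ∧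
    ∃ s ∈ ((1 + t) / 2) • fiber u K y + ((1 - t) / 2) • fiber u (reflectBody u K) y,
      x = y + s • u}

/-- The Steiner symmetral `S_u K`: every nonempty section of `K` in direction `u` is replaced by
the closed segment of the same length centred on `u^⊥`. -/
def steinerSymmetral (u : EuclideanSpace ℝ (Fin n)) (K : Set (EuclideanSpace ℝ (Fin n))) :
    Set (EuclideanSpace ℝ (Fin n)) :=
  {x | ∃ y, ⟪y, u⟫ = 0 ∧ (fiber u K y).Nonempty ∧
    ∃ s : ℝ, |s| ≤ (volume (fiber u K y)).toReal / 2 ∧ x = y + s • u}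

/-! Helper facts: the Gauss map is Borel measurable, so that `surfaceAreaMeasure` has the
defining property of the surface area measure. -/

lemma isOuterUnitNormal_gaussMap {K : Set (EuclideanSpace ℝ (Fin n))}
    {x : EuclideanSpace ℝ (Fin n)} (h : x ∈ regularBoundary K) :
    IsOuterUnitNormal K x (gaussMap K x) := by
  rw [gaussMap, dif_pos h]
  exact h.2.choose_spec.1

lemma isClosed_normalPairs (K : Set (EuclideanSpace ℝ (Fin n))) :
    IsClosed {q : EuclideanSpace ℝ (Fin n) × EuclideanSpace ℝ (Fin n) |
      IsOuterUnitNormal K q.1 q.2} := by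
  have : {q : EuclideanSpace ℝ (Fin n) × EuclideanSpace ℝ (Fin n) |
      IsOuterUnitNormal K q.1 q.2} =
      {q | ‖q.2‖ = 1} ∩ ⋂ y ∈ K, {q | ⟪y, q.2⟫ ≤ ⟪q.1, q.2⟫} := by
    ext q; simp [IsOuterUnitNormal]
  rw [this]
  refine IsClosed.inter (isClosed_eq (by fun_prop) (by fun_prop)) ?_
  exact isClosed_biInter fun y _ => isClosed_le (by fun_prop) (by fun_prop)

lemma isCompact_normalPairs {K : Set (EuclideanSpace ℝ (Fin n))} (hK : IsCompact K) :
    IsCompact ({q : EuclideanSpace ℝ (Fin n) × EuclideanSpace ℝ (Fin n) |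
      IsOuterUnitNormal K q.1 q.2} ∩ {q | q.1 ∈ frontier K}) := by
  have hF : IsCompact (frontier K) :=
    hK.of_isClosed_subset isClosed_frontier hK.isClosed.frontier_subset
  refine (hF.prod (isCompact_sphere (0 : EuclideanSpace ℝ (Fin n)) 1)).of_isClosed_subset
    ((isClosed_normalPairs K).inter (isClosed_frontier.preimage continuous_fst)) ?_
  rintro q ⟨h1, h2⟩
  exact ⟨h2, by simpa using h1.1⟩

lemma measurableSet_normalsMeet {K : Set (EuclideanSpace ℝ (Fin n))} (hK : IsCompact K)
    {C : Set (EuclideanSpace ℝ (Fin n))} (hC : IsClosed C) :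
    MeasurableSet {x ∈ frontier K | ∃ v ∈ C, IsOuterUnitNormal K x v} := by
  have : {x ∈ frontier K | ∃ v ∈ C, IsOuterUnitNormal K x v} =
      Prod.fst '' (({q : EuclideanSpace ℝ (Fin n) × EuclideanSpace ℝ (Fin n) |
        IsOuterUnitNormal K q.1 q.2} ∩ {q | q.1 ∈ frontier K}) ∩ {q | q.2 ∈ C}) := by
    ext x
    constructor
    · rintro ⟨hx, v, hv, hn⟩
      exact ⟨(x, v), ⟨⟨hn, hx⟩, hv⟩, rfl⟩
    · rintro ⟨⟨x', v⟩, ⟨⟨hn, hx⟩, hv⟩, rfl⟩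
      exact ⟨hx, v, hv, hn⟩
  rw [this]
  exact (((isCompact_normalPairs hK).inter_right
    (hC.preimage continuous_snd)).image continuous_fst).measurableSet

lemma measurableSet_regularBoundary {K : Set (EuclideanSpace ℝ (Fin n))} (hK : IsCompact K) :
    MeasurableSet (regularBoundary K) := by
  have : regularBoundary K = {x ∈ frontier K | ∃ v ∈ univ, IsOuterUnitNormal K x v} \
      ⋃ q : ℚ × (Fin n), ({x ∈ frontier K | ∃ v ∈ {v | v q.2 ≤ (q.1 : ℝ)},
          IsOuterUnitNormal K x v} ∩
        ⋃ m : ℕ, {x ∈ frontier K | ∃ v ∈ {v | (q.1 : ℝ) + 1 / ((m : ℝ) + 1) ≤ v q.2},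
          IsOuterUnitNormal K x v}) := by
    ext x
    simp only [regularBoundary, mem_ofPred_eq, mem_sdiff, mem_iUnion, mem_inter_iff, mem_univ,
      true_and, not_exists, not_and]
    constructor
    · rintro ⟨hx, v, hv, huniq⟩
      refine ⟨⟨hx, v, hv⟩, ?_⟩
      rintro ⟨q, i⟩ ⟨_, v1, h1, hn1⟩ m _ v2 h2 hn2
      have e1 := huniq _ hn1
      have e2 := huniq _ hn2
      subst e1
      subst e2
      have : (0 : ℝ) < 1 / ((m : ℝ) + 1) := by positivity
      simp only at h1 h2
      linarith
    · rintro ⟨⟨hx, v, hv⟩, h⟩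
      refine ⟨hx, v, hv, ?_⟩
      have key : ∀ a b, IsOuterUnitNormal K x a → IsOuterUnitNormal K x b →
          ∀ i, b i ≤ a i := by
        intro a b ha hb i
        by_contra! hlt
        obtain ⟨q, hq1, hq2⟩ := exists_rat_btwn hlt
        obtain ⟨m, hm⟩ := exists_nat_one_div_lt (sub_pos.2 hq2)
        refine h (q, i) ⟨hx, a, hq1.le, ha⟩ m hx b ?_ hb
        simp only
        linarith
      intro w hw
      ext i
      exact le_antisymm (key v w hv hw i) (key w v hw hv i)
  rw [this]
  refine (measurableSet_normalsMeet hK isClosed_univ).diff (MeasurableSet.iUnion fun q => ?_)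
  refine (measurableSet_normalsMeet hK (isClosed_le (by fun_prop) (by fun_prop))).inter
    (MeasurableSet.iUnion fun m => measurableSet_normalsMeet hK
      (isClosed_le (by fun_prop) (by fun_prop)))

lemma measurable_gaussMap {K : Set (EuclideanSpace ℝ (Fin n))} (hK : IsCompact K) :
    Measurable (gaussMap K) := by
  refine measurable_of_isClosed fun C hC => ?_
  have hreg := measurableSet_regularBoundary hK
  have : gaussMap K ⁻¹' C =
      (regularBoundary K ∩ {x ∈ frontier K | ∃ v ∈ C, IsOuterUnitNormal K x v}) ∪
      ((regularBoundary K)ᶜ ∩ {_x | (0 : EuclideanSpace ℝ (Fin n)) ∈ C}) := by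
    ext x
    by_cases hx : x ∈ regularBoundary K
    · have hn := isOuterUnitNormal_gaussMap hx
      simp only [mem_preimage, mem_union, mem_inter_iff, hx, true_and, mem_compl_iff,
        not_true_eq_false, false_and, or_false, mem_ofPred_eq, hx.1]
      constructor
      · intro h
        exact ⟨_, h, hn⟩
      · rintro ⟨v, hv, hv'⟩
        rwa [← hx.2.unique hv' hn]
    · simp [hx, gaussMap]
  rw [this]
  exact (hreg.inter (measurableSet_normalsMeet hK hC)).union
    (hreg.compl.inter (MeasurableSet.const _))

/-- The defining property of the surface area measure. -/
theorem surfaceAreaMeasure_apply {K : Set (EuclideanSpace ℝ (Fin n))} (hK : IsCompact K)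
    {ω : Set (EuclideanSpace ℝ (Fin n))} (hω : MeasurableSet ω) :
    surfaceAreaMeasure K ω = (μHE[n - 1] : Measure (EuclideanSpace ℝ (Fin n)))
      {x ∈ regularBoundary K | gaussMap K x ∈ ω} := by
  rw [surfaceAreaMeasure, Measure.map_apply (measurable_gaussMap hK) hω,
    Measure.restrict_apply (measurable_gaussMap hK hω), inter_comm]
  rfl

end LpProjection

end

/-! Write vectors as y + su with y ∈ u^⊥. By symmetry of K, the section of K over y is [-f(-y),
f(y)], so K_t lies below the graph of f_t(y) = (1+t)/2 f(y) + (1-t)/2 f(-y), and f_t and its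
derivative are affine in t. With U the interior of the projection of K, the area formula turns the
surface integral into q_t(y,s) = h_{Π_p K_t}(y+su)^p = C ∫_U |s - Df_t(z)y|^p (f_t(z) -
Df_t(z)z)^{1-p} dz, and Π_p^* K_t is {q_t ≤ 1}. The passage is `isGraphBody_shadowSystem` followed
by `IsGraphBody.integral_surfaceAreaMeasure`.

Since |x|^p b^{1-p} is jointly convex for b > 0, q_t(y,s) is convex in (t,s) for fixed y and in
(y,s) for fixed t; the substitution z ↦ -z gives q_{-t}(y,s) = q_t(y,-s). These facts are collected
in `IsReflectionProfile.isReflectionFamily`. Let ℓ_t(y) be the length of {s : q_t(y,s) ≤ 1} and W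
the set of y over which {q_1 < 1} is nonempty. Over W, ℓ_t is even and, by one-dimensional
Brunn–Minkowski, concave in t, so ℓ_t ≥ ℓ_1.

The integral g(t) of ℓ_t over W is concave, even, at most the volume V(t), and equal to V(1) at t =
1. A vanishing left derivative of V therefore forces g to be constant. Hence ℓ_t = ℓ_1 almost
everywhere on W, and everywhere on W because both are concave in y. It remains to exclude that {q_t
≤ 1} has mass outside W; this is a continuation argument along rays
(`IsReflectionFamily.length_eq_zero`). Together these give `IsReflectionFamily.volume_eq`.

The class C²₊ enters twice: smoothness makes f differentiable on U, and positive curvature excludes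
boundary segments parallel to u, so the upper and lower graphs meet over the boundary of the
projection. -/

open MeasureTheory Set
open scoped Pointwise RealInnerProductSpace

noncomputable section

namespace LpProjection

/-! ### Lengths of intervals and concave functions of one variable. -/

/-- One-dimensional Brunn–Minkowski inequality for compact intervals. -/
lemma add_length_le {I J L : Set ℝ} (hI : IsCompact I) (hJ : IsCompact J) (hL : IsCompact L)
    (hIc : Convex ℝ I) (hJc : Convex ℝ J) (hLc : Convex ℝ L) (hIn : I.Nonempty) (hJn : J.Nonempty)
    {a b : ℝ} (ha : 0 ≤ a) (hb : 0 ≤ b)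
    (h : ∀ x ∈ I, ∀ y ∈ J, a * x + b * y ∈ L) :
    a * volume.real I + b * volume.real J ≤ volume.real L := by
  have eI := eq_Icc_of_connected_compact ⟨hIn, hIc.isPreconnected⟩ hI
  have eJ := eq_Icc_of_connected_compact ⟨hJn, hJc.isPreconnected⟩ hJ
  have i1 := hI.sInf_mem hIn
  have i2 := hI.sSup_mem hIn
  have j1 := hJ.sInf_mem hJn
  have j2 := hJ.sSup_mem hJn
  have hi : sInf I ≤ sSup I := csInf_le_csSup hIn hI.bddBelow hI.bddAbove
  have hj : sInf J ≤ sSup J := csInf_le_csSup hJn hJ.bddBelow hJ.bddAbove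
  have hsub : Icc (a * sInf I + b * sInf J) (a * sSup I + b * sSup J) ⊆ L :=
    hLc.ordConnected.out (h _ i1 _ j1) (h _ i2 _ j2)
  have h3 := measureReal_mono (μ := volume) hsub hL.measure_lt_top.ne
  have hle : a * sInf I + b * sInf J ≤ a * sSup I + b * sSup J := by gcongr
  rw [eI, eJ, Real.volume_real_Icc_of_le hi, Real.volume_real_Icc_of_le hj]
  rw [Real.volume_real_Icc_of_le hle] at h3
  linarith

/-- A compact convex subset of the line contains two points at distance its length. -/
lemma exists_add_length_mem {I : Set ℝ} (hI : IsCompact I) (hc : Convex ℝ I)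
    (hn : I.Nonempty) : ∃ s ∈ I, s + volume.real I ∈ I := by
  have eI := eq_Icc_of_connected_compact ⟨hn, hc.isPreconnected⟩ hI
  refine ⟨sInf I, hI.sInf_mem hn, ?_⟩
  have hi : sInf I ≤ sSup I := csInf_le_csSup hn hI.bddBelow hI.bddAbove
  have : volume.real I = sSup I - sInf I := by
    rw [eI, Real.volume_real_Icc_of_le hi, csSup_Icc hi, csInf_Icc hi]
  rw [this, add_sub_cancel]
  exact hI.sSup_mem hn

/-- A concave function on `[-1, 1]` that is even, lies below `f` and touches it at `1` is constant
if `f` has vanishing left derivative at `1`. -/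
lemma eq_of_concaveOn_of_hasDerivWithinAt {f g : ℝ → ℝ}
    (hg : ConcaveOn ℝ (Icc (-1 : ℝ) 1) g) (heven : ∀ t, g (-t) = g t)
    (hle : ∀ t ∈ Icc (-1 : ℝ) 1, g t ≤ f t) (h1 : g 1 = f 1)
    (hf : HasDerivWithinAt f 0 (Iio 1) 1) {τ : ℝ} (hτ : τ ∈ Icc (-1 : ℝ) 1) : g τ = g 1 := by
  have hm1 : (-1 : ℝ) ∈ Icc (-1 : ℝ) 1 := by simp
  have hp1 : (1 : ℝ) ∈ Icc (-1 : ℝ) 1 := by simp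
  apply le_antisymm
  · rcases hτ.2.eq_or_lt with rfl | hlt
    · rfl
    rw [hasDerivWithinAt_iff_tendsto_slope' (by simp)] at hf
    -- As g ≤ f with equality at 1, the chord slope of f from t to 1 is at most that of g, and by
    -- concavity this is at most the slope of g from τ to 1. Letting t → 1 gives g τ ≤ g 1; the
    -- reverse inequality is concavity between -1 and 1 with evenness.
    have key : ∀ᶠ t in nhdsWithin 1 (Iio 1), slope f 1 t ≤ (g 1 - g τ) / (1 - τ) := by
      have hmem : Ioo τ 1 ∈ nhdsWithin (1 : ℝ) (Iio 1) := Ioo_mem_nhdsLT hlt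
      filter_upwards [hmem] with t ht
      have h2 : t ∈ Icc (-1 : ℝ) 1 := ⟨hτ.1.trans ht.1.le, ht.2.le⟩
      have hd : 0 < 1 - τ := by linarith
      have hc := hg.2 hτ hp1
        (show (0 : ℝ) ≤ (1 - t) / (1 - τ) from div_nonneg (by linarith [ht.2]) hd.le)
        (show (0 : ℝ) ≤ (t - τ) / (1 - τ) from div_nonneg (by linarith [ht.1]) hd.le)
        (by field_simp; ring)
      have e : ((1 - t) / (1 - τ)) • τ + ((t - τ) / (1 - τ)) • (1 : ℝ) = t := by
        simp only [smul_eq_mul]; field_simp; ring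
      rw [e] at hc
      simp only [smul_eq_mul] at hc
      have hft := hle t h2
      have ht0 : 0 < 1 - t := by linarith [ht.2]
      rw [slope_def_field, ← neg_div_neg_eq, div_le_iff₀ (by linarith)]
      have : (g 1 - g τ) / (1 - τ) * -(t - 1) = g 1 - ((1 - t) / (1 - τ) * g τ + (t - τ) / (1 - τ) * g 1) := by
        field_simp; ring
      rw [this]; linarith
    have h0 := le_of_tendsto hf key
    have hd : 0 < 1 - τ := by linarith
    rw [le_div_iff₀ hd] at h0
    linarith
  · have hc := hg.2 hm1 hp1 (show 0 ≤ (1 - τ) / 2 by linarith [hτ.2])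
      (show 0 ≤ (1 + τ) / 2 by linarith [hτ.1]) (by ring)
    have e : ((1 - τ) / 2) • (-1 : ℝ) + ((1 + τ) / 2) • (1 : ℝ) = τ := by
      simp only [smul_eq_mul]; ring
    rw [e, heven] at hc
    simp only [smul_eq_mul] at hc
    linarith

/-! ### Reflection families: volumes of sublevel sets and the equality case. -/

/-- A family of functions on `E × ℝ` with the convexity and symmetry properties of the `p`-th powers
of the support functions of the `L_p`-projection bodies along a linear reflection shadow system. -/
structure IsReflectionFamily {E : Type*} [NormedAddCommGroup E] [NormedSpace ℝ E] (p : ℝ)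
    (q : ℝ → E → ℝ → ℝ) : Prop where
  continuous : ∀ t ∈ Icc (-1 : ℝ) 1, Continuous fun z : E × ℝ => q t z.1 z.2
  convex_space : ∀ t ∈ Icc (-1 : ℝ) 1, ConvexOn ℝ univ fun z : E × ℝ => q t z.1 z.2
  convex_time : ∀ y, ConvexOn ℝ (Icc (-1 : ℝ) 1 ×ˢ univ) fun z : ℝ × ℝ => q z.1 y z.2
  strict : ∀ t ∈ Icc (-1 : ℝ) 1, ∀ y, StrictConvexOn ℝ univ (q t y)
  neg_time : ∀ t y s, q (-t) y s = q t y (-s)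
  homog : ∀ t y s, ∀ c : ℝ, 0 ≤ c → q t (c • y) (c * s) = c ^ p * q t y s
  bounded : ∀ t ∈ Icc (-1 : ℝ) 1, Bornology.IsBounded {z : E × ℝ | q t z.1 z.2 ≤ 1}

namespace IsReflectionFamily

variable {E : Type*} [NormedAddCommGroup E] [NormedSpace ℝ E] {p : ℝ} {q : ℝ → E → ℝ → ℝ}

lemma one_mem : (1 : ℝ) ∈ Icc (-1 : ℝ) 1 := by simp

lemma neg_one_mem : (-1 : ℝ) ∈ Icc (-1 : ℝ) 1 := by simp

variable (h : IsReflectionFamily p q)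
include h

lemma isCompact_sublevel [FiniteDimensional ℝ E] {t : ℝ} (ht : t ∈ Icc (-1 : ℝ) 1) :
    IsCompact {z : E × ℝ | q t z.1 z.2 ≤ 1} :=
  Metric.isCompact_of_isClosed_isBounded (isClosed_le (h.continuous t ht) continuous_const)
    (h.bounded t ht)

lemma isCompact_section [FiniteDimensional ℝ E] {t : ℝ} (ht : t ∈ Icc (-1 : ℝ) 1) (y : E) :
    IsCompact {s | q t y s ≤ 1} := by
  have h1 := (h.isCompact_sublevel ht).image continuous_snd
  refine h1.of_isClosed_subset (isClosed_le ?_ continuous_const) fun s hs => ⟨(y, s), hs, rfl⟩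
  exact (h.continuous t ht).comp (by fun_prop : Continuous fun s : ℝ => (y, s))

lemma convex_section {t : ℝ} (ht : t ∈ Icc (-1 : ℝ) 1) (y : E) :
    Convex ℝ {s | q t y s ≤ 1} := by
  simpa using (h.strict t ht y).convexOn.convex_le 1

lemma section_neg (t : ℝ) (y : E) : {s | q (-t) y s ≤ 1} = -{s | q t y s ≤ 1} := by
  ext s; simp [h.neg_time]

lemma length_neg (t : ℝ) (y : E) :
    volume.real {s | q (-t) y s ≤ 1} = volume.real {s | q t y s ≤ 1} := by
  rw [h.section_neg, measureReal_def, Measure.measure_neg, measureReal_def]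

lemma combo_space {t : ℝ} (ht : t ∈ Icc (-1 : ℝ) 1) {y₁ y₂ : E} {s₁ s₂ a b c : ℝ}
    (ha : 0 ≤ a) (hb : 0 ≤ b) (hab : a + b = 1) (h1 : q t y₁ s₁ ≤ c) (h2 : q t y₂ s₂ ≤ c) :
    q t (a • y₁ + b • y₂) (a * s₁ + b * s₂) ≤ c := by
  have := (h.convex_space t ht).2 (mem_univ (y₁, s₁)) (mem_univ (y₂, s₂)) ha hb hab
  simp only [Prod.smul_mk, Prod.mk_add_mk, smul_eq_mul] at this
  calc _ ≤ _ := this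
    _ ≤ a * c + b * c := by gcongr
    _ = c := by rw [← add_mul, hab, one_mul]

lemma combo_time {t₁ t₂ : ℝ} (ht₁ : t₁ ∈ Icc (-1 : ℝ) 1) (ht₂ : t₂ ∈ Icc (-1 : ℝ) 1) {y : E}
    {s₁ s₂ a b c : ℝ}
    (ha : 0 ≤ a) (hb : 0 ≤ b) (hab : a + b = 1) (h1 : q t₁ y s₁ ≤ c) (h2 : q t₂ y s₂ ≤ c) :
    q (a * t₁ + b * t₂) y (a * s₁ + b * s₂) ≤ c := by
  have := (h.convex_time y).2 (mk_mem_prod ht₁ (mem_univ s₁)) (mk_mem_prod ht₂ (mem_univ s₂))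
    ha hb hab
  simp only [Prod.smul_mk, Prod.mk_add_mk, smul_eq_mul] at this
  calc _ ≤ _ := this
    _ ≤ a * c + b * c := by gcongr
    _ = c := by rw [← add_mul, hab, one_mul]

/-- The point (1, s) and its mirror image (-1, -s) have the same value, and a convex combination of
them lies at time t. So nonempty sections at time 1 stay nonempty at all times. -/
lemma exists_lt_of_exists_lt_one {y : E} {c : ℝ} (hy : ∃ s, q 1 y s ≤ c) {t : ℝ}
    (ht : t ∈ Icc (-1 : ℝ) 1) : ∃ s, q t y s ≤ c := by
  obtain ⟨s, hs⟩ := hy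
  have hs' : q (-1) y (-s) ≤ c := by rw [h.neg_time, neg_neg]; exact hs
  have := h.combo_time one_mem neg_one_mem (a := (1 + t) / 2) (b := (1 - t) / 2)
    (by linarith [ht.1]) (by linarith [ht.2]) (by ring) hs hs'
  have e : (1 + t) / 2 * 1 + (1 - t) / 2 * -1 = t := by ring
  rw [e] at this
  exact ⟨_, this⟩

/-- The points of `E` over which the sublevel set of `q 1` has interior points. -/
lemma isOpen_base : IsOpen {y : E | ∃ s, q 1 y s < 1} := by
  have : {y : E | ∃ s, q 1 y s < 1} = ⋃ s, {y | q 1 y s < 1} := by ext; simp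
  rw [this]
  refine isOpen_iUnion fun s => isOpen_lt ?_ continuous_const
  exact (h.continuous 1 one_mem).comp (by fun_prop : Continuous fun y : E => (y, s))

lemma convex_base : Convex ℝ {y : E | ∃ s, q 1 y s < 1} := by
  rintro y₁ ⟨s₁, h1⟩ y₂ ⟨s₂, h2⟩ a b ha hb hab
  refine ⟨a * s₁ + b * s₂, ?_⟩
  -- The maximum of the two values is a common level that is still strictly below 1.
  have := h.combo_space one_mem ha hb hab (c := max (q 1 y₁ s₁) (q 1 y₂ s₂))
    (le_max_left _ _) (le_max_right _ _)
  exact this.trans_lt (max_lt h1 h2)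

lemma zero_mem_base (hp : 0 < p) : (0 : E) ∈ {y : E | ∃ s, q 1 y s < 1} := by
  refine ⟨0, ?_⟩
  have := h.homog 1 0 0 0 le_rfl
  rw [Real.zero_rpow hp.ne'] at this
  simp only [smul_zero, mul_zero, zero_mul] at this
  rw [this]; exact one_pos

/-- Used for continuity in y on the open base, which upgrades almost everywhere equality of lengths
to equality. -/
lemma concaveOn_length_space [FiniteDimensional ℝ E] {t : ℝ} (ht : t ∈ Icc (-1 : ℝ) 1) :
    ConcaveOn ℝ {y : E | ∃ s, q 1 y s < 1} fun y => volume.real {s | q t y s ≤ 1} := by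
  refine ⟨h.convex_base, ?_⟩
  rintro y₁ ⟨s₁, h1⟩ y₂ ⟨s₂, h2⟩ a b ha hb hab
  exact add_length_le (h.isCompact_section ht _) (h.isCompact_section ht _)
    (h.isCompact_section ht _) (h.convex_section ht _) (h.convex_section ht _)
    (h.convex_section ht _) (h.exists_lt_of_exists_lt_one ⟨s₁, h1.le⟩ ht)
    (h.exists_lt_of_exists_lt_one ⟨s₂, h2.le⟩ ht) ha hb
    fun x hx y hy => h.combo_space ht ha hb hab hx hy

/-- The restriction on y keeps all sections nonempty. Over other points the section may be empty
near t = ±1 and long in between, and the length need not be concave. -/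
lemma concaveOn_length_time [FiniteDimensional ℝ E] {y : E} (hy : ∃ s, q 1 y s < 1) :
    ConcaveOn ℝ (Icc (-1 : ℝ) 1) fun t => volume.real {s | q t y s ≤ 1} := by
  refine ⟨convex_Icc _ _, ?_⟩
  obtain ⟨s, hs⟩ := hy
  intro t₁ ht₁ t₂ ht₂ a b ha hb hab
  exact add_length_le (h.isCompact_section ht₁ _) (h.isCompact_section ht₂ _)
    (h.isCompact_section (convex_Icc _ _ ht₁ ht₂ ha hb hab) _) (h.convex_section ht₁ _)
    (h.convex_section ht₂ _) (h.convex_section (convex_Icc _ _ ht₁ ht₂ ha hb hab) _)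
    (h.exists_lt_of_exists_lt_one ⟨s, hs.le⟩ ht₁) (h.exists_lt_of_exists_lt_one ⟨s, hs.le⟩ ht₂)
    ha hb fun x hx y hy => h.combo_time ht₁ ht₂ ha hb hab hx hy

lemma length_one_le [FiniteDimensional ℝ E] {y : E} (hy : ∃ s, q 1 y s < 1) {t : ℝ}
    (ht : t ∈ Icc (-1 : ℝ) 1) :
    volume.real {s | q 1 y s ≤ 1} ≤ volume.real {s | q t y s ≤ 1} := by
  have := (h.concaveOn_length_time hy).2 one_mem neg_one_mem
    (show 0 ≤ (1 + t) / 2 by linarith [ht.1]) (show 0 ≤ (1 - t) / 2 by linarith [ht.2]) (by ring)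
  have e : (1 + t) / 2 * 1 + (1 - t) / 2 * -1 = t := by ring
  simp only [smul_eq_mul, e, h.length_neg] at this
  linarith

/-- By strict convexity the midpoint has value below 1. So a section at time 1 without such a point
has length zero. -/
lemma mem_base_of_two_points {y : E} {s₁ s₂ : ℝ} (hs : s₁ ≠ s₂) (h1 : q 1 y s₁ ≤ 1)
    (h2 : q 1 y s₂ ≤ 1) : ∃ s, q 1 y s < 1 := by
  have := (h.strict 1 one_mem y).2 (mem_univ s₁) (mem_univ s₂) hs
    (show (0 : ℝ) < 1 / 2 by norm_num) (show (0 : ℝ) < 1 / 2 by norm_num) (by norm_num)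
  refine ⟨_, this.trans_le ?_⟩
  simp only [smul_eq_mul]
  linarith

lemma length_one_eq_zero {y : E} (hy : ¬ ∃ s, q 1 y s < 1) :
    volume.real {s | q 1 y s ≤ 1} = 0 := by
  have : {s | q 1 y s ≤ 1}.Subsingleton := by
    intro a ha b hb
    by_contra hab
    exact hy (h.mem_base_of_two_points hab ha hb)
  rw [measureReal_def, this.measure_zero, ENNReal.toReal_zero]

/-- Continuation along the ray through y. By homogeneity, a section of length l over y at time t
forces length at least δl over c • y for δ ≤ c ≤ 1. As long as c • y stays in the base, the section
at time 1 is equally long; this bound survives in the limit, and by strict convexity a section of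
positive length puts the limit back in the open base. So y itself would lie in the base. -/
lemma length_eq_zero [FiniteDimensional ℝ E] (hp : 0 < p) {t : ℝ} (ht : t ∈ Icc (-1 : ℝ) 1)
    (heq : ∀ y, (∃ s, q 1 y s < 1) → volume.real {s | q t y s ≤ 1} = volume.real {s | q 1 y s ≤ 1})
    {y : E} (hy : ¬ ∃ s, q 1 y s < 1) : volume.real {s | q t y s ≤ 1} = 0 := by
  by_contra hne
  set l := volume.real {s | q t y s ≤ 1} with hl
  have hlpos : 0 < l := lt_of_le_of_ne measureReal_nonneg (Ne.symm hne)
  have hnon : {s | q t y s ≤ 1}.Nonempty := by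
    rw [nonempty_iff_ne_empty]
    intro h0
    rw [h0] at hl
    simp at hl
    exact hne hl
  set W := {y : E | ∃ s, q 1 y s < 1} with hW
  have hWo : IsOpen W := h.isOpen_base
  -- a small multiple of `y` lies in `W`
  have hcont : Continuous fun c : ℝ => c • y := by fun_prop
  have h0 : ∀ᶠ c in nhds (0 : ℝ), c • y ∈ W := by
    apply hcont.continuousAt.eventually_mem
    rw [zero_smul]
    exact hWo.mem_nhds (h.zero_mem_base hp)
  obtain ⟨ε, hε, hε'⟩ := Metric.eventually_nhds_iff_ball.1 h0
  set δ := min (ε / 2) 1 with hδ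
  have hδpos : 0 < δ := lt_min (by linarith) one_pos
  have hδW : δ • y ∈ W := by
    apply hε'
    rw [mem_ball_zero_iff, Real.norm_of_nonneg hδpos.le]
    exact (min_le_left _ _).trans_lt (by linarith)
  -- "Length at least δl at time 1", stated through two points of the section so that compactness
  -- makes the condition closed in c.
  set P : Set ℝ := {c | ∃ s, q 1 (c • y) s ≤ 1 ∧ q 1 (c • y) (s + δ * l) ≤ 1} with hP
  have hPW : ∀ c ∈ P, c • y ∈ W := by
    rintro c ⟨s, h1, h2⟩
    exact h.mem_base_of_two_points (by have := mul_pos hδpos hlpos; linarith) h1 h2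
  have hWP : ∀ c ∈ Icc δ 1, c • y ∈ W → c ∈ P := by
    intro c hc hcW
    have hcpos : 0 < c := hδpos.trans_le hc.1
    have hlen : δ * l ≤ volume.real {s | q 1 (c • y) s ≤ 1} := by
      rw [← heq _ hcW]
      -- The section over 0 only fills the second slot of `add_length_le`, with coefficient 0.
      have hz : ∃ s, q t (0 : E) s ≤ 1 := by
        obtain ⟨s, hs⟩ := h.zero_mem_base hp
        exact h.exists_lt_of_exists_lt_one ⟨s, hs.le⟩ ht
      have := add_length_le (a := c) (b := 0) (h.isCompact_section ht y)
        (h.isCompact_section ht (0 : E)) (h.isCompact_section ht (c • y)) (h.convex_section ht _)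
        (h.convex_section ht _) (h.convex_section ht _) hnon hz hcpos.le le_rfl (by
          intro s hs s' _
          simp only [mem_ofPred_eq, zero_mul, add_zero] at hs ⊢
          rw [h.homog _ _ _ _ hcpos.le]
          have h1 : c ^ p ≤ 1 := Real.rpow_le_one hcpos.le hc.2 hp.le
          have h2 : 0 ≤ c ^ p := Real.rpow_nonneg hcpos.le _
          nlinarith)
      have h3 : δ * l ≤ c * l := by gcongr; exact hc.1
      linarith
    obtain ⟨s, hs1, hs2⟩ := exists_add_length_mem (h.isCompact_section one_mem (c • y))
      (h.convex_section one_mem _) ⟨hcW.choose, hcW.choose_spec.le⟩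
    refine ⟨s, hs1, ?_⟩
    refine (h.convex_section one_mem (c • y)).ordConnected.out hs1 hs2 ⟨?_, ?_⟩
    · have := mul_pos hδpos hlpos; linarith
    · linarith
  have hclosed : IsClosed (P ∩ Icc δ 1) := by
    have hc1 : IsCompact {z : ℝ × ℝ | z.1 ∈ Icc δ 1 ∧ q 1 (z.1 • y) z.2 ≤ 1 ∧
        q 1 (z.1 • y) (z.2 + δ * l) ≤ 1} := by
      have hb := (h.isCompact_sublevel one_mem).image continuous_snd
      refine ((isCompact_Icc (a := δ) (b := (1 : ℝ))).prod hb).of_isClosed_subset ?_ ?_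
      · refine IsClosed.and (isClosed_Icc.preimage continuous_fst)
          (IsClosed.and (isClosed_le ?_ continuous_const) (isClosed_le ?_ continuous_const))
        · exact (h.continuous 1 one_mem).comp
            (by fun_prop : Continuous fun z : ℝ × ℝ => (z.1 • y, z.2))
        · exact (h.continuous 1 one_mem).comp
            (by fun_prop : Continuous fun z : ℝ × ℝ => (z.1 • y, z.2 + δ * l))
      · rintro ⟨c, s⟩ ⟨h1, h2, _⟩
        exact ⟨h1, ⟨(c • y, s), h2, rfl⟩⟩
    have : P ∩ Icc δ 1 = Prod.fst '' {z : ℝ × ℝ | z.1 ∈ Icc δ 1 ∧ q 1 (z.1 • y) z.2 ≤ 1 ∧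
        q 1 (z.1 • y) (z.2 + δ * l) ≤ 1} := by
      ext c
      constructor
      · rintro ⟨⟨s, h1, h2⟩, hc⟩
        exact ⟨(c, s), ⟨hc, h1, h2⟩, rfl⟩
      · rintro ⟨⟨c', s⟩, ⟨hc, h1, h2⟩, rfl⟩
        exact ⟨⟨s, h1, h2⟩, hc⟩
    rw [this]
    exact (hc1.image continuous_fst).isClosed
  have hδ1 : δ ≤ 1 := min_le_right _ _
  have hall := hclosed.Icc_subset_of_forall_mem_nhdsWithin
    (hWP δ ⟨le_rfl, hδ1⟩ hδW) (by
      rintro c ⟨hcP, hc⟩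
      have hcW : c • y ∈ W := hPW c hcP
      have h1 : ∀ᶠ c' in nhds c, c' • y ∈ W :=
        hcont.continuousAt.eventually_mem (hWo.mem_nhds hcW)
      have h2 : Ioo c 1 ∈ nhdsWithin c (Ioi c) := Ioo_mem_nhdsGT hc.2
      filter_upwards [h1.filter_mono nhdsWithin_le_nhds, h2] with c' h3 h4
      exact hWP c' ⟨hc.1.trans h4.1.le, h4.2.le⟩ h3)
  have := hPW 1 (hall ⟨hδ1, le_rfl⟩)
  rw [one_smul] at this
  exact hy this

section Measure

variable [FiniteDimensional ℝ E] [MeasurableSpace E] [BorelSpace E] (μ : Measure E)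

lemma volume_eq_integral_length {t : ℝ} (ht : t ∈ Icc (-1 : ℝ) 1) :
    (μ.prod volume).real {z : E × ℝ | q t z.1 z.2 ≤ 1} =
      ∫ y, volume.real {s | q t y s ≤ 1} ∂μ := by
  rw [measureReal_def, Measure.prod_apply ((h.isCompact_sublevel ht).measurableSet)]
  symm
  refine integral_toReal ?_ (Filter.Eventually.of_forall fun y =>
    (h.isCompact_section ht y).measure_lt_top)
  exact (measurable_measure_prodMk_left ((h.isCompact_sublevel ht).measurableSet)).aemeasurable

variable [μ.IsAddHaarMeasure]

lemma integrable_length {t : ℝ} (ht : t ∈ Icc (-1 : ℝ) 1) :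
    Integrable (fun y => volume.real {s | q t y s ≤ 1}) μ :=
  Measure.integrable_measure_prodMk_left ((h.isCompact_sublevel ht).measurableSet)
    (h.isCompact_sublevel ht).measure_lt_top.ne

/-- If the volume of the sublevel sets `{q t ≤ 1}` has vanishing left derivative at `1`, then it is
constant. -/
theorem volume_eq (hp : 0 < p)
    (hd : HasDerivWithinAt (fun t => (μ.prod volume).real {z : E × ℝ | q t z.1 z.2 ≤ 1})
      0 (Iio 1) 1) {t : ℝ} (ht : t ∈ Icc (-1 : ℝ) 1) :
    (μ.prod volume).real {z : E × ℝ | q t z.1 z.2 ≤ 1} =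
      (μ.prod volume).real {z : E × ℝ | q 1 z.1 z.2 ≤ 1} := by
  set W := {y : E | ∃ s, q 1 y s < 1} with hW
  have hWo : IsOpen W := h.isOpen_base
  have hWm : MeasurableSet W := hWo.measurableSet
  -- Integrating over the fixed set `W` rather than the whole space is what makes g concave; at t =
  -- 1 nothing is lost, since sections outside `W` have length zero there.
  set g : ℝ → ℝ := fun t => ∫ y in W, volume.real {s | q t y s ≤ 1} ∂μ with hg
  have hgconc : ConcaveOn ℝ (Icc (-1 : ℝ) 1) g := by
    refine ⟨convex_Icc _ _, ?_⟩
    intro t₁ ht₁ t₂ ht₂ a b ha hb hab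
    simp only [hg, smul_eq_mul]
    rw [← integral_const_mul, ← integral_const_mul, ← integral_add
      ((h.integrable_length μ ht₁).restrict.const_mul _)
      ((h.integrable_length μ ht₂).restrict.const_mul _)]
    refine setIntegral_mono_on (((h.integrable_length μ ht₁).restrict.const_mul _).add
      ((h.integrable_length μ ht₂).restrict.const_mul _))
      (h.integrable_length μ (convex_Icc _ _ ht₁ ht₂ ha hb hab)).restrict hWm fun y hy => ?_
    exact (h.concaveOn_length_time hy).2 ht₁ ht₂ ha hb hab
  have hgeven : ∀ t, g (-t) = g t := fun t => by simp only [hg, h.length_neg]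
  have hgle : ∀ t ∈ Icc (-1 : ℝ) 1, g t ≤ (μ.prod volume).real {z : E × ℝ | q t z.1 z.2 ≤ 1} := by
    intro t ht
    rw [h.volume_eq_integral_length μ ht]
    exact setIntegral_le_integral (h.integrable_length μ ht)
      (Filter.Eventually.of_forall fun y => measureReal_nonneg)
  have hg1 : g 1 = (μ.prod volume).real {z : E × ℝ | q 1 z.1 z.2 ≤ 1} := by
    rw [h.volume_eq_integral_length μ one_mem]
    exact setIntegral_eq_integral_of_forall_compl_eq_zero fun y hy => h.length_one_eq_zero hy
  have hgt : g t = g 1 := eq_of_concaveOn_of_hasDerivWithinAt hgconc hgeven hgle hg1 hd ht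
  -- The nonnegative function ℓ_t - ℓ_1 has integral zero on the open set `W` and is continuous
  -- there.
  have heq : ∀ y ∈ W, volume.real {s | q t y s ≤ 1} = volume.real {s | q 1 y s ≤ 1} := by
    have h0 : ∫ y in W, (volume.real {s | q t y s ≤ 1} - volume.real {s | q 1 y s ≤ 1}) ∂μ = 0 := by
      rw [integral_sub (h.integrable_length μ ht).restrict
        (h.integrable_length μ one_mem).restrict]
      exact sub_eq_zero.2 hgt
    rw [setIntegral_eq_zero_iff_of_nonneg_ae
      ((ae_restrict_iff' hWm).2 (Filter.Eventually.of_forall fun y hy =>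
        sub_nonneg.2 (h.length_one_le hy ht)))
      ((h.integrable_length μ ht).sub (h.integrable_length μ one_mem)).integrableOn] at h0
    have := Measure.eqOn_open_of_ae_eq h0 hWo
      (((h.concaveOn_length_space ht).continuousOn hWo).sub
        ((h.concaveOn_length_space one_mem).continuousOn hWo)) continuousOn_const
    intro y hy
    exact sub_eq_zero.1 (this hy)
  rw [h.volume_eq_integral_length μ ht, h.volume_eq_integral_length μ one_mem]
  congr 1
  ext y
  by_cases hy : y ∈ W
  · exact heq y hy
  · rw [h.length_eq_zero hp ht heq hy, h.length_one_eq_zero hy]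

end Measure

end IsReflectionFamily

end LpProjection

/-! ### Polar bodies as sublevel sets. -/

namespace LpProjection

/-- The `p`-th root of a nonnegative, convex, `p`-homogeneous function is subadditive. -/
lemma rpow_inv_add_le {V : Type*} [AddCommGroup V] [Module ℝ V] {p : ℝ} (hp : 0 < p) {Φ : V → ℝ}
    (hΦ : ConvexOn ℝ univ Φ) (h0 : ∀ v, 0 ≤ Φ v)
    (hom : ∀ v, ∀ c : ℝ, 0 ≤ c → Φ (c • v) = c ^ p * Φ v) (x y : V) :
    Φ (x + y) ^ (1 / p) ≤ Φ x ^ (1 / p) + Φ y ^ (1 / p) := by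
  have hN : ∀ v, 0 ≤ Φ v ^ (1 / p) := fun v => Real.rpow_nonneg (h0 v) _
  have hNp : ∀ v, (Φ v ^ (1 / p)) ^ p = Φ v := fun v => by
    rw [← Real.rpow_mul (h0 v), one_div_mul_cancel hp.ne', Real.rpow_one]
  have hscale : ∀ v, ∀ a : ℝ, 0 < a → Φ v ^ (1 / p) ≤ a → Φ (a⁻¹ • v) ≤ 1 := by
    intro v a ha hva
    rw [hom _ _ (inv_nonneg.2 ha.le), ← hNp v, ← Real.mul_rpow (inv_nonneg.2 ha.le) (hN v)]
    refine Real.rpow_le_one (mul_nonneg (inv_nonneg.2 ha.le) (hN v)) ?_ hp.le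
    rw [inv_mul_le_iff₀ ha, mul_one]
    exact hva
  -- The slack ε allows division by a and b even where Φ vanishes. With weights a/(a+b) and b/(a+b),
  -- this is the usual proof that the gauge of the convex set {Φ ≤ 1} is subadditive.
  refine le_of_forall_pos_le_add fun ε hε => ?_
  set a := Φ x ^ (1 / p) + ε / 2 with ha
  set b := Φ y ^ (1 / p) + ε / 2 with hb
  have hapos : 0 < a := by have := hN x; positivity
  have hbpos : 0 < b := by have := hN y; positivity
  have hab : 0 < a + b := by positivity
  have hc := hΦ.2 (mem_univ (a⁻¹ • x)) (mem_univ (b⁻¹ • y)) (show 0 ≤ a / (a + b) by positivity)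
    (show 0 ≤ b / (a + b) by positivity) (by field_simp)
  have e : (a / (a + b)) • a⁻¹ • x + (b / (a + b)) • b⁻¹ • y = (a + b)⁻¹ • (x + y) := by
    rw [smul_smul, smul_smul, smul_add]
    congr 2 <;> field_simp
  rw [e, hom _ _ (inv_nonneg.2 hab.le), smul_eq_mul, smul_eq_mul] at hc
  have h1 := hscale x a hapos (by rw [ha]; linarith)
  have h2 := hscale y b hbpos (by rw [hb]; linarith)
  have h3 : (a + b)⁻¹ ^ p * Φ (x + y) ≤ 1 := by
    refine hc.trans ?_
    calc _ ≤ a / (a + b) * 1 + b / (a + b) * 1 := by gcongr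
      _ = 1 := by field_simp
  have h4 : Φ (x + y) ≤ (a + b) ^ p := by
    rw [Real.inv_rpow hab.le, inv_mul_le_iff₀ (Real.rpow_pos_of_pos hab _), mul_one] at h3
    exact h3
  calc Φ (x + y) ^ (1 / p) ≤ ((a + b) ^ p) ^ (1 / p) :=
        Real.rpow_le_rpow (h0 _) h4 (by positivity)
    _ = a + b := by rw [← Real.rpow_mul hab.le, mul_one_div_cancel hp.ne', Real.rpow_one]
    _ = _ := by rw [ha, hb]; ring

variable {n : ℕ}

/-- The polar of the convex body with a sublinear support function `h` is `{h ≤ 1}`. -/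
lemma polarBody_of_sublinear {h : EuclideanSpace ℝ (Fin n) → ℝ}
    (hom : ∀ c : ℝ, 0 < c → ∀ x, h (c • x) = c * h x) (hadd : ∀ x y, h (x + y) ≤ h x + h y) :
    polarBody {x | ∀ v, ⟪x, v⟫ ≤ h v} = {v | h v ≤ 1} := by
  ext v
  constructor
  · intro hv
    have h0 : h 0 = 0 := by
      have := hom 2 two_pos 0
      rw [smul_zero] at this; linarith
    by_cases hv0 : v = 0
    · simp [hv0, h0]
    -- Hahn–Banach: a linear functional dominated by h that agrees with h at v. Its Riesz vector is
    -- a point of the body where the supremum h v is attained.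
    obtain ⟨g, hg, hgle⟩ := exists_extension_of_le_sublinear
      (LinearPMap.mkSpanSingleton v (h v) hv0) h hom hadd (by
        rintro ⟨x, hx⟩
        obtain ⟨c, rfl⟩ := Submodule.mem_span_singleton.1 hx
        have e0 : LinearPMap.mkSpanSingleton v (h v) hv0 ⟨c • v, hx⟩ = c * h v :=
          LinearPMap.mkSpanSingleton'_apply _ _ _ c hx
        rw [e0]; change c * h v ≤ h (c • v)
        rcases lt_trichotomy c 0 with hc | rfl | hc
        · have e : c • v = (-c) • (-v) := by simp
          rw [e, hom _ (neg_pos.2 hc)]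
          have := hadd v (-v)
          rw [add_neg_cancel, h0] at this
          nlinarith
        · simp [h0]
        · rw [hom _ hc])
    have hgv : g v = h v := by
      have := hg ⟨v, Submodule.mem_span_singleton_self v⟩
      rw [this, LinearPMap.mkSpanSingleton_apply _ _ hv0]
    set x := (InnerProductSpace.toDual ℝ (EuclideanSpace ℝ (Fin n))).symm
      (LinearMap.toContinuousLinearMap g) with hx
    have hxg : ∀ w, ⟪x, w⟫ = g w := fun w => by
      rw [hx, InnerProductSpace.toDual_symm_apply]; rfl
    have := hv x (fun w => by rw [hxg]; exact hgle w)
    rw [real_inner_comm, hxg, hgv] at this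
    exact this
  · intro hv y hy
    rw [real_inner_comm]
    exact (hy v).trans hv

lemma polarBody_lpProjectionBody {p : ℝ} (hp : 0 < p) {L : Set (EuclideanSpace ℝ (Fin n))}
    {Φ : EuclideanSpace ℝ (Fin n) → ℝ} (hL : ∀ v, lpProjectionSupport p L v = Φ v ^ (1 / p))
    (hΦ : ConvexOn ℝ univ Φ) (h0 : ∀ v, 0 ≤ Φ v)
    (hom : ∀ v, ∀ c : ℝ, 0 ≤ c → Φ (c • v) = c ^ p * Φ v) :
    polarBody (lpProjectionBody p L) = {v | Φ v ≤ 1} := by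
  have hb : lpProjectionBody p L = {x | ∀ v, ⟪x, v⟫ ≤ Φ v ^ (1 / p)} := by
    simp only [lpProjectionBody, hL]
  rw [hb, polarBody_of_sublinear]
  · ext v
    have := Real.rpow_le_rpow_iff (h0 v) zero_le_one (show 0 < 1 / p by positivity)
    rwa [Real.one_rpow] at this
  · intro c hc x
    rw [hom _ _ hc.le, Real.mul_rpow (Real.rpow_nonneg hc.le _) (h0 x), ← Real.rpow_mul hc.le,
      mul_one_div_cancel hp.ne', Real.rpow_one]
  · exact rpow_inv_add_le hp hΦ h0 hom

lemma omega_pos {r : ℝ} (hr : -2 < r) : 0 < omega r :=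
  div_pos (Real.rpow_pos_of_pos Real.pi_pos _) (Real.Gamma_pos_of_pos (by linarith))

lemma normalization_pos {p : ℝ} (hn : 2 ≤ n) (hp : 1 < p) :
    0 < 1 / (n * omega n * cConst (n - 2) p) := by
  have h2 : (2 : ℝ) ≤ n := by exact_mod_cast hn
  have h1 : 0 < omega n := omega_pos (by linarith)
  have h3 : 0 < cConst (n - 2) p := by
    unfold cConst
    exact div_pos (omega_pos (by linarith)) (mul_pos (mul_pos (omega_pos (by linarith))
      (omega_pos (by linarith))) (omega_pos (by linarith)))
  positivity

end LpProjection

/-! ### The area formula for graphs over a hyperplane. -/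

namespace LpProjection

/-- If `f` contracts distances relative to `g` up to the factor `c`, then the Hausdorff measure of
an image under `f` is at most `c ^ d` times that of the image under `g`. -/
lemma euclideanHausdorffMeasure_image_le_of_dist_le {X Y Z : Type*} [Nonempty X]
    [MetricSpace Y] [MeasurableSpace Y] [BorelSpace Y] [MetricSpace Z] [MeasurableSpace Z]
    [BorelSpace Z] (d : ℕ) {f : X → Y} {g : X → Z} {B : Set X} {c : NNReal}
    (h : ∀ x ∈ B, ∀ y ∈ B, dist (f x) (f y) ≤ c * dist (g x) (g y)) :
    μHE[d] (f '' B) ≤ (c : ENNReal) ^ d * μHE[d] (g '' B) := by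
  -- The map k sends g x to f x. The distance bound makes it independent of the chosen preimage and
  -- Lipschitz with constant c.
  set k : Z → Y := f ∘ Function.invFunOn g B with hk
  have hinv : ∀ x ∈ B, Function.invFunOn g B (g x) ∈ B ∧
      g (Function.invFunOn g B (g x)) = g x := fun x hx =>
    ⟨Function.invFunOn_mem ⟨x, hx, rfl⟩, Function.invFunOn_eq ⟨x, hx, rfl⟩⟩
  have himage : k '' (g '' B) = f '' B := by
    rw [image_image]
    refine image_congr fun x hx => ?_
    obtain ⟨h1, h2⟩ := hinv x hx
    have := h _ h1 _ hx
    rw [h2, dist_self, mul_zero] at this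
    exact dist_le_zero.1 this
  have hlip : LipschitzOnWith c k (g '' B) := by
    refine LipschitzOnWith.of_dist_le_mul ?_
    rintro _ ⟨x, hx, rfl⟩ _ ⟨y, hy, rfl⟩
    obtain ⟨h1, h2⟩ := hinv x hx
    obtain ⟨h3, h4⟩ := hinv y hy
    have := h _ h1 _ h3
    rwa [h2, h4] at this
  have := hlip.hausdorffMeasure_image_le (d := (d : ℝ)) (Nat.cast_nonneg d)
  rw [himage, ENNReal.rpow_natCast] at this
  simp only [Measure.euclideanHausdorffMeasure_def, Measure.smul_apply, ENNReal.smul_def,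
    smul_eq_mul]
  calc _ ≤ _ := mul_le_mul_right this _
    _ = _ := by ring

variable {V : Type*} [NormedAddCommGroup V] [InnerProductSpace ℝ V] {u : V}

lemma inner_coe_orthogonal (u : V) (y : (ℝ ∙ u)ᗮ) : ⟪(y : V), u⟫ = 0 := by
  rw [real_inner_comm]
  exact Submodule.mem_orthogonal_singleton_iff_inner_right.1 y.2

lemma inner_coe_orthogonal' (u : V) (y : (ℝ ∙ u)ᗮ) : ⟪u, (y : V)⟫ = 0 :=
  Submodule.mem_orthogonal_singleton_iff_inner_right.1 y.2

lemma norm_sq_add_smul (hu : ‖u‖ = 1) (y : (ℝ ∙ u)ᗮ) (s : ℝ) :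
    ‖(y : V) + s • u‖ ^ 2 = ‖y‖ ^ 2 + s ^ 2 := by
  rw [norm_add_sq_real, inner_smul_right, inner_coe_orthogonal, norm_smul, hu]
  simp

lemma inner_add_smul (hu : ‖u‖ = 1) (y z : (ℝ ∙ u)ᗮ) (s r : ℝ) :
    ⟪(y : V) + s • u, (z : V) + r • u⟫ = ⟪y, z⟫ + s * r := by
  simp only [inner_add_left, inner_add_right, inner_smul_left, inner_smul_right,
    inner_coe_orthogonal, inner_coe_orthogonal', real_inner_self_eq_norm_sq, hu,
    Submodule.coe_inner]
  simp [mul_comm]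

/-- The orthogonal projection onto `u^⊥`. -/
def proj (u : V) : V →L[ℝ] (ℝ ∙ u)ᗮ := (ℝ ∙ u)ᗮ.orthogonalProjectionOnto

lemma proj_add_smul (u : V) (y : (ℝ ∙ u)ᗮ) (s : ℝ) : proj u ((y : V) + s • u) = y := by
  rw [proj, map_add, Submodule.orthogonalProjectionOnto_mem_subspace_eq_self, map_smul,
    Submodule.orthogonalProjectionOnto_orthogonal_apply_eq_zero
      (Submodule.mem_span_singleton_self u), smul_zero, add_zero]

lemma eq_proj_add_smul (hu : ‖u‖ = 1) (x : V) : x = (proj u x : V) + ⟪x, u⟫ • u := by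
  have h : x - ⟪x, u⟫ • u ∈ (ℝ ∙ u)ᗮ := by
    rw [Submodule.mem_orthogonal_singleton_iff_inner_right, inner_sub_right, inner_smul_right,
      real_inner_self_eq_norm_sq, hu, real_inner_comm]
    ring
  have e : x = ((⟨_, h⟩ : (ℝ ∙ u)ᗮ) : V) + ⟪x, u⟫ • u := by simp
  have h2 : proj u x = ⟨_, h⟩ := by
    nth_rewrite 1 [e]
    exact proj_add_smul u _ _
  rw [h2]; exact e

/-- The parametrization `y ↦ y + F(y) u` of the graph of a function on `u^⊥`. -/
def graphMap (u : V) (F : (ℝ ∙ u)ᗮ → ℝ) (y : (ℝ ∙ u)ᗮ) : V := (y : V) + F y • u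

/-- The derivative of `graphMap` in terms of the derivative of the function. -/
def graphLin (u : V) (a : (ℝ ∙ u)ᗮ →L[ℝ] ℝ) : (ℝ ∙ u)ᗮ →L[ℝ] V :=
  (ℝ ∙ u)ᗮ.subtypeL + a.smulRight u

lemma graphLin_apply (a : (ℝ ∙ u)ᗮ →L[ℝ] ℝ) (y : (ℝ ∙ u)ᗮ) :
    graphLin u a y = (y : V) + a y • u := rfl

lemma hasFDerivAt_graphMap {F : (ℝ ∙ u)ᗮ → ℝ} {F' : (ℝ ∙ u)ᗮ →L[ℝ] ℝ} {y : (ℝ ∙ u)ᗮ}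
    (h : HasFDerivAt F F' y) : HasFDerivAt (graphMap u F) (graphLin u F') y :=
  (ℝ ∙ u)ᗮ.subtypeL.hasFDerivAt.add (h.smul_const u)

lemma norm_le_norm_graphLin (hu : ‖u‖ = 1) (a : (ℝ ∙ u)ᗮ →L[ℝ] ℝ) (y : (ℝ ∙ u)ᗮ) :
    ‖y‖ ≤ ‖graphLin u a y‖ := by
  refine abs_le_of_sq_le_sq' ?_ (norm_nonneg _) |>.2
  rw [graphLin_apply, norm_sq_add_smul hu]
  nlinarith [sq_nonneg (a y)]

variable [FiniteDimensional ℝ V]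

/-- For A = `graphLin u a`, the map A^*A is the identity plus the rank-one map y ↦ a(y)α, where α
represents a; its determinant is 1 + a(α) = 1 + ‖a‖². -/
lemma normDet_graphLin (hu : ‖u‖ = 1) (a : (ℝ ∙ u)ᗮ →L[ℝ] ℝ) :
    (graphLin u a).toLinearMap.normDet = √(1 + ‖a‖ ^ 2) := by
  set α := (InnerProductSpace.toDual ℝ (ℝ ∙ u)ᗮ).symm a with hα
  have haα : ∀ y, a y = ⟪α, y⟫ := fun y => by
    rw [hα, InnerProductSpace.toDual_symm_apply]
  have hnorm : ‖α‖ = ‖a‖ := by rw [hα, LinearIsometryEquiv.norm_map]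
  have h1 : (graphLin u a).toLinearMap.adjoint ∘ₗ (graphLin u a).toLinearMap =
      LinearMap.transvection a.toLinearMap α := by
    refine LinearMap.ext fun y => ext_inner_right ℝ fun z => ?_
    rw [LinearMap.comp_apply, LinearMap.adjoint_inner_left, LinearMap.transvection.apply]
    simp only [ContinuousLinearMap.coe_coe, graphLin_apply]
    rw [inner_add_smul hu, inner_add_left, inner_smul_left, haα z]
    simp
  have h2 := LinearMap.normDet_sq (graphLin u a).toLinearMap
  rw [h1, LinearMap.transvection.det] at h2
  have h3 : a.toLinearMap α = ‖a‖ ^ 2 := by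
    rw [← hnorm, ContinuousLinearMap.coe_coe, haα, real_inner_self_eq_norm_sq]
  rw [h3] at h2
  rw [← h2]
  simp only [RCLike.ofReal_real_eq_id, id_eq]
  rw [Real.sqrt_sq (LinearMap.normDet_nonneg _)]

variable [MeasurableSpace V] [BorelSpace V]

/-- The function r ↦ √(1 + r²) is 1-Lipschitz and at least 1, so an additive error c - 1 becomes a
factor c. -/
lemma sqrt_one_add_sq_le {a b c : ℝ} (hc : 1 ≤ c) (h : |a - b| ≤ c - 1) :
    √(1 + a ^ 2) ≤ c * √(1 + b ^ 2) := by
  refine Real.sqrt_le_iff.2 ⟨by positivity, ?_⟩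
  rw [mul_pow, Real.sq_sqrt (by positivity)]
  have h1 : |a| ≤ |b| + (c - 1) := by
    have := abs_sub_abs_le_abs_sub a b; linarith
  have h2 : a ^ 2 ≤ (|b| + (c - 1)) ^ 2 := by
    rw [← sq_abs]; exact pow_le_pow_left₀ (abs_nonneg a) h1 2
  have h3 : 2 * |b| ≤ 1 + b ^ 2 := by rw [← sq_abs b]; nlinarith [sq_nonneg (|b| - 1)]
  have h4 : 0 ≤ 2 + (c + 1) * b ^ 2 - 2 * |b| := by nlinarith [sq_nonneg b]
  nlinarith [sq_abs b, mul_nonneg (sub_nonneg.2 hc) h4]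

/-- Comparison of the Hausdorff measure of a piece of graph with the area integral, on a set where
the function is close to a linear one. -/
lemma graph_measure_compare (hu : ‖u‖ = 1) {F : (ℝ ∙ u)ᗮ → ℝ} {B : Set (ℝ ∙ u)ᗮ}
    (hB : MeasurableSet B) {a : (ℝ ∙ u)ᗮ →L[ℝ] ℝ} {c δ : NNReal} (hδ : 1 + δ ≤ c)
    (hδ' : 1 ≤ c * (1 - (δ : ℝ))) (happ : ApproximatesLinearOn (graphMap u F) (graphLin u a) B δ)
    (hder : ∀ x ∈ B, ‖fderiv ℝ F x - a‖ ≤ δ) :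
    μHE[Module.finrank ℝ (ℝ ∙ u)ᗮ] (graphMap u F '' B) ≤
      (c : ENNReal) ^ (Module.finrank ℝ (ℝ ∙ u)ᗮ + 1) *
        ∫⁻ x in B, ENNReal.ofReal √(1 + ‖fderiv ℝ F x‖ ^ 2) ∧
    ∫⁻ x in B, ENNReal.ofReal √(1 + ‖fderiv ℝ F x‖ ^ 2) ≤
      (c : ENNReal) ^ (Module.finrank ℝ (ℝ ∙ u)ᗮ + 1) *
        μHE[Module.finrank ℝ (ℝ ∙ u)ᗮ] (graphMap u F '' B) := by
  have hδr : 1 + (δ : ℝ) ≤ c := by exact_mod_cast hδ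
  have hc1 : (1 : ℝ) ≤ c := by linarith [δ.2]
  have hA := LinearMap.euclideanHausdorffMeasure_image_eq_normDet_mul_volume
    (graphLin u a).toLinearMap B
  rw [normDet_graphLin hu] at hA
  -- The linear graph map does not shrink vectors, so the additive error δ‖x - y‖ is relative to
  -- ‖A(x - y)‖. Distances on the graph and on the tangent plane then differ by a factor at most c.
  -- The exponent in the result counts one factor for each dimension and one for the Jacobian.
  have hAG : ∀ x ∈ B, ∀ y ∈ B, ‖graphMap u F x - graphMap u F y - graphLin u a (x - y)‖ ≤
      δ * ‖graphLin u a (x - y)‖ := fun x hx y hy =>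
    (happ x hx y hy).trans (by gcongr; exact norm_le_norm_graphLin hu a _)
  have h1 : μHE[Module.finrank ℝ (ℝ ∙ u)ᗮ] (graphMap u F '' B) ≤
      (c : ENNReal) ^ (Module.finrank ℝ (ℝ ∙ u)ᗮ) *
        μHE[Module.finrank ℝ (ℝ ∙ u)ᗮ] ((graphLin u a).toLinearMap '' B) := by
    refine euclideanHausdorffMeasure_image_le_of_dist_le _ fun x hx y hy => ?_
    rw [dist_eq_norm, dist_eq_norm, ← map_sub, ContinuousLinearMap.coe_coe]
    have := hAG x hx y hy
    have h2 := norm_le_norm_add_norm_sub' (graphMap u F x - graphMap u F y) (graphLin u a (x - y))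
    have := norm_nonneg (graphLin u a (x - y))
    nlinarith
  have h2 : μHE[Module.finrank ℝ (ℝ ∙ u)ᗮ] ((graphLin u a).toLinearMap '' B) ≤
      (c : ENNReal) ^ (Module.finrank ℝ (ℝ ∙ u)ᗮ) *
        μHE[Module.finrank ℝ (ℝ ∙ u)ᗮ] (graphMap u F '' B) := by
    refine euclideanHausdorffMeasure_image_le_of_dist_le _ fun x hx y hy => ?_
    rw [dist_eq_norm, dist_eq_norm, ← map_sub, ContinuousLinearMap.coe_coe]
    have h3 := hAG x hx y hy
    have h4 := norm_le_norm_add_norm_sub (graphMap u F x - graphMap u F y) (graphLin u a (x - y))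
    have h5 := norm_nonneg (graphLin u a (x - y))
    have h6 : (1 - (δ : ℝ)) * ‖graphLin u a (x - y)‖ ≤ ‖graphMap u F x - graphMap u F y‖ := by
      nlinarith
    calc ‖graphLin u a (x - y)‖ ≤ c * (1 - (δ : ℝ)) * ‖graphLin u a (x - y)‖ := by nlinarith
      _ = c * ((1 - (δ : ℝ)) * ‖graphLin u a (x - y)‖) := by ring
      _ ≤ _ := by gcongr
  have hJ : ∀ x ∈ B, √(1 + ‖a‖ ^ 2) ≤ c * √(1 + ‖fderiv ℝ F x‖ ^ 2) ∧
      √(1 + ‖fderiv ℝ F x‖ ^ 2) ≤ c * √(1 + ‖a‖ ^ 2) := by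
    intro x hx
    have h3 := (abs_norm_sub_norm_le (fderiv ℝ F x) a).trans (hder x hx)
    refine ⟨sqrt_one_add_sq_le hc1 ?_, sqrt_one_add_sq_le hc1 ?_⟩
    · rw [abs_sub_comm]; linarith
    · linarith
  have hofReal : ∀ r : ℝ, ENNReal.ofReal (c * r) = c * ENNReal.ofReal r := fun r => by
    rw [ENNReal.ofReal_mul (NNReal.coe_nonneg c), ENNReal.ofReal_coe_nnreal]
  have hI1 : ENNReal.ofReal √(1 + ‖a‖ ^ 2) * volume B ≤
      c * ∫⁻ x in B, ENNReal.ofReal √(1 + ‖fderiv ℝ F x‖ ^ 2) := by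
    rw [← setLIntegral_const, ← lintegral_const_mul' _ _ ENNReal.coe_ne_top]
    refine setLIntegral_mono' hB fun x hx => ?_
    rw [← hofReal]
    exact ENNReal.ofReal_le_ofReal (hJ x hx).1
  have hI2 : ∫⁻ x in B, ENNReal.ofReal √(1 + ‖fderiv ℝ F x‖ ^ 2) ≤
      c * (ENNReal.ofReal √(1 + ‖a‖ ^ 2) * volume B) := by
    rw [← setLIntegral_const, ← lintegral_const_mul' _ _ ENNReal.coe_ne_top]
    refine setLIntegral_mono' hB fun x hx => ?_
    rw [← hofReal]
    exact ENNReal.ofReal_le_ofReal (hJ x hx).2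
  constructor
  · calc _ ≤ _ := h1
      _ ≤ (c : ENNReal) ^ (Module.finrank ℝ (ℝ ∙ u)ᗮ) *
          (c * ∫⁻ x in B, ENNReal.ofReal √(1 + ‖fderiv ℝ F x‖ ^ 2)) := by
          rw [hA]; gcongr
      _ = _ := by rw [pow_succ]; ring
  · calc _ ≤ _ := hI2
      _ ≤ c * ((c : ENNReal) ^ (Module.finrank ℝ (ℝ ∙ u)ᗮ) *
        μHE[Module.finrank ℝ (ℝ ∙ u)ᗮ] (graphMap u F '' B)) := by
          rw [← hA]; gcongr
      _ = _ := by rw [pow_succ]; ring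

/-- Disjointing the cover reduces a comparison of measures to subsets of single pieces. -/
lemma measure_le_of_cover {α : Type*} [MeasurableSpace α] {μ ν : Measure α} {B : Set α}
    (hB : MeasurableSet B) {T : ℕ → Set α} (hT : ∀ i, MeasurableSet (T i)) (hBT : B ⊆ ⋃ i, T i)
    (h : ∀ i C, MeasurableSet C → C ⊆ B → C ⊆ T i → μ C ≤ ν C) : μ B ≤ ν B := by
  have e : B = ⋃ i, B ∩ disjointed T i := by
    rw [← inter_iUnion, iUnion_disjointed, inter_eq_left.2 hBT]
  have hm : ∀ i, MeasurableSet (B ∩ disjointed T i) := fun i =>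
    hB.inter (MeasurableSet.disjointed hT i)
  have hd : Pairwise (Function.onFun Disjoint fun i => B ∩ disjointed T i) := fun i j hij =>
    (disjoint_disjointed T hij).mono inter_subset_right inter_subset_right
  rw [e, measure_iUnion hd hm, measure_iUnion hd hm]
  exact ENNReal.tsum_le_tsum fun i => h i _ (hm i) inter_subset_left
    (inter_subset_right.trans (disjointed_subset T i))

/-- **Area formula for graphs**: the projection to `u^⊥` of the Hausdorff measure on the graph of
`F` over `s` has density `√(1 + ‖DF‖²)`. -/
theorem map_proj_restrict_graph (hu : ‖u‖ = 1) {F : (ℝ ∙ u)ᗮ → ℝ} {s : Set (ℝ ∙ u)ᗮ}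
    (hs : MeasurableSet s) (hF : ∀ x ∈ s, DifferentiableAt ℝ F x) :
    Measure.map (proj u) ((μHE[Module.finrank ℝ (ℝ ∙ u)ᗮ]).restrict (graphMap u F '' s)) =
      (volume.restrict s).withDensity fun x => ENNReal.ofReal √(1 + ‖fderiv ℝ F x‖ ^ 2) := by
  set m := Module.finrank ℝ (ℝ ∙ u)ᗮ with hm
  set ν₁ := Measure.map (proj u) ((μHE[m]).restrict (graphMap u F '' s)) with hν₁
  set ν₂ := (volume.restrict s).withDensity fun x => ENNReal.ofReal √(1 + ‖fderiv ℝ F x‖ ^ 2)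
    with hν₂
  have hgp : ∀ y, proj u (graphMap u F y) = y := fun y => proj_add_smul u y _
  have hν₁' : ∀ B, MeasurableSet B → ν₁ B = μHE[m] (graphMap u F '' (B ∩ s)) := by
    intro B hB
    rw [hν₁, Measure.map_apply (proj u).continuous.measurable hB,
      Measure.restrict_apply ((proj u).continuous.measurable hB)]
    congr 1
    ext x
    constructor
    · rintro ⟨h1, y, hy, rfl⟩
      rw [mem_preimage, hgp] at h1
      exact ⟨y, ⟨h1, hy⟩, rfl⟩
    · rintro ⟨y, ⟨h1, hy⟩, rfl⟩
      refine ⟨?_, y, hy, rfl⟩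
      rw [mem_preimage, hgp]; exact h1
  have hν₂' : ∀ B, MeasurableSet B → ν₂ B =
      ∫⁻ x in B ∩ s, ENNReal.ofReal √(1 + ‖fderiv ℝ F x‖ ^ 2) := by
    intro B hB
    rw [hν₂, withDensity_apply _ hB, Measure.restrict_restrict hB]
  have key : ∀ c : NNReal, 1 < c → ∀ B, MeasurableSet B →
      ν₁ B ≤ ((c : ENNReal) ^ (m + 1) • ν₂) B ∧ ν₂ B ≤ ((c : ENNReal) ^ (m + 1) • ν₁) B := by
    intro c hc
    -- The choice δ = (c - 1)/c gives c(1 - δ) = 1 and δ ≤ c - 1.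
    obtain ⟨δ, hδ0, hδ1, hδ2⟩ : ∃ δ : NNReal, 0 < δ ∧ 1 + δ ≤ c ∧ 1 ≤ c * (1 - (δ : ℝ)) := by
      have hcr : (1 : ℝ) < c := by exact_mod_cast hc
      refine ⟨⟨(c - 1) / c, div_nonneg (by linarith) c.2⟩, ?_, ?_, ?_⟩
      · exact div_pos (sub_pos.2 hcr) (by linarith)
      · rw [← NNReal.coe_le_coe]
        have : ((c : ℝ) - 1) / c ≤ c - 1 := div_le_self (by linarith) hcr.le
        change 1 + ((c : ℝ) - 1) / c ≤ c
        linarith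
      · change 1 ≤ (c : ℝ) * (1 - ((c : ℝ) - 1) / c)
        have : (c : ℝ) ≠ 0 := by linarith
        field_simp
        linarith
    have hmeas : Measurable (fderiv ℝ F) := measurable_fderiv ℝ F
    set d := TopologicalSpace.denseSeq ((ℝ ∙ u)ᗮ →L[ℝ] ℝ) with hd
    -- Radius δ/2 makes any two derivatives over one piece differ by less than δ.
    set T : ℕ → Set (ℝ ∙ u)ᗮ := fun j => fderiv ℝ F ⁻¹' Metric.ball (d j) (δ / 2) with hT
    have hTm : ∀ j, MeasurableSet (T j) := fun j => hmeas Metric.isOpen_ball.measurableSet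
    have hTc : ⋃ j, T j = univ := by
      refine eq_univ_of_forall fun x => ?_
      obtain ⟨j, hj⟩ := Metric.denseRange_iff.1
        (TopologicalSpace.denseRange_denseSeq ((ℝ ∙ u)ᗮ →L[ℝ] ℝ)) (fderiv ℝ F x) (δ / 2)
        (by positivity)
      exact mem_iUnion.2 ⟨j, hj⟩
    have hpiece : ∀ j C, MeasurableSet C → C ⊆ T j → C ⊆ s → ∃ (P : ℕ → Set (ℝ ∙ u)ᗮ),
        (∀ i, MeasurableSet (P i)) ∧ C ⊆ ⋃ i, P i ∧ ∀ i D, MeasurableSet D → D ⊆ C → D ⊆ P i →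
        ν₁ D ≤ ((c : ENNReal) ^ (m + 1) • ν₂) D ∧ ν₂ D ≤ ((c : ENNReal) ^ (m + 1) • ν₁) D := by
      intro j C hC hCT hCs
      obtain ⟨P, A, -, hP1, hP2, hP3, hP4⟩ :=
        exists_partition_approximatesLinearOn_of_hasFDerivWithinAt (graphMap u F) C
          (fun x => graphLin u (fderiv ℝ F x))
          (fun x hx => (hasFDerivAt_graphMap (hF x (hCs hx)).hasFDerivAt).hasFDerivWithinAt)
          (fun _ => δ) (fun _ => hδ0.ne')
      refine ⟨P, hP1, hP2, fun i D hD hDC hDP => ?_⟩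
      rcases C.eq_empty_or_nonempty with hCe | hCn
      · rw [hCe, subset_empty_iff] at hDC
        simp [hDC]
      obtain ⟨y, hyC, hy⟩ := hP4 hCn i
      have happ := hP3 i
      rw [hy] at happ
      have h1 := graph_measure_compare hu hD hδ1 hδ2 (happ.mono_set (subset_inter hDC hDP)) (by
        intro x hx
        have h2 : dist (fderiv ℝ F x) (d j) < δ / 2 := hCT (hDC hx)
        have h3 : dist (fderiv ℝ F y) (d j) < δ / 2 := hCT hyC
        rw [← dist_eq_norm (fderiv ℝ F x) (fderiv ℝ F y)]
        have := dist_triangle_right (fderiv ℝ F x) (fderiv ℝ F y) (d j)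
        linarith)
      rw [Measure.smul_apply, Measure.smul_apply, hν₁' D hD, hν₂' D hD,
        inter_eq_left.2 (hDC.trans hCs)]
      exact h1
    have hs1 : ∀ B, MeasurableSet B → ν₁ B = ν₁ (B ∩ s) := fun B hB => by
      rw [hν₁' B hB, hν₁' _ (hB.inter hs), inter_assoc, inter_self]
    have hs2 : ∀ B, MeasurableSet B → ν₂ B = ν₂ (B ∩ s) := fun B hB => by
      rw [hν₂' B hB, hν₂' _ (hB.inter hs), inter_assoc, inter_self]
    intro B hB
    rw [Measure.smul_apply, Measure.smul_apply, hs1 B hB, hs2 B hB, ← Measure.smul_apply,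
      ← Measure.smul_apply]
    constructor
    · refine measure_le_of_cover (hB.inter hs) hTm (by rw [hTc]; exact subset_univ _)
        fun j C hC hCB hCT => ?_
      obtain ⟨P, hP1, hP2, hP3⟩ := hpiece j C hC hCT (hCB.trans inter_subset_right)
      exact measure_le_of_cover hC hP1 hP2 fun i D hD hDC hDP => (hP3 i D hD hDC hDP).1
    · refine measure_le_of_cover (hB.inter hs) hTm (by rw [hTc]; exact subset_univ _)
        fun j C hC hCB hCT => ?_
      obtain ⟨P, hP1, hP2, hP3⟩ := hpiece j C hC hCT (hCB.trans inter_subset_right)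
      exact measure_le_of_cover hC hP1 hP2 fun i D hD hDC hDP => (hP3 i D hD hDC hDP).2
  -- The two measures agree up to the factor c^(m+1) for every c > 1; the limit c → 1 gives
  -- equality.
  have hlim : ∀ x : ENNReal, Filter.Tendsto (fun c : NNReal => (c : ENNReal) ^ (m + 1) * x)
      (nhdsWithin 1 (Ioi 1)) (nhds x) := by
    intro x
    have h1 : Filter.Tendsto (fun c : NNReal => (c : ENNReal) ^ (m + 1)) (nhds 1) (nhds 1) := by
      have : Continuous fun c : NNReal => ((c ^ (m + 1) : NNReal) : ENNReal) :=
        ENNReal.continuous_coe.comp (continuous_pow _)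
      have := this.tendsto 1
      simpa using this
    have h2 := ENNReal.Tendsto.mul_const (b := x)
      (h1.mono_left (nhdsWithin_le_nhds (s := Ioi 1))) (Or.inl one_ne_zero)
    rwa [one_mul] at h2
  refine Measure.ext fun B hB => le_antisymm ?_ ?_
  · refine ge_of_tendsto (hlim (ν₂ B)) ?_
    filter_upwards [self_mem_nhdsWithin] with c hc
    exact (key c hc B hB).1
  · refine ge_of_tendsto (hlim (ν₁ B)) ?_
    filter_upwards [self_mem_nhdsWithin] with c hc
    exact (key c hc B hB).2

end LpProjection

/-! ### Finite surface area, and null sets over the boundary of the base. -/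

namespace LpProjection

variable {V : Type*} [NormedAddCommGroup V] [InnerProductSpace ℝ V] {u : V}

lemma finrank_orthogonal {m : ℕ} (hm : Module.finrank ℝ V = m + 1) (hu : ‖u‖ = 1) :
    Module.finrank ℝ (ℝ ∙ u)ᗮ = m := by
  have : Fact (Module.finrank ℝ V = m + 1) := ⟨hm⟩
  exact Submodule.finrank_orthogonal_span_singleton (by rintro rfl; simp at hu)

/-- Radial projection to the boundary of a convex body is Lipschitz on bounded sets away from the
origin. -/
lemma exists_lipschitz_radial {C : Set V} (hC : Convex ℝ C) (hb : Bornology.IsBounded C)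
    (h0 : C ∈ nhds 0) : ∃ c : NNReal, ∀ z w : V, 1 ≤ ‖z‖ → 1 ≤ ‖w‖ → ‖w‖ ≤ 2 →
      dist ((gauge C z)⁻¹ • z) ((gauge C w)⁻¹ • w) ≤ c * dist z w := by
  obtain ⟨K, hK⟩ := hC.lipschitz_gauge h0
  obtain ⟨M, hMpos, hM⟩ := hb.subset_closedBall_lt 0 0
  have habs : Absorbent ℝ C := absorbent_nhds_zero h0
  have hlow : ∀ z : V, 1 ≤ ‖z‖ → 1 / M ≤ gauge C z := fun z hz =>
    (div_le_div_of_nonneg_right hz hMpos.le).trans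
      (le_gauge_of_subset_closedBall habs hMpos.le hM)
  refine ⟨⟨M + M * K * M * 2, by positivity⟩, fun z w hz hw hw2 => ?_⟩
  have hgz : 0 < gauge C z := (by positivity : 0 < 1 / M).trans_le (hlow z hz)
  have hgw : 0 < gauge C w := (by positivity : 0 < 1 / M).trans_le (hlow w hw)
  have hiz : (gauge C z)⁻¹ ≤ M := by
    rw [inv_le_comm₀ hgz hMpos, ← one_div]; exact hlow z hz
  have hiw : (gauge C w)⁻¹ ≤ M := by
    rw [inv_le_comm₀ hgw hMpos, ← one_div]; exact hlow w hw
  have hd : |gauge C w - gauge C z| ≤ K * ‖z - w‖ := by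
    have := hK.dist_le_mul w z
    rwa [Real.dist_eq, dist_comm, dist_eq_norm] at this
  have hinv : |(gauge C z)⁻¹ - (gauge C w)⁻¹| ≤ M * (K * ‖z - w‖) * M := by
    have e : (gauge C z)⁻¹ - (gauge C w)⁻¹ =
        (gauge C z)⁻¹ * (gauge C w - gauge C z) * (gauge C w)⁻¹ := by field_simp
    rw [e, abs_mul, abs_mul, abs_of_pos (inv_pos.2 hgz), abs_of_pos (inv_pos.2 hgw)]
    gcongr
  rw [dist_eq_norm, dist_eq_norm]
  have e : (gauge C z)⁻¹ • z - (gauge C w)⁻¹ • w =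
      (gauge C z)⁻¹ • (z - w) + ((gauge C z)⁻¹ - (gauge C w)⁻¹) • w := by
    rw [smul_sub, sub_smul]; abel
  calc _ ≤ ‖(gauge C z)⁻¹ • (z - w)‖ + ‖((gauge C z)⁻¹ - (gauge C w)⁻¹) • w‖ := by
        rw [e]; exact norm_add_le _ _
    _ ≤ M * ‖z - w‖ + M * (K * ‖z - w‖) * M * 2 := by
        rw [norm_smul, norm_smul, Real.norm_eq_abs, Real.norm_eq_abs, abs_of_pos (inv_pos.2 hgz)]
        gcongr
    _ = (M + M * K * M * 2) * ‖z - w‖ := by ring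

lemma proj_isOpenMap [FiniteDimensional ℝ V] (u : V) : IsOpenMap (proj u) :=
  (proj u).isOpenMap fun y => ⟨y, by have := proj_add_smul u y 0; simpa using this⟩

variable [FiniteDimensional ℝ V] [MeasurableSpace V] [BorelSpace V]

/-- The boundary of a convex body has finite surface area. -/
theorem measure_frontier_lt_top {m : ℕ} (hm : Module.finrank ℝ V = m + 1) {C : Set V}
    (hC : Convex ℝ C) (hc : IsCompact C) (h0 : C ∈ nhds 0) : μHE[m] (frontier C) < ⊤ := by
  have hF : IsCompact (frontier C) :=
    hc.of_isClosed_subset isClosed_frontier hc.isClosed.frontier_subset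
  obtain ⟨c, hlip⟩ := exists_lipschitz_radial hC hc.isBounded h0
  refine hF.measure_lt_top_of_nhdsWithin fun x₀ hx₀ => ?_
  have hx0 : x₀ ≠ 0 := by
    rintro rfl
    exact hx₀.2 (mem_interior_iff_mem_nhds.2 h0)
  set e : V := ‖x₀‖⁻¹ • x₀ with he
  have he1 : ‖e‖ = 1 := by
    rw [he, norm_smul, norm_inv, norm_norm, inv_mul_cancel₀ (norm_ne_zero_iff.2 hx0)]
  -- In the open cone N around the direction e of x₀, the boundary is covered by the radial
  -- projection Ψ of the unit ball of the hyperplane at height 1. There vectors have norm between 1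
  -- and 2, so Ψ is Lipschitz.
  set N : Set V := {x | ‖proj e x‖ < ⟪x, e⟫} with hN
  have hNo : IsOpen N := isOpen_lt (by fun_prop) (by fun_prop)
  have hx₀e : x₀ = ((0 : (ℝ ∙ e)ᗮ) : V) + ‖x₀‖ • e := by
    rw [he, smul_smul, mul_inv_cancel₀ (norm_ne_zero_iff.2 hx0)]; simp
  have hx₀N : x₀ ∈ N := by
    have h1 : proj e x₀ = 0 := by rw [hx₀e]; exact proj_add_smul e 0 _
    have h2 : ⟪x₀, e⟫ = ‖x₀‖ := by
      nth_rewrite 1 [hx₀e]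
      simp [inner_smul_left, he1]
    simp only [hN, mem_ofPred_eq, h1, h2, norm_zero]
    exact norm_pos_iff.2 hx0
  set Ψ : (ℝ ∙ e)ᗮ → V := fun w => (gauge C ((w : V) + (1 : ℝ) • e))⁻¹ • ((w : V) + (1 : ℝ) • e)
    with hΨ
  have hsub : N ∩ frontier C ⊆ Ψ '' Metric.closedBall 0 1 := by
    rintro x ⟨hxN, hxF⟩
    have hg : gauge C x = 1 := (gauge_eq_one_iff_mem_frontier hC h0).2 hxF
    have hpos : 0 < ⟪x, e⟫ := (norm_nonneg _).trans_lt hxN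
    refine ⟨(⟪x, e⟫)⁻¹ • proj e x, ?_, ?_⟩
    · rw [mem_closedBall_zero_iff, norm_smul, norm_inv, Real.norm_of_nonneg hpos.le,
        inv_mul_le_iff₀ hpos, mul_one]
      exact hxN.le
    · have h1 : (((⟪x, e⟫)⁻¹ • proj e x : (ℝ ∙ e)ᗮ) : V) + (1 : ℝ) • e = (⟪x, e⟫)⁻¹ • x := by
        refine Eq.trans ?_ (congrArg ((⟪x, e⟫)⁻¹ • ·) (eq_proj_add_smul he1 x)).symm
        rw [smul_add, inv_smul_smul₀ hpos.ne', one_smul]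
        rfl
      simp only [hΨ, h1]
      rw [gauge_smul_of_nonneg (inv_nonneg.2 hpos.le), hg, smul_eq_mul, mul_one, inv_inv,
        smul_smul, mul_inv_cancel₀ hpos.ne', one_smul]
  refine ⟨N ∩ frontier C, ?_, (measure_mono hsub).trans_lt ?_⟩
  · exact Filter.inter_mem (mem_nhdsWithin_of_mem_nhds (hNo.mem_nhds hx₀N)) self_mem_nhdsWithin
  have hn : ∀ w ∈ Metric.closedBall (0 : (ℝ ∙ e)ᗮ) 1, 1 ≤ ‖(w : V) + (1 : ℝ) • e‖ ∧
      ‖(w : V) + (1 : ℝ) • e‖ ≤ 2 := by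
    intro w hw
    rw [mem_closedBall_zero_iff] at hw
    have h1 := norm_sq_add_smul he1 w 1
    have h2 := norm_nonneg ((w : V) + (1 : ℝ) • e)
    have h3 := norm_nonneg w
    constructor <;> nlinarith
  have hle := euclideanHausdorffMeasure_image_le_of_dist_le m (f := Ψ)
    (g := (id : (ℝ ∙ e)ᗮ → (ℝ ∙ e)ᗮ)) (B := Metric.closedBall 0 1) (c := c) (by
      intro x hx y hy
      refine (hlip _ _ (hn x hx).1 (hn y hy).1 (hn y hy).2).trans (le_of_eq ?_)
      rw [dist_add_right]; rfl)
  refine hle.trans_lt (ENNReal.mul_lt_top (ENNReal.pow_lt_top ENNReal.coe_lt_top) ?_)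
  rw [image_id]
  have h2 := InnerProductSpace.euclideanHausdorffMeasure_eq_volume (V := (ℝ ∙ e)ᗮ)
  rw [finrank_orthogonal hm he1] at h2
  rw [h2]
  exact (isCompact_closedBall _ _).measure_lt_top

/-- The part of the graph of a function lying over the boundary of a convex body is a null set. -/
theorem measure_graph_frontier_eq_zero {m : ℕ} (hm : Module.finrank ℝ V = m + 1) (hu : ‖u‖ = 1)
    {D : Set (ℝ ∙ u)ᗮ} (hD : Convex ℝ D) (hc : IsCompact D) (h0 : D ∈ nhds 0)
    {F : (ℝ ∙ u)ᗮ → ℝ} {M : ℝ} (hM : ∀ y ∈ frontier D, |F y| ≤ M)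
    (hmeas : MeasurableSet (graphMap u F '' frontier D)) :
    μHE[m] (graphMap u F '' frontier D) = 0 := by
  set Z := graphMap u F '' frontier D with hZ
  -- M can be negative when `frontier D` is empty; the cylinder C needs a positive height.
  set M' := max M 0 with hM'
  have hM'0 : 0 ≤ M' := le_max_right _ _
  set C : Set V := proj u ⁻¹' D ∩ {x | |⟪x, u⟫| ≤ M' + 1} with hCdef
  have hCc : IsCompact C := by
    have h1 : IsCompact ((fun z : (ℝ ∙ u)ᗮ × ℝ => (z.1 : V) + z.2 • u) ''
        (D ×ˢ Icc (-(M' + 1)) (M' + 1))) := (hc.prod isCompact_Icc).image (by fun_prop)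
    refine h1.of_isClosed_subset ((hc.isClosed.preimage (proj u).continuous).inter
      (isClosed_le (by fun_prop) (by fun_prop))) ?_
    rintro x ⟨hx1, hx2⟩
    exact ⟨(proj u x, ⟪x, u⟫), ⟨hx1, abs_le.1 hx2⟩, (eq_proj_add_smul hu x).symm⟩
  have hCconv : Convex ℝ C := by
    refine (hD.linear_preimage (proj u).toLinearMap).inter ?_
    have : {x : V | |⟪x, u⟫| ≤ M' + 1} = (innerSL ℝ u).toLinearMap ⁻¹' Icc (-(M' + 1)) (M' + 1) := by
      ext x; simp [abs_le, real_inner_comm]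
    rw [this]
    exact (convex_Icc _ _).linear_preimage _
  have hC0 : C ∈ nhds 0 := by
    refine Filter.inter_mem ?_ ?_
    · refine (proj u).continuous.continuousAt.preimage_mem_nhds ?_
      rwa [map_zero]
    · refine Filter.mem_of_superset ((isOpen_lt (f := fun x : V => |⟪x, u⟫|) (by fun_prop)
        (continuous_const (y := M' + 1))).mem_nhds ?_) fun x (hx : |⟪x, u⟫| < M' + 1) => hx.le
      simp only [inner_zero_left, abs_zero, mem_ofPred_eq]
      linarith
  have hfin := measure_frontier_lt_top hm hCconv hCc hC0
  -- Infinitely many vertical translates of the set fit disjointly into the lateral boundary of the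
  -- cylinder C. They have equal measure and the boundary of C has finite measure, so each is null.
  -- Shifts of at most 1 explain the height M' + 1.
  set T : ℕ → Set V := fun k => (fun x => (1 / ((k : ℝ) + 1)) • u + x) '' Z with hT
  have hTF : ∀ k, T k ⊆ frontier C := by
    rintro k _ ⟨_, ⟨y, hy, rfl⟩, rfl⟩
    have hk0 : 0 ≤ 1 / ((k : ℝ) + 1) := by positivity
    have hk1 : 1 / ((k : ℝ) + 1) ≤ 1 := by
      rw [div_le_one (by positivity)]; have : (0 : ℝ) ≤ k := k.cast_nonneg; linarith
    have e : (1 / ((k : ℝ) + 1)) • u + graphMap u F y = (y : V) + (1 / ((k : ℝ) + 1) + F y) • u := by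
      rw [graphMap, add_smul]; abel
    have hp : proj u ((1 / ((k : ℝ) + 1)) • u + graphMap u F y) = y := by
      rw [e]; exact proj_add_smul u y _
    have hi : ⟪(1 / ((k : ℝ) + 1)) • u + graphMap u F y, u⟫ = 1 / ((k : ℝ) + 1) + F y := by
      rw [e, inner_add_left, inner_coe_orthogonal, inner_smul_left, real_inner_self_eq_norm_sq, hu]
      simp
    rw [hCc.isClosed.frontier_eq]
    refine ⟨⟨?_, ?_⟩, fun hint => ?_⟩
    · rw [mem_preimage, hp]; exact hc.isClosed.frontier_subset hy
    · simp only [mem_ofPred_eq, hi]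
      have := (hM y hy).trans (le_max_left M 0)
      refine (abs_add_le _ _).trans ?_
      rw [abs_of_nonneg hk0]
      linarith
    · have h1 : D ∈ nhds y := by
        have := (proj_isOpenMap u).image_mem_nhds (mem_interior_iff_mem_nhds.1 hint)
        rw [hp] at this
        refine Filter.mem_of_superset this ?_
        rintro _ ⟨x, hx, rfl⟩
        exact hx.1
      exact hy.2 (mem_interior_iff_mem_nhds.2 h1)
  have hTm : ∀ k, MeasurableSet (T k) := fun k =>
    (Homeomorph.addLeft ((1 / ((k : ℝ) + 1)) • u)).measurableEmbedding.measurableSet_image.2 hmeas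
  have hTμ : ∀ k, μHE[m] (T k) = μHE[m] Z := fun k =>
    (isometry_add_left ((1 / ((k : ℝ) + 1)) • u)).euclideanHausdorffMeasure_image Z
  have hTd : Pairwise (Function.onFun Disjoint T) := by
    intro i j hij
    refine disjoint_left.2 ?_
    rintro _ ⟨_, ⟨y, hy, rfl⟩, rfl⟩ ⟨_, ⟨z, hz, rfl⟩, hzy⟩
    have e : ∀ (k : ℕ) (y : (ℝ ∙ u)ᗮ), (1 / ((k : ℝ) + 1)) • u + graphMap u F y =
        (y : V) + (1 / ((k : ℝ) + 1) + F y) • u := fun k y => by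
      rw [graphMap, add_smul]; abel
    simp only [e] at hzy
    have h1 := congrArg (proj u) hzy
    rw [proj_add_smul, proj_add_smul] at h1
    subst h1
    have h2 := congrArg (fun x => ⟪x, u⟫) hzy
    simp only [inner_add_left, inner_smul_left, real_inner_self_eq_norm_sq, hu,
      inner_coe_orthogonal] at h2
    simp only [RCLike.conj_to_real] at h2
    apply hij
    have h3 : 1 / ((j : ℝ) + 1) = 1 / ((i : ℝ) + 1) := by linarith
    rw [one_div, one_div] at h3
    have h4 := inv_injective h3
    exact_mod_cast (by linarith : (i : ℝ) = j)
  by_contra hne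
  have h1 : μHE[m] (⋃ k, T k) = ⊤ := by
    rw [measure_iUnion hTd hTm]
    simp only [hTμ]
    exact ENNReal.tsum_const_eq_top_of_ne_zero hne
  have h2 := measure_mono (μ := (μHE[m] : Measure V)) (iUnion_subset hTF)
  rw [h1] at h2
  exact hfin.ne (top_le_iff.1 h2)

end LpProjection

/-! ### Symmetric bodies bounded by two graphs and their normals. -/

namespace LpProjection

variable {n : ℕ}

/-- `L` is an origin-symmetric convex body bounded by the graphs of `F` and `y ↦ -F(-y)` over the
convex body `D ⊆ u^⊥`, where `F` is differentiable and concave, and the two graphs meet exactly over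
the boundary of `D`. -/
structure IsGraphBody (u : EuclideanSpace ℝ (Fin n)) (L : Set (EuclideanSpace ℝ (Fin n)))
    (D : Set (ℝ ∙ u)ᗮ) (F : (ℝ ∙ u)ᗮ → ℝ) : Prop where
  isCompact_base : IsCompact D
  convex_base : Convex ℝ D
  base_mem_nhds : D ∈ nhds 0
  neg_base : ∀ y ∈ D, -y ∈ D
  isCompact : IsCompact L
  convex : Convex ℝ L
  mem_nhds : L ∈ nhds 0
  mem_iff : ∀ x, x ∈ L ↔ proj u x ∈ D ∧ -F (-proj u x) ≤ ⟪x, u⟫ ∧ ⟪x, u⟫ ≤ F (proj u x)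
  differentiableAt : ∀ y ∈ interior D, DifferentiableAt ℝ F y
  le_tangent : ∀ y ∈ interior D, ∀ z ∈ D, F z ≤ F y + fderiv ℝ F y (z - y)
  pos : ∀ y ∈ interior D, 0 < F y + F (-y)
  eq_zero : ∀ y ∈ frontier D, F y + F (-y) = 0

/-- The upward normal vector `(-∇F, 1)` of the graph of `F`. -/
def normalVec (u : EuclideanSpace ℝ (Fin n)) (F : (ℝ ∙ u)ᗮ → ℝ) (y : (ℝ ∙ u)ᗮ) :
    EuclideanSpace ℝ (Fin n) :=
  ((-(InnerProductSpace.toDual ℝ (ℝ ∙ u)ᗮ).symm (fderiv ℝ F y) : (ℝ ∙ u)ᗮ) :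
    EuclideanSpace ℝ (Fin n)) + (1 : ℝ) • u

lemma inner_graphMap {V : Type*} [NormedAddCommGroup V] [InnerProductSpace ℝ V] {u : V}
    (hu : ‖u‖ = 1) (F : (ℝ ∙ u)ᗮ → ℝ) (y : (ℝ ∙ u)ᗮ) : ⟪graphMap u F y, u⟫ = F y := by
  rw [graphMap, inner_add_left, inner_coe_orthogonal, inner_smul_left, real_inner_self_eq_norm_sq,
    hu]
  simp

lemma proj_graphMap {V : Type*} [NormedAddCommGroup V] [InnerProductSpace ℝ V] {u : V}
    (F : (ℝ ∙ u)ᗮ → ℝ) (y : (ℝ ∙ u)ᗮ) : proj u (graphMap u F y) = y :=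
  proj_add_smul u y _

variable {u : EuclideanSpace ℝ (Fin n)}

lemma inner_normalVec (hu : ‖u‖ = 1) (F : (ℝ ∙ u)ᗮ → ℝ) (y : (ℝ ∙ u)ᗮ)
    (v : EuclideanSpace ℝ (Fin n)) :
    ⟪v, normalVec u F y⟫ = ⟪v, u⟫ - fderiv ℝ F y (proj u v) := by
  have h : ⟪(proj u v : EuclideanSpace ℝ (Fin n)) + ⟪v, u⟫ • u, normalVec u F y⟫ =
      ⟪v, u⟫ - fderiv ℝ F y (proj u v) := by
    rw [normalVec, inner_add_smul hu, inner_neg_right, real_inner_comm,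
      InnerProductSpace.toDual_symm_apply]
    ring
  rwa [← eq_proj_add_smul hu v] at h

lemma norm_normalVec (hu : ‖u‖ = 1) (F : (ℝ ∙ u)ᗮ → ℝ) (y : (ℝ ∙ u)ᗮ) :
    ‖normalVec u F y‖ = √(1 + ‖fderiv ℝ F y‖ ^ 2) := by
  rw [← Real.sqrt_sq (norm_nonneg (normalVec u F y)), normalVec, norm_sq_add_smul hu, norm_neg,
    LinearIsometryEquiv.norm_map]
  congr 1; ring

lemma norm_normalVec_pos (hu : ‖u‖ = 1) (F : (ℝ ∙ u)ᗮ → ℝ) (y : (ℝ ∙ u)ᗮ) :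
    0 < ‖normalVec u F y‖ := by
  rw [norm_normalVec hu]; positivity

lemma inner_graphMap_normalVec (hu : ‖u‖ = 1) (F : (ℝ ∙ u)ᗮ → ℝ) (y : (ℝ ∙ u)ᗮ) :
    ⟪graphMap u F y, normalVec u F y⟫ = F y - fderiv ℝ F y y := by
  rw [inner_normalVec hu, inner_graphMap hu, proj_graphMap]

lemma supportFn_eq_of_isOuterUnitNormal {L : Set (EuclideanSpace ℝ (Fin n))}
    {x v : EuclideanSpace ℝ (Fin n)} (hx : x ∈ L) (h : IsOuterUnitNormal L x v) :
    supportFn L v = ⟪x, v⟫ := by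
  refine IsGreatest.csSup_eq ⟨⟨x, hx, rfl⟩, ?_⟩
  rintro _ ⟨y, hy, rfl⟩
  exact h.2 y hy

lemma continuous_supportFn {L : Set (EuclideanSpace ℝ (Fin n))} (hL : IsCompact L) :
    Continuous (supportFn L) := by
  have := hL.continuous_sSup (f := fun (v x : EuclideanSpace ℝ (Fin n)) => ⟪x, v⟫)
    (by simp only [Function.HasUncurry.uncurry]; fun_prop)
  exact this

namespace IsGraphBody

variable {L : Set (EuclideanSpace ℝ (Fin n))} {D : Set (ℝ ∙ u)ᗮ} {F : (ℝ ∙ u)ᗮ → ℝ}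
  (h : IsGraphBody u L D F)
include h

lemma add_nonneg {y : (ℝ ∙ u)ᗮ} (hy : y ∈ D) : 0 ≤ F y + F (-y) := by
  by_cases hi : y ∈ interior D
  · exact (h.pos y hi).le
  · exact (h.eq_zero y ⟨subset_closure hy, hi⟩).ge

lemma graphMap_mem (hu : ‖u‖ = 1) {y : (ℝ ∙ u)ᗮ} (hy : y ∈ D) : graphMap u F y ∈ L := by
  rw [h.mem_iff, proj_graphMap, inner_graphMap hu]
  exact ⟨hy, by linarith [h.add_nonneg hy], le_rfl⟩

lemma neg_mem {x : EuclideanSpace ℝ (Fin n)} (hx : x ∈ L) : -x ∈ L := by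
  rw [h.mem_iff] at hx ⊢
  rw [map_neg, neg_neg, inner_neg_left]
  exact ⟨h.neg_base _ hx.1, by linarith [hx.2.2], by linarith [hx.2.1]⟩

lemma neg_interior {y : (ℝ ∙ u)ᗮ} (hy : y ∈ interior D) : -y ∈ interior D := by
  have e : -D = D := by
    ext z
    exact ⟨fun hz => by simpa using h.neg_base _ hz, fun hz => h.neg_base _ hz⟩
  have h1 : -y ∈ -interior D := by simpa using hy
  have h2 : -interior D = interior (-D) := (Homeomorph.neg (ℝ ∙ u)ᗮ).preimage_interior D
  rwa [h2, e] at h1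

lemma inner_le (hu : ‖u‖ = 1) {y : (ℝ ∙ u)ᗮ} (hy : y ∈ interior D)
    {z : EuclideanSpace ℝ (Fin n)} (hz : z ∈ L) :
    ⟪z, normalVec u F y⟫ ≤ F y - fderiv ℝ F y y := by
  rw [inner_normalVec hu]
  obtain ⟨h1, -, h3⟩ := (h.mem_iff z).1 hz
  have := h.le_tangent y hy _ h1
  rw [map_sub] at this
  linarith

lemma isOuterUnitNormal (hu : ‖u‖ = 1) {y : (ℝ ∙ u)ᗮ} (hy : y ∈ interior D) :
    IsOuterUnitNormal L (graphMap u F y) (‖normalVec u F y‖⁻¹ • normalVec u F y) := by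
  have hpos := norm_normalVec_pos hu F y
  refine ⟨?_, fun z hz => ?_⟩
  · rw [norm_smul, norm_inv, norm_norm, inv_mul_cancel₀ hpos.ne']
  · rw [inner_smul_right, inner_smul_right, inner_graphMap_normalVec hu]
    exact mul_le_mul_of_nonneg_left (h.inner_le hu hy hz) (inv_nonneg.2 hpos.le)

/-- The function ⟪v, ·⟫ has a local maximum along the graph, so v is orthogonal to the tangent plane
and is a multiple of `normalVec`. -/
lemma eq_of_isOuterUnitNormal (hu : ‖u‖ = 1) {y : (ℝ ∙ u)ᗮ} (hy : y ∈ interior D)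
    {v : EuclideanSpace ℝ (Fin n)} (hv : IsOuterUnitNormal L (graphMap u F y) v) :
    v = ‖normalVec u F y‖⁻¹ • normalVec u F y := by
  have hder := ((innerSL ℝ v).hasFDerivAt.comp y
    (hasFDerivAt_graphMap (h.differentiableAt y hy).hasFDerivAt))
  have hmax : IsLocalMax (innerSL ℝ v ∘ graphMap u F) y := by
    filter_upwards [mem_interior_iff_mem_nhds.1 hy] with z hz
    simp only [Function.comp_apply, innerSL_apply_apply]
    rw [real_inner_comm, real_inner_comm _ v]
    exact hv.2 _ (h.graphMap_mem hu hz)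
  have hzero := hmax.hasFDerivAt_eq_zero hder
  have hw : ∀ w : (ℝ ∙ u)ᗮ, ⟪v, (w : EuclideanSpace ℝ (Fin n)) + fderiv ℝ F y w • u⟫ = 0 :=
    fun w => by
      have := DFunLike.congr_fun hzero w
      simpa [graphLin_apply] using this
  set r := ⟪v, u⟫ with hr
  have hvr : v = r • normalVec u F y := by
    refine ext_inner_left ℝ fun z => ?_
    rw [inner_smul_right, inner_normalVec hu]
    have h1 := hw (proj u z)
    rw [inner_add_right, inner_smul_right, ← hr] at h1
    have h2 : ⟪v, (proj u z : EuclideanSpace ℝ (Fin n)) + ⟪z, u⟫ • u⟫ =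
        r * (⟪z, u⟫ - fderiv ℝ F y (proj u z)) := by
      rw [inner_add_right, inner_smul_right, ← hr]; linarith
    rwa [← eq_proj_add_smul hu z, real_inner_comm] at h2
  -- The lower endpoint of the section lies in L strictly below the upper one, which makes the
  -- multiple nonnegative.
  have hlow : graphMap u (fun z => -F (-z)) y ∈ L := by
    rw [h.mem_iff, proj_graphMap, inner_graphMap hu]
    exact ⟨interior_subset hy, le_rfl, by linarith [h.pos y hy]⟩
  have hr0 : 0 ≤ r := by
    have h1 := hv.2 _ hlow
    simp only [graphMap, inner_add_left, inner_smul_left, RCLike.conj_to_real] at h1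
    rw [real_inner_comm v u, ← hr] at h1
    have h2 := h.pos y hy
    by_contra! hneg
    nlinarith
  have hnorm := hv.1
  rw [hvr, norm_smul, Real.norm_of_nonneg hr0] at hnorm
  have hr1 : r = ‖normalVec u F y‖⁻¹ := eq_inv_of_mul_eq_one_left hnorm
  rw [← hr1]; exact hvr

lemma graphMap_mem_frontier (hu : ‖u‖ = 1) {y : (ℝ ∙ u)ᗮ} (hy : y ∈ D) :
    graphMap u F y ∈ frontier L := by
  refine ⟨subset_closure (h.graphMap_mem hu hy), fun hint => ?_⟩
  have hc : Filter.Tendsto (fun s : ℝ => graphMap u F y + s • u) (nhdsWithin 0 (Ioi 0))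
      (nhds (graphMap u F y)) := by
    have : Continuous fun s : ℝ => graphMap u F y + s • u := by fun_prop
    have := this.tendsto 0
    simp only [zero_smul, add_zero] at this
    exact this.mono_left nhdsWithin_le_nhds
  have h1 := hc.eventually_mem (mem_interior_iff_mem_nhds.1 hint)
  obtain ⟨s, hs, hs0⟩ := (h1.and self_mem_nhdsWithin).exists
  have hs0' : 0 < s := hs0
  have e : graphMap u F y + s • u = (y : EuclideanSpace ℝ (Fin n)) + (F y + s) • u := by
    rw [graphMap, add_smul, add_assoc]
  have h2 := ((h.mem_iff _).1 hs).2.2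
  rw [inner_add_left, inner_graphMap hu, inner_smul_left, real_inner_self_eq_norm_sq, hu, e,
    proj_add_smul] at h2
  simp only [RCLike.conj_to_real, one_pow, mul_one] at h2
  linarith

lemma graphMap_mem_regularBoundary (hu : ‖u‖ = 1) {y : (ℝ ∙ u)ᗮ} (hy : y ∈ interior D) :
    graphMap u F y ∈ regularBoundary L :=
  ⟨h.graphMap_mem_frontier hu (interior_subset hy), _, h.isOuterUnitNormal hu hy,
    fun _ hv => h.eq_of_isOuterUnitNormal hu hy hv⟩

lemma gaussMap_graphMap (hu : ‖u‖ = 1) {y : (ℝ ∙ u)ᗮ} (hy : y ∈ interior D) :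
    gaussMap L (graphMap u F y) = ‖normalVec u F y‖⁻¹ • normalVec u F y :=
  h.eq_of_isOuterUnitNormal hu hy
    (isOuterUnitNormal_gaussMap (h.graphMap_mem_regularBoundary hu hy))

lemma isOuterUnitNormal_neg {x v : EuclideanSpace ℝ (Fin n)} (hv : IsOuterUnitNormal L x v) :
    IsOuterUnitNormal L (-x) (-v) := by
  refine ⟨by rw [norm_neg]; exact hv.1, fun z hz => ?_⟩
  have := hv.2 _ (h.neg_mem hz)
  rw [inner_neg_left] at this
  rw [inner_neg_right, inner_neg_neg]
  linarith

lemma neg_mem_regularBoundary {x : EuclideanSpace ℝ (Fin n)} (hx : x ∈ regularBoundary L) :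
    -x ∈ regularBoundary L := by
  obtain ⟨hf, v, hv, huniq⟩ := hx
  have e : -L = L := by
    ext z
    exact ⟨fun hz => by simpa using h.neg_mem hz, fun hz => h.neg_mem hz⟩
  refine ⟨?_, -v, h.isOuterUnitNormal_neg hv, fun w hw => ?_⟩
  · have h1 : -x ∈ -frontier L := by simpa using hf
    have h2 : -frontier L = frontier (-L) :=
      (Homeomorph.neg (EuclideanSpace ℝ (Fin n))).preimage_frontier L
    rwa [h2, e] at h1
  · have := h.isOuterUnitNormal_neg hw
    rw [neg_neg] at this
    rw [← huniq _ this, neg_neg]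

lemma gaussMap_neg {x : EuclideanSpace ℝ (Fin n)} (hx : x ∈ regularBoundary L) :
    gaussMap L (-x) = -gaussMap L x :=
  (h.neg_mem_regularBoundary hx).2.unique
    (isOuterUnitNormal_gaussMap (h.neg_mem_regularBoundary hx))
    (h.isOuterUnitNormal_neg (isOuterUnitNormal_gaussMap hx))

lemma supportFn_neg (v : EuclideanSpace ℝ (Fin n)) : supportFn L (-v) = supportFn L v := by
  unfold supportFn
  congr 1
  ext r
  constructor
  · rintro ⟨x, hx, rfl⟩; exact ⟨-x, h.neg_mem hx, by simp⟩
  · rintro ⟨x, hx, rfl⟩; exact ⟨-x, h.neg_mem hx, by simp⟩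

lemma frontier_subset (hu : ‖u‖ = 1) : frontier L ⊆
    (graphMap u F '' interior D ∪ -(graphMap u F '' interior D)) ∪
      graphMap u F '' frontier D := by
  intro x hx
  have hxL : x ∈ L := h.isCompact.isClosed.frontier_subset hx
  obtain ⟨h1, h2, h3⟩ := (h.mem_iff x).1 hxL
  have hgx : ∀ y : (ℝ ∙ u)ᗮ, proj u x = y → ⟪x, u⟫ = F y → graphMap u F y = x := by
    rintro y rfl he
    rw [graphMap, ← he]; exact (eq_proj_add_smul hu x).symm
  by_cases hi : proj u x ∈ interior D
  · left
    by_cases h4 : ⟪x, u⟫ = F (proj u x)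
    · left; exact ⟨_, hi, hgx _ rfl h4⟩
    by_cases h5 : -F (-proj u x) = ⟪x, u⟫
    · right
      refine ⟨-proj u x, h.neg_interior hi, ?_⟩
      rw [graphMap, show F (-proj u x) = -⟪x, u⟫ by linarith]
      conv_rhs => rw [eq_proj_add_smul hu x]
      rw [neg_add, neg_smul]; rfl
    -- Strictly between the two graphs over an interior point of D, continuity of F keeps a whole
    -- neighbourhood inside L.
    exfalso
    refine hx.2 (mem_interior_iff_mem_nhds.2 ?_)
    have hp : ContinuousAt (proj u) x := (proj u).continuous.continuousAt
    have hF1 : ContinuousAt (fun x => F (proj u x)) x :=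
      ContinuousAt.comp (f := proj u) (h.differentiableAt _ hi).continuousAt hp
    have hF2 : ContinuousAt (fun x => F (-proj u x)) x :=
      ContinuousAt.comp (f := fun x => -proj u x)
        (h.differentiableAt _ (h.neg_interior hi)).continuousAt hp.neg
    have hin : ContinuousAt (fun x : EuclideanSpace ℝ (Fin n) => ⟪x, u⟫) x := by fun_prop
    have e1 := hin.eventually_lt hF1 (lt_of_le_of_ne h3 h4)
    have e2 := hF2.neg.eventually_lt hin (lt_of_le_of_ne h2 h5)
    have e3 := hp.eventually_mem (mem_interior_iff_mem_nhds.1 hi)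
    filter_upwards [e1, e2, e3] with z h6 h7 h8
    exact (h.mem_iff z).2 ⟨h8, h7.le, h6.le⟩
  · right
    have hf : proj u x ∈ frontier D := ⟨subset_closure h1, hi⟩
    exact ⟨_, hf, hgx _ rfl (by linarith [h.eq_zero _ hf])⟩

lemma measurableSet_graph : MeasurableSet (graphMap u F '' interior D) := by
  refine isOpen_interior.measurableSet.image_of_continuousOn_injOn ?_ ?_
  · intro y hy
    exact (hasFDerivAt_graphMap
      (h.differentiableAt y hy).hasFDerivAt).continuousAt.continuousWithinAt
  · intro y _ z _ hyz
    have := congrArg (proj u) hyz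
    rwa [proj_graphMap, proj_graphMap] at this

lemma measure_graph_frontier (hn : 1 ≤ n) (hu : ‖u‖ = 1) :
    μHE[n - 1] (graphMap u F '' frontier D) = 0 := by
  obtain ⟨M, hM⟩ := h.isCompact.isBounded.subset_closedBall 0
  refine measure_graph_frontier_eq_zero (M := M) (by rw [finrank_euclideanSpace_fin]; omega) hu
    h.convex_base h.isCompact_base h.base_mem_nhds (fun y hy => ?_) ?_
  · have h1 := hM (h.graphMap_mem hu (h.isCompact_base.isClosed.frontier_subset hy))
    rw [mem_closedBall_zero_iff] at h1
    rw [← inner_graphMap hu F y]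
    refine (abs_real_inner_le_norm _ _).trans ?_
    rwa [hu, mul_one]
  -- F need not be continuous at the boundary of D; measurability comes from the section there being
  -- a single point, so that this piece of graph is a closed part of L.
  · have e : graphMap u F '' frontier D = L ∩ proj u ⁻¹' frontier D := by
      ext x
      constructor
      · rintro ⟨y, hy, rfl⟩
        refine ⟨h.graphMap_mem hu (h.isCompact_base.isClosed.frontier_subset hy), ?_⟩
        rwa [mem_preimage, proj_graphMap]
      · rintro ⟨hx, hy⟩
        obtain ⟨-, h2, h3⟩ := (h.mem_iff x).1 hx
        refine ⟨_, hy, ?_⟩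
        rw [graphMap, show F (proj u x) = ⟪x, u⟫ by linarith [h.eq_zero _ hy]]
        exact (eq_proj_add_smul hu x).symm
    rw [e]
    exact h.isCompact.measurableSet.inter
      ((isClosed_frontier.preimage (proj u).continuous).measurableSet)

lemma measure_frontier (hn : 1 ≤ n) : μHE[n - 1] (frontier L) < ⊤ :=
  measure_frontier_lt_top (by rw [finrank_euclideanSpace_fin]; omega) h.convex h.isCompact
    h.mem_nhds

lemma map_proj_graph (hn : 1 ≤ n) (hu : ‖u‖ = 1) :
    Measure.map (proj u) ((μHE[n - 1]).restrict (graphMap u F '' interior D)) =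
      (volume.restrict (interior D)).withDensity fun y => ENNReal.ofReal ‖normalVec u F y‖ := by
  have := map_proj_restrict_graph hu isOpen_interior.measurableSet h.differentiableAt
  rw [finrank_orthogonal (m := n - 1) (by rw [finrank_euclideanSpace_fin]; omega) hu] at this
  rw [this]
  simp only [norm_normalVec hu]

end IsGraphBody

end LpProjection

namespace LpProjection

/-! ### The surface integral as an integral over the base. -/

variable {n : ℕ} {u : EuclideanSpace ℝ (Fin n)}

namespace IsGraphBody

variable {L : Set (EuclideanSpace ℝ (Fin n))} {D : Set (ℝ ∙ u)ᗮ} {F : (ℝ ∙ u)ᗮ → ℝ}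
  (h : IsGraphBody u L D F)
include h

/-- The right-hand side is the maximum of ⟪·, normalVec⟫ on L, and L contains a ball of radius r.
The bound keeps the negative power h^{1-p} bounded. -/
lemma exists_le_support (hu : ‖u‖ = 1) : ∃ r : ℝ, 0 < r ∧ ∀ y ∈ interior D,
    r * ‖normalVec u F y‖ ≤ F y - fderiv ℝ F y y := by
  obtain ⟨r, hr, hrL⟩ := Metric.nhds_basis_closedBall.mem_iff.1 h.mem_nhds
  refine ⟨r, hr, fun y hy => ?_⟩
  have hpos := norm_normalVec_pos hu F y
  have hz : (r * ‖normalVec u F y‖⁻¹) • normalVec u F y ∈ L := by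
    apply hrL
    rw [mem_closedBall_zero_iff, norm_smul, Real.norm_of_nonneg (by positivity), mul_assoc,
      inv_mul_cancel₀ hpos.ne', mul_one]
  have h1 := h.inner_le hu hy hz
  rw [inner_smul_left, real_inner_self_eq_norm_sq] at h1
  simp only [RCLike.conj_to_real] at h1
  convert h1 using 1
  field_simp

/-- The derivative `fderiv ℝ F` is measurable on all of u^⊥ for any F; F itself is only known to be
continuous on the interior of D. -/
lemma aestronglyMeasurable_profile {f : ℝ → ℝ → ℝ → ℝ}
    (hf : Measurable fun z : ℝ × ℝ × ℝ => f z.1 z.2.1 z.2.2) (w : (ℝ ∙ u)ᗮ) :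
    AEStronglyMeasurable (fun y => f (fderiv ℝ F y w) (F y - fderiv ℝ F y y) ‖normalVec u F y‖)
      (volume.restrict (interior D)) := by
  have hD : Measurable (fderiv ℝ F) := measurable_fderiv ℝ F
  have h1 : Measurable fun y => fderiv ℝ F y w := measurable_fderiv_apply_const ℝ F w
  have h2 : Measurable fun y => fderiv ℝ F y y :=
    isBoundedBilinearMap_apply.continuous.measurable.comp (hD.prodMk measurable_id)
  have h3 : AEMeasurable F (volume.restrict (interior D)) :=
    (ContinuousOn.aestronglyMeasurable (fun y hy =>
      (h.differentiableAt y hy).continuousAt.continuousWithinAt)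
      isOpen_interior.measurableSet).aemeasurable
  have h4 : Measurable fun y => ‖normalVec u F y‖ := by
    unfold normalVec
    refine Measurable.norm (Measurable.add_const ?_ _)
    refine Continuous.measurable (by fun_prop) |>.comp
      (((InnerProductSpace.toDual ℝ (ℝ ∙ u)ᗮ).symm.continuous.measurable.comp hD).neg)
  exact (hf.comp_aemeasurable
    (h1.aemeasurable.prodMk ((h3.sub h2.aemeasurable).prodMk h4.aemeasurable))).aestronglyMeasurable

/-- The surface integral defining `Π_p L`, as an integral over the base of the graph. -/
theorem integral_surfaceAreaMeasure (hn : 1 ≤ n) (hu : ‖u‖ = 1) {p : ℝ} (hp : 1 < p)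
    (v : EuclideanSpace ℝ (Fin n)) :
    IntegrableOn (fun y => |⟪v, u⟫ - fderiv ℝ F y (proj u v)| ^ p *
        (F y - fderiv ℝ F y y) ^ (1 - p)) (interior D) ∧
    ∫ θ, |⟪v, θ⟫| ^ p * supportFn L θ ^ (1 - p) ∂(surfaceAreaMeasure L) =
      2 * ∫ y in interior D, |⟪v, u⟫ - fderiv ℝ F y (proj u v)| ^ p *
        (F y - fderiv ℝ F y y) ^ (1 - p) := by
  set Γ := graphMap u F '' interior D with hΓ
  have hΓm : MeasurableSet Γ := h.measurableSet_graph
  have hnegm : MeasurableSet (-Γ) := hΓm.neg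
  have hΓreg : Γ ⊆ regularBoundary L := by
    rintro _ ⟨y, hy, rfl⟩; exact h.graphMap_mem_regularBoundary hu hy
  have hnreg : -Γ ⊆ regularBoundary L := fun x hx => by
    simpa using h.neg_mem_regularBoundary (hΓreg hx)
  set φ : EuclideanSpace ℝ (Fin n) → ℝ := fun θ => |⟪v, θ⟫| ^ p * supportFn L θ ^ (1 - p) with hφ
  have hφm : Measurable φ :=
    ((Continuous.measurable (by fun_prop : Continuous fun θ => |⟪v, θ⟫|)).pow_const p).mul
      ((continuous_supportFn h.isCompact).measurable.pow_const (1 - p))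
  have hφneg : ∀ θ, φ (-θ) = φ θ := fun θ => by
    simp only [hφ, inner_neg_right, abs_neg, h.supportFn_neg]
  set Ψ : (ℝ ∙ u)ᗮ → ℝ := fun y => (|⟪v, u⟫ - fderiv ℝ F y (proj u v)| / ‖normalVec u F y‖) ^ p *
    ((F y - fderiv ℝ F y y) / ‖normalVec u F y‖) ^ (1 - p) with hΨ
  obtain ⟨r, hr, hrle⟩ := h.exists_le_support hu
  have hφΨ : ∀ x ∈ Γ, φ (gaussMap L x) = Ψ (proj u x) := by
    rintro _ ⟨y, hy, rfl⟩
    have hs := supportFn_eq_of_isOuterUnitNormal (h.graphMap_mem hu (interior_subset hy))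
      (h.isOuterUnitNormal hu hy)
    simp only [hφ, hΨ]
    rw [proj_graphMap, h.gaussMap_graphMap hu hy, hs, inner_smul_right, inner_smul_right,
      inner_graphMap_normalVec hu, inner_normalVec hu, abs_mul, abs_inv, abs_norm,
      inv_mul_eq_div, inv_mul_eq_div]
  -- The integrand has degree p + (1 - p) = 1 in the normal, so its normalization cancels against
  -- the Jacobian ‖normalVec‖.
  have hΨd : ∀ y ∈ interior D, ‖normalVec u F y‖ * Ψ y =
      |⟪v, u⟫ - fderiv ℝ F y (proj u v)| ^ p * (F y - fderiv ℝ F y y) ^ (1 - p) := by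
    intro y hy
    have hpos := norm_normalVec_pos hu F y
    have hb : 0 ≤ F y - fderiv ℝ F y y := (by positivity : 0 ≤ r * _).trans (hrle y hy)
    simp only [hΨ]
    rw [Real.div_rpow (abs_nonneg _) hpos.le, Real.div_rpow hb hpos.le, Real.rpow_sub hpos,
      Real.rpow_one]
    have : ‖normalVec u F y‖ ^ p ≠ 0 := (Real.rpow_pos_of_pos hpos p).ne'
    field_simp
  have hmap := h.map_proj_graph hn hu
  rw [← hΓ] at hmap
  set J : (ℝ ∙ u)ᗮ → ENNReal := fun y => ENNReal.ofReal ‖normalVec u F y‖ with hJ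
  have hJm : AEMeasurable J (volume.restrict (interior D)) :=
    (h.aestronglyMeasurable_profile (f := fun _ _ c => c) (by fun_prop) 0).aemeasurable.ennreal_ofReal
  have hJtop : ∀ᵐ y ∂(volume.restrict (interior D)), J y < ⊤ :=
    Filter.Eventually.of_forall fun y => ENNReal.ofReal_lt_top
  have hJreal : ∀ y, (J y).toReal = ‖normalVec u F y‖ := fun y =>
    ENNReal.toReal_ofReal (norm_nonneg _)
  have hac := withDensity_absolutelyContinuous (volume.restrict (interior D)) J
  have hΨm : AEStronglyMeasurable Ψ ((volume.restrict (interior D)).withDensity J) := by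
    refine AEStronglyMeasurable.mono_ac hac ?_
    refine h.aestronglyMeasurable_profile
      (f := fun a b c => (|⟪v, u⟫ - a| / c) ^ p * (b / c) ^ (1 - p)) ?_ (proj u v)
    fun_prop
  -- The total mass is the area of the graph, which is part of a boundary of finite measure;
  -- integrability then follows from boundedness of Ψ.
  have hfin : IsFiniteMeasure ((volume.restrict (interior D)).withDensity J) := by
    rw [← hmap]
    constructor
    rw [Measure.map_apply (proj u).continuous.measurable MeasurableSet.univ, preimage_univ,
      Measure.restrict_apply_univ]
    exact (measure_mono (hΓreg.trans fun x hx => hx.1)).trans_lt (h.measure_frontier hn)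
  have hΨi : Integrable Ψ ((volume.restrict (interior D)).withDensity J) := by
    refine Integrable.of_bound hΨm (‖v‖ ^ p * r ^ (1 - p)) ?_
    refine hac.ae_le ((ae_restrict_iff' isOpen_interior.measurableSet).2
      (Filter.Eventually.of_forall fun y hy => ?_))
    have hpos := norm_normalVec_pos hu F y
    have hb : r ≤ (F y - fderiv ℝ F y y) / ‖normalVec u F y‖ := by
      rw [le_div_iff₀ hpos]; exact hrle y hy
    have h1 : |⟪v, u⟫ - fderiv ℝ F y (proj u v)| / ‖normalVec u F y‖ ≤ ‖v‖ := by
      rw [div_le_iff₀ hpos, ← inner_normalVec hu]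
      exact abs_real_inner_le_norm _ _
    rw [Real.norm_of_nonneg (mul_nonneg (Real.rpow_nonneg (by positivity) _)
      (Real.rpow_nonneg (hr.le.trans hb) _))]
    exact mul_le_mul (Real.rpow_le_rpow (by positivity) h1 (by linarith))
      (Real.rpow_le_rpow_of_nonpos hr hb (by linarith)) (Real.rpow_nonneg (hr.le.trans hb) _)
      (by positivity)
  have hdensity : IntegrableOn (fun y => |⟪v, u⟫ - fderiv ℝ F y (proj u v)| ^ p *
        (F y - fderiv ℝ F y y) ^ (1 - p)) (interior D) := by
    rw [integrable_withDensity_iff_integrable_smul₀' hJm hJtop] at hΨi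
    refine IntegrableOn.congr_fun hΨi (fun y hy => ?_) isOpen_interior.measurableSet
    simp only [hJreal, smul_eq_mul]
    exact hΨd y hy
  refine ⟨hdensity, ?_⟩
  have hψi : IntegrableOn (fun x => φ (gaussMap L x)) Γ (μHE[n - 1]) := by
    have h1 : IntegrableOn (fun x => Ψ (proj u x)) Γ (μHE[n - 1]) := by
      rw [← hmap] at hΨi
      exact hΨi.comp_measurable (proj u).continuous.measurable
    exact h1.congr_fun (fun x hx => (hφΨ x hx).symm) hΓm
  have hI1 : ∫ x in Γ, φ (gaussMap L x) ∂(μHE[n - 1]) = ∫ y in interior D,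
      |⟪v, u⟫ - fderiv ℝ F y (proj u v)| ^ p * (F y - fderiv ℝ F y y) ^ (1 - p) := by
    rw [setIntegral_congr_fun hΓm hφΨ]
    rw [← integral_map (f := Ψ) (φ := proj u) (proj u).continuous.aemeasurable
      (by rw [hmap]; exact hΨm), hmap, integral_withDensity_eq_integral_toReal_smul₀ hJm hJtop]
    refine setIntegral_congr_fun isOpen_interior.measurableSet fun y hy => ?_
    simp only [hJreal, smul_eq_mul]
    exact hΨd y hy
  have hneg : MeasurePreserving (Neg.neg : EuclideanSpace ℝ (Fin n) → EuclideanSpace ℝ (Fin n))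
      (μHE[n - 1]) (μHE[n - 1]) :=
    (IsometryEquiv.neg (EuclideanSpace ℝ (Fin n))).measurePreserving_euclideanHausdorffMeasure _
  have hemb : MeasurableEmbedding
      (Neg.neg : EuclideanSpace ℝ (Fin n) → EuclideanSpace ℝ (Fin n)) :=
    (MeasurableEquiv.neg (EuclideanSpace ℝ (Fin n))).measurableEmbedding
  have hψneg : ∀ x ∈ -Γ, φ (gaussMap L x) = φ (gaussMap L (-x)) := fun x hx => by
    rw [h.gaussMap_neg (hnreg hx), hφneg]
  have hpre : (Neg.neg : EuclideanSpace ℝ (Fin n) → EuclideanSpace ℝ (Fin n)) ⁻¹' Γ = -Γ := rfl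
  have hψi' : IntegrableOn (fun x => φ (gaussMap L x)) (-Γ) (μHE[n - 1]) := by
    have h1 := (hneg.integrableOn_comp_preimage hemb).2 hψi
    rw [hpre] at h1
    exact h1.congr_fun (fun x hx => (hψneg x hx).symm) hnegm
  have hI2 : ∫ x in -Γ, φ (gaussMap L x) ∂(μHE[n - 1]) =
      ∫ x in Γ, φ (gaussMap L x) ∂(μHE[n - 1]) := by
    rw [setIntegral_congr_fun hnegm hψneg, ← hpre]
    exact hneg.setIntegral_preimage_emb hemb (fun x => φ (gaussMap L x)) Γ
  have hdisj : Disjoint Γ (-Γ) := by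
    refine disjoint_left.2 ?_
    rintro x ⟨y, hy, hyx⟩ ⟨z, hz, hzx⟩
    have h1 : graphMap u F z = -graphMap u F y := by rw [hyx, hzx]
    have h2 := congrArg (proj u) h1
    rw [map_neg, proj_graphMap, proj_graphMap] at h2
    have h3 := congrArg (fun x => ⟪x, u⟫) h1
    simp only [inner_neg_left, inner_graphMap hu] at h3
    rw [h2] at h3
    linarith [h.pos y hy]
  -- Up to the null set over `frontier D`, the regular boundary is the graph and its antipodal
  -- image. These contribute equally, whence the factor 2.
  have hae : regularBoundary L =ᵐ[μHE[n - 1]] (Γ ∪ -Γ : Set (EuclideanSpace ℝ (Fin n))) := by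
    refine ae_eq_set.2 ⟨?_, ?_⟩
    · refine measure_mono_null ?_ (h.measure_graph_frontier hn hu)
      rintro x ⟨hx1, hx2⟩
      exact (h.frontier_subset hu hx1.1).resolve_left hx2
    · rw [sdiff_eq_empty.2 (union_subset hΓreg hnreg), measure_empty]
  unfold surfaceAreaMeasure
  rw [integral_map (measurable_gaussMap h.isCompact).aemeasurable hφm.aestronglyMeasurable,
    setIntegral_congr_set hae, setIntegral_union hdisj hnegm hψi hψi', hI2, hI1]
  ring

end IsGraphBody

end LpProjection

/-! ### The boundary function of a symmetric C²₊ body. -/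

namespace LpProjection

variable {n : ℕ} {u : EuclideanSpace ℝ (Fin n)} {K : Set (EuclideanSpace ℝ (Fin n))}

lemma IsSymmetricConvexBody.mem_nhds_zero (hK : IsSymmetricConvexBody K) : K ∈ nhds 0 := by
  obtain ⟨x, hx⟩ := hK.nonempty_interior
  have e : -K = K := by
    ext z
    exact ⟨fun hz => by simpa using hK.neg_mem _ hz, fun hz => hK.neg_mem _ hz⟩
  have hx' : -x ∈ interior K := by
    have h1 : -x ∈ -interior K := by simpa using hx
    have h2 : -interior K = interior (-K) :=
      (Homeomorph.neg (EuclideanSpace ℝ (Fin n))).preimage_interior K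
    rwa [h2, e] at h1
  have := hK.convex.interior hx hx' (show (0 : ℝ) ≤ 1 / 2 by norm_num)
    (show (0 : ℝ) ≤ 1 / 2 by norm_num) (by norm_num)
  rw [smul_neg, add_neg_cancel] at this
  exact mem_interior_iff_mem_nhds.1 this

/-- The upper boundary function `f(y) = max {s : y + s u ∈ K}` of a body `K`. -/
def upperFn (u : EuclideanSpace ℝ (Fin n)) (K : Set (EuclideanSpace ℝ (Fin n))) (y : (ℝ ∙ u)ᗮ) : ℝ :=
  sSup (fiber u K y)

lemma isCompact_fiber (hu : ‖u‖ = 1) (hK : IsCompact K) (y : (ℝ ∙ u)ᗮ) :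
    IsCompact (fiber u K y) := by
  have h1 : IsCompact ((fun x => ⟪x, u⟫) '' K) := hK.image (by fun_prop)
  refine h1.of_isClosed_subset (hK.isClosed.preimage (by fun_prop)) fun s hs => ⟨_, hs, ?_⟩
  simp only [inner_add_left, inner_coe_orthogonal, inner_smul_left, real_inner_self_eq_norm_sq, hu]
  simp

lemma convex_fiber (hK : Convex ℝ K) (y : (ℝ ∙ u)ᗮ) : Convex ℝ (fiber u K y) := by
  intro s hs r hr a b ha hb hab
  have := hK hs hr ha hb hab
  have e : a • ((y : EuclideanSpace ℝ (Fin n)) + s • u) +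
      b • ((y : EuclideanSpace ℝ (Fin n)) + r • u) =
      (y : EuclideanSpace ℝ (Fin n)) + (a • s + b • r) • u := by
    have hb' : b = 1 - a := by linarith
    subst hb'
    module
  rwa [e] at this

lemma fiber_nonempty_iff (hu : ‖u‖ = 1) (y : (ℝ ∙ u)ᗮ) :
    (fiber u K y).Nonempty ↔ y ∈ proj u '' K := by
  constructor
  · rintro ⟨s, hs⟩; exact ⟨_, hs, proj_add_smul u y s⟩
  · rintro ⟨x, hx, rfl⟩
    refine ⟨⟪x, u⟫, ?_⟩
    change (proj u x : EuclideanSpace ℝ (Fin n)) + ⟪x, u⟫ • u ∈ K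
    rwa [← eq_proj_add_smul hu x]

lemma fiber_neg (hK : IsSymmetricConvexBody K) (y : (ℝ ∙ u)ᗮ) :
    fiber u K ((-y : (ℝ ∙ u)ᗮ) : EuclideanSpace ℝ (Fin n)) = -fiber u K y := by
  ext s
  have e : ((-y : (ℝ ∙ u)ᗮ) : EuclideanSpace ℝ (Fin n)) + s • u =
      -((y : EuclideanSpace ℝ (Fin n)) + (-s) • u) := by
    rw [neg_add, neg_smul, neg_neg]; rfl
  change ((-y : (ℝ ∙ u)ᗮ) : EuclideanSpace ℝ (Fin n)) + s • u ∈ K ↔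
    (y : EuclideanSpace ℝ (Fin n)) + (-s) • u ∈ K
  rw [e]
  exact ⟨fun h => by simpa using hK.neg_mem _ h, fun h => hK.neg_mem _ h⟩

/-- Symmetry expresses the lower endpoint through the same function. The hypothesis on y matters:
over an empty section `upperFn` takes the default value 0. -/
lemma fiber_eq_Icc (hu : ‖u‖ = 1) (hK : IsSymmetricConvexBody K) {y : (ℝ ∙ u)ᗮ}
    (hy : y ∈ proj u '' K) :
    fiber u K y = Icc (-upperFn u K (-y)) (upperFn u K y) := by
  have hn := (fiber_nonempty_iff hu y).2 hy
  have h1 := eq_Icc_of_connected_compact ⟨hn, (convex_fiber hK.convex y).isPreconnected⟩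
    (isCompact_fiber hu hK.isCompact y)
  have h2 : upperFn u K (-y) = -sInf (fiber u K y) := by
    rw [upperFn, fiber_neg hK, Real.sInf_def, neg_neg]
  rw [h2, neg_neg]; exact h1

lemma mem_iff_upperFn (hu : ‖u‖ = 1) (hK : IsSymmetricConvexBody K)
    (x : EuclideanSpace ℝ (Fin n)) : x ∈ K ↔ proj u x ∈ proj u '' K ∧
      -upperFn u K (-proj u x) ≤ ⟪x, u⟫ ∧ ⟪x, u⟫ ≤ upperFn u K (proj u x) := by
  have h1 : x ∈ K ↔ ⟪x, u⟫ ∈ fiber u K (proj u x) := by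
    change _ ↔ (proj u x : EuclideanSpace ℝ (Fin n)) + ⟪x, u⟫ • u ∈ K
    rw [← eq_proj_add_smul hu x]
  constructor
  · intro hx
    have h2 : proj u x ∈ proj u '' K := ⟨x, hx, rfl⟩
    rw [h1, fiber_eq_Icc hu hK h2] at hx
    exact ⟨h2, hx⟩
  · rintro ⟨h2, h3⟩
    rw [h1, fiber_eq_Icc hu hK h2]
    exact h3

lemma neg_mem_proj (hK : IsSymmetricConvexBody K) {y : (ℝ ∙ u)ᗮ} (hy : y ∈ proj u '' K) :
    -y ∈ proj u '' K := by
  obtain ⟨x, hx, rfl⟩ := hy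
  exact ⟨-x, hK.neg_mem _ hx, map_neg _ _⟩

lemma proj_mem_nhds (hK : IsSymmetricConvexBody K) : proj u '' K ∈ nhds 0 := by
  have := (proj_isOpenMap u).image_mem_nhds hK.mem_nhds_zero
  rwa [map_zero] at this

/-- Over interior points of the projection the sections have positive length. -/
lemma upperFn_add_pos (hu : ‖u‖ = 1) (hK : IsSymmetricConvexBody K) {y : (ℝ ∙ u)ᗮ}
    (hy : y ∈ interior (proj u '' K)) : 0 < upperFn u K y + upperFn u K (-y) := by
  obtain ⟨r, hr, hrK⟩ := Metric.nhds_basis_closedBall.mem_iff.1 hK.mem_nhds_zero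
  have hc : Continuous fun a : ℝ => a • y := by fun_prop
  have h1 : ∀ᶠ a in nhds (1 : ℝ), a • y ∈ proj u '' K := by
    apply hc.continuousAt.eventually_mem
    rw [one_smul]; exact mem_interior_iff_mem_nhds.1 hy
  obtain ⟨a, ha1, ⟨x, hx, hxa⟩⟩ := ((h1.filter_mono nhdsWithin_le_nhds).and
    (self_mem_nhdsWithin (s := Ioi (1 : ℝ)))).exists.imp fun a h => And.symm h
  have ha : (1 : ℝ) < a := ha1
  have hapos : 0 < a := by linarith
  -- Since a • y is still in the projection for some a > 1, the point over y is a proper convex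
  -- combination of a point of K and the centre of a ball in K. Moving within the ball along u gives
  -- two points of the section.
  have hmem : ∀ σ : ℝ, |σ| ≤ 1 → a⁻¹ * ⟪x, u⟫ + (1 - a⁻¹) * (σ * r) ∈ fiber u K y := by
    intro σ hσ
    have hru : (σ * r) • u ∈ K := by
      apply hrK
      rw [mem_closedBall_zero_iff, norm_smul, hu, mul_one, Real.norm_eq_abs, abs_mul,
        abs_of_pos hr]
      nlinarith
    have ha' : a⁻¹ ≤ 1 := inv_le_one_of_one_le₀ ha.le
    have h2 := hK.convex hx hru (inv_nonneg.2 hapos.le) (sub_nonneg.2 ha') (by ring)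
    have e : a⁻¹ • x + (1 - a⁻¹) • (σ * r) • u =
        (y : EuclideanSpace ℝ (Fin n)) + (a⁻¹ * ⟪x, u⟫ + (1 - a⁻¹) * (σ * r)) • u := by
      have h3 : a⁻¹ • x = (y : EuclideanSpace ℝ (Fin n)) + (a⁻¹ * ⟪x, u⟫) • u := by
        refine (congrArg (a⁻¹ • ·) (eq_proj_add_smul hu x)).trans ?_
        rw [hxa, smul_add, smul_smul, Submodule.coe_smul, inv_smul_smul₀ hapos.ne']
      rw [h3, add_smul, smul_smul, add_assoc]
    rwa [e] at h2
  have hyK : y ∈ proj u '' K := interior_subset hy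
  have h3 := hmem 1 (by simp)
  have h4 := hmem (-1) (by simp)
  rw [fiber_eq_Icc hu hK hyK] at h3 h4
  have h5 : a⁻¹ < 1 := inv_lt_one_of_one_lt₀ ha
  have h6 : 0 < (1 - a⁻¹) * r := mul_pos (by linarith) hr
  have h7 := h3.2
  have h8 := h4.1
  nlinarith

/-- Over boundary points of the projection of a `C²₊` body, the sections are single points. -/
lemma upperFn_add_eq_zero (hu : ‖u‖ = 1) (hK : IsSymmetricConvexBody K) (hC : IsC2Plus K)
    {y : (ℝ ∙ u)ᗮ} (hy : y ∈ frontier (proj u '' K)) :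
    upperFn u K y + upperFn u K (-y) = 0 := by
  have hu0 : u ≠ 0 := by rintro rfl; simp at hu
  have hDc : IsCompact (proj u '' K) := hK.isCompact.image (proj u).continuous
  have hyK : y ∈ proj u '' K := hDc.isClosed.frontier_subset hy
  have hIcc := fiber_eq_Icc hu hK hyK
  have hle : -upperFn u K (-y) ≤ upperFn u K y := by
    rw [← nonempty_Icc, ← hIcc]; exact (fiber_nonempty_iff hu y).2 hyK
  by_contra hne
  have hlt : -upperFn u K (-y) < upperFn u K y :=
    lt_of_le_of_ne hle fun h => hne (by linarith)
  obtain ⟨s₀, hs₀⟩ := exists_between hlt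
  set x : EuclideanSpace ℝ (Fin n) := (y : EuclideanSpace ℝ (Fin n)) + s₀ • u with hx
  have hline : ∀ s, s ∈ Icc (-upperFn u K (-y)) (upperFn u K y) →
      (y : EuclideanSpace ℝ (Fin n)) + s • u ∈ K := fun s hs => by
    rw [← hIcc] at hs; exact hs
  have hnint : ∀ s, (y : EuclideanSpace ℝ (Fin n)) + s • u ∉ interior K := fun s hs => by
    have := (proj_isOpenMap u).image_mem_nhds (mem_interior_iff_mem_nhds.1 hs)
    rw [proj_add_smul] at this
    exact hy.2 (mem_interior_iff_mem_nhds.2 this)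
  have hxF : x ∈ frontier K := ⟨subset_closure (hline _ ⟨hs₀.1.le, hs₀.2.le⟩), hnint s₀⟩
  obtain ⟨U, ρ, hU, hxU, hρ, hKU, hdρ, hpos⟩ := hC x hxF
  have hc : Continuous fun s : ℝ => (y : EuclideanSpace ℝ (Fin n)) + s • u := by fun_prop
  -- A nondegenerate section over a boundary point would be a segment in the boundary of K parallel
  -- to u. The function ρ vanishes along it, so Dρ(u) = 0 and D²ρ(u,u) = 0, against positive
  -- curvature.
  have hev : ∀ᶠ s in nhds s₀, (y : EuclideanSpace ℝ (Fin n)) + s • u ∈ U ∧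
      ρ ((y : EuclideanSpace ℝ (Fin n)) + s • u) = 0 := by
    filter_upwards [hc.continuousAt.eventually_mem (hU.mem_nhds hxU), Icc_mem_nhds hs₀.1 hs₀.2]
      with s hsU hsI
    refine ⟨hsU, ?_⟩
    have h1 : (y : EuclideanSpace ℝ (Fin n)) + s • u ∈ {z ∈ U | ρ z ≤ 0} := by
      rw [← hKU]; exact ⟨hline s hsI, hsU⟩
    refine le_antisymm h1.2 (not_lt.1 fun hlt => hnint s ?_)
    have hcont := (hρ.continuousOn.continuousAt (hU.mem_nhds hsU)).eventually_lt
      continuousAt_const hlt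
    refine mem_interior_iff_mem_nhds.2 ?_
    filter_upwards [hcont, hU.mem_nhds hsU] with z hz hzU
    have : z ∈ K ∩ U := by rw [hKU]; exact ⟨hzU, le_of_lt hz⟩
    exact this.1
  have hdiff : ∀ z ∈ U, DifferentiableAt ℝ ρ z := fun z hz =>
    (hρ.differentiableOn (by norm_num)).differentiableAt (hU.mem_nhds hz)
  have hd1 : ∀ᶠ s in nhds s₀, fderiv ℝ ρ ((y : EuclideanSpace ℝ (Fin n)) + s • u) u = 0 := by
    filter_upwards [hev.eventually_nhds] with s hs
    have h1 : HasDerivAt (fun s : ℝ => (y : EuclideanSpace ℝ (Fin n)) + s • u) u s := by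
      simpa using ((hasDerivAt_id s).smul_const u).const_add (y : EuclideanSpace ℝ (Fin n))
    have h2 := (hdiff _ hs.self_of_nhds.1).hasFDerivAt.comp_hasDerivAt s h1
    have h3 : ρ ∘ (fun s : ℝ => (y : EuclideanSpace ℝ (Fin n)) + s • u) =ᶠ[nhds s] fun _ => 0 :=
      hs.mono fun r hr => hr.2
    exact h2.unique ((hasDerivAt_const s (0 : ℝ)).congr_of_eventuallyEq h3)
  have hd2 : fderiv ℝ (fderiv ℝ ρ) x u u = 0 := by
    have h1 : HasDerivAt (fun s : ℝ => (y : EuclideanSpace ℝ (Fin n)) + s • u) u s₀ := by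
      simpa using ((hasDerivAt_id s₀).smul_const u).const_add (y : EuclideanSpace ℝ (Fin n))
    have h4 : DifferentiableAt ℝ (fderiv ℝ ρ) x :=
      ((hρ.fderiv_of_isOpen hU (m := 1) (by norm_num)).differentiableOn
        (by norm_num)).differentiableAt (hU.mem_nhds hxU)
    have h2 := h4.hasFDerivAt.comp_hasDerivAt s₀ h1
    have h5 := h2.clm_apply (hasDerivAt_const s₀ u)
    have h3 : (fun s : ℝ => (fderiv ℝ ρ ∘ fun s : ℝ =>
        (y : EuclideanSpace ℝ (Fin n)) + s • u) s u) =ᶠ[nhds s₀] fun _ => 0 := hd1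
    have := h5.unique ((hasDerivAt_const s₀ (0 : ℝ)).congr_of_eventuallyEq h3)
    simpa using this
  exact (hpos u hu0 hd1.self_of_nhds).ne' hd2

/-- The boundary function of a body of class `C²₊` is differentiable over the interior of the
projection, and lies below its tangents. -/
lemma upperFn_differentiable (hu : ‖u‖ = 1) (hK : IsSymmetricConvexBody K) (hC : IsC2Plus K)
    {y : (ℝ ∙ u)ᗮ} (hy : y ∈ interior (proj u '' K)) :
    DifferentiableAt ℝ (upperFn u K) y ∧ ∀ z ∈ proj u '' K,
      upperFn u K z ≤ upperFn u K y + fderiv ℝ (upperFn u K) y (z - y) := by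
  have hyK : y ∈ proj u '' K := interior_subset hy
  set f := upperFn u K with hf
  have hG : ∀ z ∈ proj u '' K, graphMap u f z ∈ K := fun z hz => by
    have h1 := fiber_eq_Icc hu hK hz
    have h2 : f z ∈ fiber u K z := by
      rw [h1, right_mem_Icc, ← nonempty_Icc, ← h1]; exact (fiber_nonempty_iff hu z).2 hz
    exact h2
  set x := graphMap u f y with hx
  have hxint : x ∉ interior K := fun hint => by
    have hc : Filter.Tendsto (fun s : ℝ => x + s • u) (nhdsWithin 0 (Ioi 0)) (nhds x) := by
      have : Continuous fun s : ℝ => x + s • u := by fun_prop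
      have := this.tendsto 0
      simp only [zero_smul, add_zero] at this
      exact this.mono_left nhdsWithin_le_nhds
    obtain ⟨s, hs, hs0⟩ := ((hc.eventually_mem (mem_interior_iff_mem_nhds.1 hint)).and
      self_mem_nhdsWithin).exists
    have hs0' : 0 < s := hs0
    have e : x + s • u = (y : EuclideanSpace ℝ (Fin n)) + (f y + s) • u := by
      rw [hx, graphMap, add_smul, add_assoc]
    rw [e] at hs
    have h1 : f y + s ∈ fiber u K y := hs
    rw [fiber_eq_Icc hu hK hyK] at h1
    linarith [h1.2]
  have hxK : x ∈ K := hG y hyK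
  obtain ⟨U, ρ, hU, hxU, hρ, hKU, hdρ, -⟩ := hC x ⟨subset_closure hxK, hxint⟩
  have hρd : HasFDerivAt ρ (fderiv ℝ ρ x) x :=
    ((hρ.differentiableOn (by norm_num)).differentiableAt (hU.mem_nhds hxU)).hasFDerivAt
  set l := fderiv ℝ ρ x with hl
  have hρx : ρ x = 0 := by
    have h1 : x ∈ {z ∈ U | ρ z ≤ 0} := by rw [← hKU]; exact ⟨hxK, hxU⟩
    refine le_antisymm h1.2 (not_lt.1 fun hlt => hxint ?_)
    have hcont := (hρ.continuousOn.continuousAt (hU.mem_nhds hxU)).eventually_lt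
      continuousAt_const hlt
    refine mem_interior_iff_mem_nhds.2 ?_
    filter_upwards [hcont, hU.mem_nhds hxU] with z hz hzU
    have : z ∈ K ∩ U := by rw [hKU]; exact ⟨hzU, le_of_lt hz⟩
    exact this.1
  -- On the segment from x to z, ρ starts at 0 and is nonpositive near x, so its one-sided
  -- derivative is at most 0.
  have hsupp : ∀ z ∈ K, l (z - x) ≤ 0 := by
    intro z hz
    have h1 : HasDerivAt (fun τ : ℝ => x + τ • (z - x)) (z - x) 0 := by
      simpa using ((hasDerivAt_id (0 : ℝ)).smul_const (z - x)).const_add x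
    have h2 : HasDerivAt (ρ ∘ fun τ : ℝ => x + τ • (z - x)) (l (z - x)) 0 := by
      have : HasFDerivAt ρ l (x + (0 : ℝ) • (z - x)) := by simpa using hρd
      exact this.comp_hasDerivAt 0 h1
    have h3 := (hasDerivWithinAt_iff_tendsto_slope' (s := Ioi 0) (by simp)).1
      (h2.hasDerivWithinAt (s := Ioi 0))
    refine le_of_tendsto h3 ?_
    have hcU : ∀ᶠ τ in nhdsWithin (0 : ℝ) (Ioi 0), x + τ • (z - x) ∈ U := by
      have : ContinuousAt (fun τ : ℝ => x + τ • (z - x)) 0 := h1.continuousAt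
      refine (this.eventually_mem (hU.mem_nhds ?_)).filter_mono nhdsWithin_le_nhds
      simpa using hxU
    filter_upwards [hcU, Ioo_mem_nhdsGT (show (0 : ℝ) < 1 by norm_num)] with τ hτU hτ
    have h4 : x + τ • (z - x) ∈ {z ∈ U | ρ z ≤ 0} := by
      rw [← hKU]
      exact ⟨hK.convex.add_smul_sub_mem hxK hz ⟨hτ.1.le, hτ.2.le⟩, hτU⟩
    rw [slope_def_field]
    simp only [Function.comp_apply, zero_smul, add_zero, hρx, sub_zero]
    exact div_nonpos_of_nonpos_of_nonneg h4.2 hτ.1.le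
  have hlu0 : 0 ≤ l u := by
    have h1 : -f (-y) ∈ fiber u K y := by
      have h2 := fiber_eq_Icc hu hK hyK
      rw [h2, left_mem_Icc, ← nonempty_Icc, ← h2]; exact (fiber_nonempty_iff hu y).2 hyK
    have h2 := hsupp _ h1
    have e : (y : EuclideanSpace ℝ (Fin n)) + (-f (-y)) • u - x = (-(f y + f (-y))) • u := by
      rw [hx, graphMap]; module
    rw [e, map_smul, smul_eq_mul] at h2
    have h3 := upperFn_add_pos hu hK hy
    by_contra! hneg
    nlinarith
  -- If l u = 0, the support inequality over a neighbourhood of y makes l nonpositive, hence zero,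
  -- on u^⊥, contradicting Dρ ≠ 0.
  have hlu : 0 < l u := by
    refine lt_of_le_of_ne hlu0 fun hzero => hdρ ?_
    have hw : ∀ w : (ℝ ∙ u)ᗮ, l (w : EuclideanSpace ℝ (Fin n)) ≤ 0 := by
      intro w
      have hc : Continuous fun a : ℝ => y + a • w := by fun_prop
      have h1 : ∀ᶠ a in nhds (0 : ℝ), y + a • w ∈ proj u '' K := by
        apply hc.continuousAt.eventually_mem
        rw [zero_smul, add_zero]; exact mem_interior_iff_mem_nhds.1 hy
      obtain ⟨a, ha1, ha0⟩ := ((h1.filter_mono nhdsWithin_le_nhds).and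
        (self_mem_nhdsWithin (s := Ioi (0 : ℝ)))).exists
      have ha : (0 : ℝ) < a := ha0
      have h2 := hsupp _ (hG _ ha1)
      have e : graphMap u f (y + a • w) - x = a • (w : EuclideanSpace ℝ (Fin n)) +
          (f (y + a • w) - f y) • u := by
        rw [hx, graphMap, graphMap, Submodule.coe_add, Submodule.coe_smul]; module
      rw [e, map_add, map_smul, map_smul, ← hzero, smul_zero, add_zero, smul_eq_mul] at h2
      by_contra! hpos
      have := mul_pos ha hpos
      linarith
    refine ContinuousLinearMap.ext fun v => ?_
    have e := congrArg l (eq_proj_add_smul hu v)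
    rw [map_add, map_smul, ← hzero, smul_zero, add_zero] at e
    rw [e]
    refine le_antisymm (hw _) ?_
    have := hw (-proj u v)
    rw [Submodule.coe_neg, map_neg] at this
    simpa using this
  -- the candidate for the derivative
  set a : (ℝ ∙ u)ᗮ →L[ℝ] ℝ := -((l u)⁻¹ • (l.comp (ℝ ∙ u)ᗮ.subtypeL)) with ha
  have hadef : ∀ w : (ℝ ∙ u)ᗮ, a w = -((l u)⁻¹ * l (w : EuclideanSpace ℝ (Fin n))) :=
    fun w => rfl
  have hupper : ∀ z ∈ proj u '' K, f z ≤ f y + a (z - y) := by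
    intro z hz
    have h1 := hsupp _ (hG z hz)
    have e : graphMap u f z - x = ((z - y : (ℝ ∙ u)ᗮ) : EuclideanSpace ℝ (Fin n)) +
        (f z - f y) • u := by
      rw [hx, graphMap, graphMap, Submodule.coe_sub]; module
    rw [e, map_add, map_smul, smul_eq_mul] at h1
    rw [hadef]
    have h2 : f z - f y ≤ -((l u)⁻¹ * l ((z - y : (ℝ ∙ u)ᗮ) : EuclideanSpace ℝ (Fin n))) := by
      rw [← mul_le_mul_iff_left₀ hlu]
      have : -((l u)⁻¹ * l ((z - y : (ℝ ∙ u)ᗮ) : EuclideanSpace ℝ (Fin n))) * l u =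
        -l ((z - y : (ℝ ∙ u)ᗮ) : EuclideanSpace ℝ (Fin n)) := by field_simp
      rw [this]; linarith
    linarith
  have hder : HasFDerivAt f a y := by
    rw [hasFDerivAt_iff_isLittleO, Asymptotics.isLittleO_iff]
    intro ε hε
    set c := ‖graphLin u a‖ + ε with hcdef
    have hcpos : 0 < c := by positivity
    have hη : 0 < ε * l u / c := by positivity
    have hlo := (Asymptotics.isLittleO_iff.1 (hasFDerivAt_iff_isLittleO.1 hρd)) hη
    -- The tangent plane at x lowered by ε‖z - y‖. There ρ decreases to first order by ε‖z - y‖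
    -- l(u), which beats the error term, so γ z ∈ K and f z is bounded below. The upper bound is the
    -- support inequality.
    set γ : (ℝ ∙ u)ᗮ → EuclideanSpace ℝ (Fin n) := fun z =>
      x + (graphLin u a (z - y) - (ε * ‖z - y‖) • u) with hγ
    have hγc : Continuous γ := by fun_prop
    have hγy : γ y = x := by simp [hγ]
    have h1 : ∀ᶠ z in nhds y, γ z ∈ U := by
      apply hγc.continuousAt.eventually_mem
      rw [hγy]; exact hU.mem_nhds hxU
    have h2 : ∀ᶠ z in nhds y, ‖ρ (γ z) - ρ x - l (γ z - x)‖ ≤ ε * l u / c * ‖γ z - x‖ := by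
      have : Filter.Tendsto γ (nhds y) (nhds x) := by
        have := hγc.tendsto y; rwa [hγy] at this
      exact this.eventually hlo
    filter_upwards [h1, h2, mem_interior_iff_mem_nhds.1 hy] with z hzU hzρ hzK
    have hnn : 0 ≤ ‖z - y‖ := norm_nonneg _
    have e1 : γ z - x = graphLin u a (z - y) - (ε * ‖z - y‖) • u := by simp [hγ]
    have hnorm : ‖γ z - x‖ ≤ c * ‖z - y‖ := by
      rw [e1]
      refine (norm_sub_le _ _).trans ?_
      have := (graphLin u a).le_opNorm (z - y)
      rw [norm_smul, hu, mul_one, Real.norm_of_nonneg (by positivity), hcdef, add_mul]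
      linarith
    have hlin : l (γ z - x) = -(ε * ‖z - y‖ * l u) := by
      rw [e1, map_sub, graphLin_apply, map_add, map_smul, map_smul, smul_eq_mul, smul_eq_mul,
        hadef]
      field_simp
      ring
    have hρz : ρ (γ z) ≤ 0 := by
      rw [hlin, hρx, Real.norm_eq_abs] at hzρ
      have h3 := (abs_le.1 hzρ).2
      have h4 : ε * l u / c * ‖γ z - x‖ ≤ ε * l u / c * (c * ‖z - y‖) := by gcongr
      have h5 : ε * l u / c * (c * ‖z - y‖) = ε * ‖z - y‖ * l u := by field_simp
      linarith
    have hγK : γ z ∈ K := by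
      have : γ z ∈ K ∩ U := by rw [hKU]; exact ⟨hzU, hρz⟩
      exact this.1
    have e2 : γ z = (z : EuclideanSpace ℝ (Fin n)) + (f y + a (z - y) - ε * ‖z - y‖) • u := by
      simp only [hγ, hx, graphMap, graphLin_apply, Submodule.coe_sub]; module
    rw [e2] at hγK
    have hlow : f y + a (z - y) - ε * ‖z - y‖ ≤ f z := by
      have h6 : f y + a (z - y) - ε * ‖z - y‖ ∈ fiber u K z := hγK
      rw [fiber_eq_Icc hu hK hzK] at h6
      exact h6.2
    have hup := hupper z hzK
    rw [Real.norm_eq_abs, abs_le]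
    constructor <;> linarith
  refine ⟨hder.differentiableAt, ?_⟩
  rw [hder.fderiv]
  exact hupper

end LpProjection

/-! ### The shadow system as a family of graph bodies. -/

namespace LpProjection

variable {n : ℕ} {u : EuclideanSpace ℝ (Fin n)} {K : Set (EuclideanSpace ℝ (Fin n))}

/-- The upper boundary function of the body `K_t` of the linear reflection shadow system. -/
def shadowFn (u : EuclideanSpace ℝ (Fin n)) (K : Set (EuclideanSpace ℝ (Fin n))) (t : ℝ)
    (y : (ℝ ∙ u)ᗮ) : ℝ :=
  (1 + t) / 2 * upperFn u K y + (1 - t) / 2 * upperFn u K (-y)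

lemma fiber_reflectBody (y : (ℝ ∙ u)ᗮ) : fiber u (reflectBody u K) y = -fiber u K y := by
  have hr : ∀ s : ℝ, (ℝ ∙ u)ᗮ.reflection ((y : EuclideanSpace ℝ (Fin n)) + s • u) =
      (y : EuclideanSpace ℝ (Fin n)) + (-s) • u := fun s => by
    rw [map_add, map_smul, Submodule.reflection_mem_subspace_eq_self y.2,
      Submodule.reflection_orthogonalComplement_singleton_eq_neg, smul_neg, neg_smul]
  ext s
  change (y : EuclideanSpace ℝ (Fin n)) + s • u ∈ (ℝ ∙ u)ᗮ.reflection '' K ↔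
    (y : EuclideanSpace ℝ (Fin n)) + (-s) • u ∈ K
  constructor
  · rintro ⟨x, hx, he⟩
    have := congrArg (ℝ ∙ u)ᗮ.reflection he
    rw [Submodule.reflection_reflection, hr] at this
    rwa [← this]
  · intro hs
    exact ⟨_, hs, by rw [hr, neg_neg]⟩

lemma mem_shadowSystem_iff (hu : ‖u‖ = 1) (t : ℝ) (x : EuclideanSpace ℝ (Fin n)) :
    x ∈ shadowSystem u K t ↔ ∃ a ∈ fiber u K (proj u x), ∃ b ∈ fiber u K (proj u x),
      ⟪x, u⟫ = (1 + t) / 2 * a - (1 - t) / 2 * b := by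
  constructor
  · rintro ⟨y, hy, s, ⟨_, ⟨a, ha, rfl⟩, _, ⟨b, hb, rfl⟩, rfl⟩, hxy⟩
    have hy' : y ∈ (ℝ ∙ u)ᗮ := by
      rw [Submodule.mem_orthogonal_singleton_iff_inner_right, real_inner_comm]; exact hy
    have hp : proj u x = ⟨y, hy'⟩ := by rw [hxy]; exact proj_add_smul u ⟨y, hy'⟩ _
    have hb' := hb
    rw [show y = ((⟨y, hy'⟩ : (ℝ ∙ u)ᗮ) : EuclideanSpace ℝ (Fin n)) from rfl,
      fiber_reflectBody] at hb'
    rw [hp]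
    refine ⟨a, ha, -b, hb', ?_⟩
    rw [hxy, inner_add_left, hy, inner_smul_left, real_inner_self_eq_norm_sq, hu]
    simp only [smul_eq_mul, RCLike.conj_to_real]
    ring
  · rintro ⟨a, ha, b, hb, hx⟩
    refine ⟨proj u x, inner_coe_orthogonal u _, ⟪x, u⟫, ?_, eq_proj_add_smul hu x⟩
    rw [fiber_reflectBody]
    refine ⟨_, ⟨a, ha, rfl⟩, _, ⟨-b, by simpa using hb, rfl⟩, ?_⟩
    simp only [smul_eq_mul, hx]; ring

lemma mem_shadowSystem_iff_shadowFn (hu : ‖u‖ = 1) (hK : IsSymmetricConvexBody K) {t : ℝ}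
    (ht : t ∈ Icc (-1 : ℝ) 1) (x : EuclideanSpace ℝ (Fin n)) :
    x ∈ shadowSystem u K t ↔ proj u x ∈ proj u '' K ∧
      -shadowFn u K t (-proj u x) ≤ ⟪x, u⟫ ∧ ⟪x, u⟫ ≤ shadowFn u K t (proj u x) := by
  rw [mem_shadowSystem_iff hu]
  have h1 : 0 ≤ (1 + t) / 2 := by linarith [ht.1]
  have h2 : 0 ≤ (1 - t) / 2 := by linarith [ht.2]
  simp only [shadowFn, neg_neg]
  constructor
  · rintro ⟨a, ha, b, hb, hx⟩
    have hp := (fiber_nonempty_iff hu _).1 ⟨a, ha⟩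
    rw [fiber_eq_Icc hu hK hp] at ha hb
    refine ⟨hp, ?_, ?_⟩
    · have h3 := mul_le_mul_of_nonneg_left ha.1 h1
      have h4 := mul_le_mul_of_nonneg_left hb.2 h2
      rw [hx]; linarith
    · have h3 := mul_le_mul_of_nonneg_left ha.2 h1
      have h4 := mul_le_mul_of_nonneg_left hb.1 h2
      rw [hx]; linarith
  · rintro ⟨hp, hlo, hhi⟩
    have hI := fiber_eq_Icc hu hK hp
    have hle : -upperFn u K (-proj u x) ≤ upperFn u K (proj u x) := by
      rw [← nonempty_Icc, ← hI]; exact (fiber_nonempty_iff hu _).2 hp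
    rw [hI]
    set A := upperFn u K (-proj u x) with hA
    set B := upperFn u K (proj u x) with hB
    have hmem : ⟪x, u⟫ ∈ segment ℝ (-((1 + t) / 2 * A + (1 - t) / 2 * B))
        ((1 + t) / 2 * B + (1 - t) / 2 * A) := by
      rw [segment_eq_Icc (by nlinarith)]; exact ⟨hlo, hhi⟩
    obtain ⟨c, d, hc, hd, hcd, he⟩ := hmem
    obtain rfl : c = 1 - d := by linarith
    have h3 := mul_nonneg hd (sub_nonneg.2 hle)
    have h4 := mul_nonneg hc (sub_nonneg.2 hle)
    -- The two sections are traversed with the same parameter d, the second backwards because its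
    -- contribution is reflected.
    refine ⟨(1 - d) * -A + d * B, ⟨?_, ?_⟩, (1 - d) * B + d * -A, ⟨?_, ?_⟩, ?_⟩
    · linarith
    · linarith
    · linarith
    · linarith
    · rw [← he]; simp only [smul_eq_mul]; ring

lemma hasFDerivAt_shadowFn (hu : ‖u‖ = 1) (hK : IsSymmetricConvexBody K) (hC : IsC2Plus K) (t : ℝ)
    {y : (ℝ ∙ u)ᗮ} (hy : y ∈ interior (proj u '' K)) (hy' : -y ∈ interior (proj u '' K)) :
    HasFDerivAt (shadowFn u K t) (((1 + t) / 2) • fderiv ℝ (upperFn u K) y -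
      ((1 - t) / 2) • fderiv ℝ (upperFn u K) (-y)) y := by
  have h1 := (upperFn_differentiable hu hK hC hy).1.hasFDerivAt
  have h2 := (upperFn_differentiable hu hK hC hy').1.hasFDerivAt
  have h3 : HasFDerivAt (fun z : (ℝ ∙ u)ᗮ => upperFn u K (-z)) (-fderiv ℝ (upperFn u K) (-y)) y := by
    exact (h2.comp y (hasFDerivAt_id y).neg).congr_fderiv (by ext w; simp)
  have h4 := (h1.const_mul ((1 + t) / 2)).add (h3.const_mul ((1 - t) / 2))
  refine h4.congr_fderiv ?_
  rw [smul_neg]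
  exact (sub_eq_add_neg _ _).symm

/-- The bodies of the shadow system, as the image of the compact convex set of pairs of points of
`K` in the same section. -/
lemma shadowSystem_eq_image (hu : ‖u‖ = 1) (t : ℝ) : shadowSystem u K t =
    (fun k : EuclideanSpace ℝ (Fin n) × EuclideanSpace ℝ (Fin n) =>
      (proj u k.1 : EuclideanSpace ℝ (Fin n)) +
        ((1 + t) / 2 * ⟪k.1, u⟫ - (1 - t) / 2 * ⟪k.2, u⟫) • u) ''
      ((K ×ˢ K) ∩ {k | proj u k.1 = proj u k.2}) := by
  have hlift : ∀ (y : (ℝ ∙ u)ᗮ) (s : ℝ), ⟪(y : EuclideanSpace ℝ (Fin n)) + s • u, u⟫ = s := by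
    intro y s
    rw [inner_add_left, inner_coe_orthogonal, inner_smul_left, real_inner_self_eq_norm_sq, hu]
    simp
  have hfib : ∀ x ∈ K, ⟪x, u⟫ ∈ fiber u K (proj u x) := fun x hx => by
    change (proj u x : EuclideanSpace ℝ (Fin n)) + ⟪x, u⟫ • u ∈ K
    rwa [← eq_proj_add_smul hu x]
  ext x
  rw [mem_shadowSystem_iff hu]
  constructor
  · rintro ⟨a, ha, b, hb, hx⟩
    refine ⟨((proj u x : EuclideanSpace ℝ (Fin n)) + a • u,
      (proj u x : EuclideanSpace ℝ (Fin n)) + b • u), ⟨⟨ha, hb⟩, ?_⟩, ?_⟩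
    · simp only [mem_ofPred_eq, proj_add_smul]
    · simp only [proj_add_smul, hlift, ← hx]
      exact (eq_proj_add_smul hu x).symm
  · rintro ⟨⟨k₁, k₂⟩, ⟨⟨h1, h2⟩, h3⟩, rfl⟩
    simp only [mem_ofPred_eq] at h3
    simp only [proj_add_smul, hlift]
    exact ⟨_, hfib _ h1, _, by rw [h3]; exact hfib _ h2, rfl⟩

lemma isCompact_shadowSystem (hu : ‖u‖ = 1) (hK : IsCompact K) (t : ℝ) :
    IsCompact (shadowSystem u K t) := by
  rw [shadowSystem_eq_image hu]
  exact ((hK.prod hK).inter_right (isClosed_eq (by fun_prop) (by fun_prop))).image (by fun_prop)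

lemma convex_shadowSystem (hu : ‖u‖ = 1) (hK : Convex ℝ K) (t : ℝ) :
    Convex ℝ (shadowSystem u K t) := by
  rw [shadowSystem_eq_image hu]
  -- For fixed t the map is linear, and the pairs lying over a common point of u^⊥ form a convex
  -- set.
  refine Convex.is_linear_image ((hK.prod hK).inter ?_) ⟨fun k l => ?_, fun c k => ?_⟩
  · intro k hk l hl a b _ _ _
    simp only [mem_ofPred_eq] at hk hl
    simp only [mem_ofPred_eq, Prod.fst_add, Prod.snd_add, Prod.smul_fst, Prod.smul_snd, map_add,
      map_smul, hk, hl]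
  · simp only [Prod.fst_add, Prod.snd_add, map_add, inner_add_left, Submodule.coe_add]
    module
  · simp only [Prod.smul_fst, Prod.smul_snd, map_smul, inner_smul_left, Submodule.coe_smul,
      RCLike.conj_to_real]
    module

lemma shadowSystem_mem_nhds (hu : ‖u‖ = 1) (hK : IsSymmetricConvexBody K) (t : ℝ) :
    shadowSystem u K t ∈ nhds 0 := by
  obtain ⟨r, hr, hrK⟩ := Metric.nhds_basis_closedBall.mem_iff.1 hK.mem_nhds_zero
  refine Filter.mem_of_superset (Metric.closedBall_mem_nhds 0 hr) fun x hx => ?_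
  rw [mem_shadowSystem_iff hu]
  rw [mem_closedBall_zero_iff] at hx
  have hmem : ∀ s : ℝ, s ^ 2 = ⟪x, u⟫ ^ 2 → s ∈ fiber u K (proj u x) := by
    intro s hs
    apply hrK
    rw [mem_closedBall_zero_iff]
    refine le_trans (le_of_eq ?_) hx
    refine (pow_left_inj₀ (norm_nonneg _) (norm_nonneg _) two_ne_zero).1 ?_
    have h1 := norm_sq_add_smul hu (proj u x) s
    have h2 := norm_sq_add_smul hu (proj u x) ⟪x, u⟫
    rw [← eq_proj_add_smul hu x] at h2
    rw [h1, h2, hs]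
  exact ⟨⟪x, u⟫, hmem _ rfl, -⟪x, u⟫, hmem _ (by ring), by ring⟩

/-- The bodies of the linear reflection shadow system of a `C²₊` body are bounded by graphs. -/
theorem isGraphBody_shadowSystem (hu : ‖u‖ = 1) (hK : IsSymmetricConvexBody K) (hC : IsC2Plus K)
    {t : ℝ} (ht : t ∈ Icc (-1 : ℝ) 1) :
    IsGraphBody u (shadowSystem u K t) (proj u '' K) (shadowFn u K t) := by
  have h1 : 0 ≤ (1 + t) / 2 := by linarith [ht.1]
  have h2 : 0 ≤ (1 - t) / 2 := by linarith [ht.2]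
  have hnegD : -(proj u '' K) = proj u '' K := by
    ext z
    exact ⟨fun hz => by simpa using neg_mem_proj hK hz, fun hz => neg_mem_proj hK hz⟩
  have hnegi : ∀ y ∈ interior (proj u '' K), -y ∈ interior (proj u '' K) := by
    intro y hy
    have h3 : -y ∈ -interior (proj u '' K) := by simpa using hy
    have h4 : -interior (proj u '' K) = interior (-(proj u '' K)) :=
      (Homeomorph.neg (ℝ ∙ u)ᗮ).preimage_interior _
    rwa [h4, hnegD] at h3
  have hsum : ∀ y, shadowFn u K t y + shadowFn u K t (-y) =
      upperFn u K y + upperFn u K (-y) := fun y => by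
    simp only [shadowFn, neg_neg]; ring
  refine
    { isCompact_base := hK.isCompact.image (proj u).continuous
      convex_base := hK.convex.linear_image (proj u).toLinearMap
      base_mem_nhds := proj_mem_nhds hK
      neg_base := fun y hy => neg_mem_proj hK hy
      isCompact := isCompact_shadowSystem hu hK.isCompact t
      convex := convex_shadowSystem hu hK.convex t
      mem_nhds := shadowSystem_mem_nhds hu hK t
      mem_iff := mem_shadowSystem_iff_shadowFn hu hK ht
      differentiableAt := fun y hy =>
        (hasFDerivAt_shadowFn hu hK hC t hy (hnegi y hy)).differentiableAt
      le_tangent := fun y hy z hz => ?_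
      pos := fun y hy => by rw [hsum]; exact upperFn_add_pos hu hK hy
      eq_zero := fun y hy => by rw [hsum]; exact upperFn_add_eq_zero hu hK hC hy }
  rw [(hasFDerivAt_shadowFn hu hK hC t hy (hnegi y hy)).fderiv]
  have h3 := mul_le_mul_of_nonneg_left ((upperFn_differentiable hu hK hC hy).2 z hz) h1
  have h4 := mul_le_mul_of_nonneg_left
    ((upperFn_differentiable hu hK hC (hnegi y hy)).2 (-z) (neg_mem_proj hK hz)) h2
  have e : -z - -y = -(z - y) := by abel
  rw [e, map_neg] at h4
  simp only [shadowFn, sub_apply, smul_apply, smul_eq_mul]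
  linarith

lemma shadowSystem_one (hu : ‖u‖ = 1) (hK : IsSymmetricConvexBody K) :
    shadowSystem u K 1 = K := by
  ext x
  rw [mem_shadowSystem_iff_shadowFn hu hK (by simp), mem_iff_upperFn hu hK]
  simp [shadowFn]

lemma shadowSystem_zero (hu : ‖u‖ = 1) (hK : IsSymmetricConvexBody K) :
    shadowSystem u K 0 = steinerSymmetral u K := by
  have hlen : ∀ y ∈ proj u '' K, (volume (fiber u K (y : (ℝ ∙ u)ᗮ))).toReal =
      upperFn u K y + upperFn u K (-y) := by
    intro y hy
    have hI := fiber_eq_Icc hu hK hy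
    have hle : -upperFn u K (-y) ≤ upperFn u K y := by
      rw [← nonempty_Icc, ← hI]; exact (fiber_nonempty_iff hu _).2 hy
    rw [hI, Real.volume_Icc, ENNReal.toReal_ofReal (by linarith)]
    ring
  ext x
  rw [mem_shadowSystem_iff_shadowFn hu hK (by simp)]
  constructor
  · rintro ⟨hp, h1, h2⟩
    refine ⟨proj u x, inner_coe_orthogonal u _, (fiber_nonempty_iff hu _).2 hp, ⟪x, u⟫, ?_,
      eq_proj_add_smul hu x⟩
    simp only [shadowFn, neg_neg] at h1 h2
    rw [hlen _ hp, abs_le]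
    constructor <;> linarith
  · rintro ⟨y, hy, hn, s, hs, rfl⟩
    have hy' : y ∈ (ℝ ∙ u)ᗮ := by
      rw [Submodule.mem_orthogonal_singleton_iff_inner_right, real_inner_comm]; exact hy
    have hp : proj u (y + s • u) = ⟨y, hy'⟩ := proj_add_smul u ⟨y, hy'⟩ s
    have hD : (⟨y, hy'⟩ : (ℝ ∙ u)ᗮ) ∈ proj u '' K := (fiber_nonempty_iff hu _).1 hn
    have hi : ⟪y + s • u, u⟫ = s := by
      rw [inner_add_left, hy, inner_smul_left, real_inner_self_eq_norm_sq, hu]; simp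
    have hv := hlen _ hD
    simp only at hv
    rw [hv, abs_le] at hs
    rw [hp, hi]
    simp only [shadowFn, neg_neg]
    refine ⟨hD, ?_, ?_⟩ <;> linarith [hs.1, hs.2]

end LpProjection

/-! ### Convexity and symmetry of the energy. -/

namespace LpProjection

/-- If |x| ≠ |y|, strictness comes from r ↦ r^p on [0, ∞). If y = -x, it comes from cancellation in
the triangle inequality. -/
lemma strictConvexOn_abs_rpow {p : ℝ} (hp : 1 < p) :
    StrictConvexOn ℝ univ fun x : ℝ => |x| ^ p := by
  refine ⟨convex_univ, fun x _ y _ hxy a b ha hb hab => ?_⟩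
  simp only [smul_eq_mul]
  have hle : |a * x + b * y| ≤ a * |x| + b * |y| := by
    refine (abs_add_le _ _).trans_eq ?_
    rw [abs_mul, abs_mul, abs_of_pos ha, abs_of_pos hb]
  by_cases he : |x| = |y|
  · rcases abs_eq_abs.1 he with h | h
    · exact absurd h hxy
    have hy : 0 < |y| := abs_pos.2 fun h0 => hxy (by rw [h, h0, neg_zero])
    have h1 : |a * x + b * y| < |y| := by
      rw [h, show a * -y + b * y = (b - a) * y by ring, abs_mul]
      have : |b - a| < 1 := abs_lt.2 ⟨by linarith, by linarith⟩
      nlinarith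
    calc |a * x + b * y| ^ p < |y| ^ p := Real.rpow_lt_rpow (abs_nonneg _) h1 (by linarith)
      _ = a * |x| ^ p + b * |y| ^ p := by rw [he, ← add_mul, hab, one_mul]
  · calc |a * x + b * y| ^ p ≤ (a * |x| + b * |y|) ^ p :=
          Real.rpow_le_rpow (abs_nonneg _) hle (by linarith)
      _ < a * |x| ^ p + b * |y| ^ p :=
        (strictConvexOn_rpow hp).2 (abs_nonneg x) (abs_nonneg y) he ha hb hab

/-- The perspective of `|x| ^ p` is jointly convex. -/
lemma convexOn_abs_rpow_perspective {p : ℝ} (hp : 1 < p) :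
    ConvexOn ℝ (univ ×ˢ Ioi 0) fun z : ℝ × ℝ => |z.1| ^ p * z.2 ^ (1 - p) := by
  -- In the form b|x/b|^p the function is a perspective, and convexity follows from that of |·|^p
  -- with weights proportional to lb and mc.
  have hpersp : ∀ x b : ℝ, 0 < b → |x| ^ p * b ^ (1 - p) = b * |x / b| ^ p := by
    intro x b hb
    rw [abs_div, abs_of_pos hb, Real.div_rpow (abs_nonneg _) hb.le, Real.rpow_sub hb,
      Real.rpow_one]
    ring
  refine ⟨convex_univ.prod (convex_Ioi 0), ?_⟩
  rintro ⟨x, b⟩ ⟨-, hb⟩ ⟨y, c⟩ ⟨-, hc⟩ l m hl hm hlm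
  simp only [mem_Ioi] at hb hc
  have hB : 0 < l * b + m * c := by
    have := (convex_Ioi (0 : ℝ)) (mem_Ioi.2 hb) (mem_Ioi.2 hc) hl hm hlm
    simpa using this
  simp only [Prod.smul_mk, Prod.mk_add_mk, smul_eq_mul]
  rw [hpersp _ _ hb, hpersp _ _ hc, hpersp _ _ hB]
  have h1 := (strictConvexOn_abs_rpow hp).convexOn.2 (mem_univ (x / b)) (mem_univ (y / c))
    (show 0 ≤ l * b / (l * b + m * c) by positivity)
    (show 0 ≤ m * c / (l * b + m * c) by positivity) (by field_simp)
  simp only [smul_eq_mul] at h1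
  have e : l * b / (l * b + m * c) * (x / b) + m * c / (l * b + m * c) * (y / c) =
      (l * x + m * y) / (l * b + m * c) := by field_simp
  rw [e] at h1
  calc _ ≤ (l * b + m * c) * (l * b / (l * b + m * c) * |x / b| ^ p +
        m * c / (l * b + m * c) * |y / c| ^ p) := mul_le_mul_of_nonneg_left h1 hB.le
    _ = _ := by field_simp

/-- A nonnegative, continuous, positive definite, `p`-homogeneous function has bounded sublevel
sets. -/
lemma isBounded_sublevel_of_homogeneous {W : Type*} [NormedAddCommGroup W] [NormedSpace ℝ W]
    [FiniteDimensional ℝ W] {p : ℝ} (hp : 0 < p) {Φ : W → ℝ} (hΦ : Continuous Φ)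
    (hpos : ∀ w, w ≠ 0 → 0 < Φ w)
    (hom : ∀ w, ∀ c : ℝ, 0 ≤ c → Φ (c • w) = c ^ p * Φ w) :
    Bornology.IsBounded {w | Φ w ≤ 1} := by
  rcases subsingleton_or_nontrivial W with hW | hW
  · exact (Set.toFinite _).isBounded
  have : ProperSpace W := FiniteDimensional.proper ℝ W
  obtain ⟨w₀, hw₀, hmin⟩ := (isCompact_sphere (0 : W) 1).exists_isMinOn
    (NormedSpace.sphere_nonempty.2 zero_le_one) hΦ.continuousOn
  have hm : 0 < Φ w₀ := hpos _ fun h0 => by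
    rw [h0, mem_sphere_zero_iff_norm, norm_zero] at hw₀; exact zero_ne_one hw₀
  refine (Metric.isBounded_iff_subset_closedBall (0 : W)).2 ⟨(1 / Φ w₀) ^ (1 / p), ?_⟩
  intro w hw
  rw [mem_ofPred_eq] at hw
  rw [mem_closedBall_zero_iff]
  by_cases h0 : w = 0
  · rw [h0, norm_zero]; positivity
  have hn : 0 < ‖w‖ := norm_pos_iff.2 h0
  have h1 : Φ w₀ ≤ Φ (‖w‖⁻¹ • w) := hmin (by
    rw [mem_sphere_zero_iff_norm, norm_smul, norm_inv, norm_norm, inv_mul_cancel₀ hn.ne'])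
  have h2 : Φ w = ‖w‖ ^ p * Φ (‖w‖⁻¹ • w) := by
    rw [← hom _ _ hn.le, smul_smul, mul_inv_cancel₀ hn.ne', one_smul]
  have h3 : ‖w‖ ^ p ≤ 1 / Φ w₀ := by
    rw [le_div_iff₀ hm]
    exact (mul_le_mul_of_nonneg_left h1 (by positivity)).trans (h2 ▸ hw)
  calc ‖w‖ = (‖w‖ ^ p) ^ (1 / p) := by
        rw [← Real.rpow_mul hn.le, mul_one_div_cancel hp.ne', Real.rpow_one]
    _ ≤ _ := Real.rpow_le_rpow (by positivity) h3 (by positivity)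

variable {E : Type*} [NormedAddCommGroup E] [NormedSpace ℝ E] [MeasurableSpace E]

/-- The function `(y, s) ↦ C ∫_U |s - a_t(z) y|^p β_t(z)^{1-p} dz`. -/
def profileEnergy (μ : Measure E) (C p : ℝ) (U : Set E) (a : ℝ → E → E →L[ℝ] ℝ) (β : ℝ → E → ℝ)
    (t : ℝ) (y : E) (s : ℝ) : ℝ :=
  C * ∫ z in U, |s - a t z y| ^ p * β t z ^ (1 - p) ∂μ

/-- The conditions on the data of `profileEnergy` under which it is a reflection family. -/
structure IsReflectionProfile (μ : Measure E) (p : ℝ) (U : Set E) (a : ℝ → E → E →L[ℝ] ℝ)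
    (β : ℝ → E → ℝ) : Prop where
  isOpen : IsOpen U
  nonempty : U.Nonempty
  neg_mem : ∀ z ∈ U, -z ∈ U
  pos : ∀ t ∈ Icc (-1 : ℝ) 1, ∀ z ∈ U, 0 < β t z
  affine_left : ∀ z, ∀ t₁ t₂ l m : ℝ, l + m = 1 →
    a (l * t₁ + m * t₂) z = l • a t₁ z + m • a t₂ z
  affine_right : ∀ z, ∀ t₁ t₂ l m : ℝ, l + m = 1 →
    β (l * t₁ + m * t₂) z = l * β t₁ z + m * β t₂ z
  neg_left : ∀ t z, a (-t) z = -a t (-z)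
  neg_right : ∀ t z, β (-t) z = β t (-z)
  integrable : ∀ t ∈ Icc (-1 : ℝ) 1, ∀ y s,
    IntegrableOn (fun z => |s - a t z y| ^ p * β t z ^ (1 - p)) U μ
  definite : ∀ t ∈ Icc (-1 : ℝ) 1, ∀ y s, (∀ᵐ z ∂μ.restrict U, s = a t z y) → y = 0 ∧ s = 0

namespace IsReflectionProfile

variable {μ : Measure E} {C p : ℝ} {U : Set E} {a : ℝ → E → E →L[ℝ] ℝ} {β : ℝ → E → ℝ}

lemma integrand_nonneg (h : IsReflectionProfile μ p U a β) {t : ℝ} (ht : t ∈ Icc (-1 : ℝ) 1)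
    (y : E) (s : ℝ) {z : E} (hz : z ∈ U) : 0 ≤ |s - a t z y| ^ p * β t z ^ (1 - p) :=
  mul_nonneg (Real.rpow_nonneg (abs_nonneg _) _) (Real.rpow_nonneg (h.pos t ht z hz).le _)

/-- Joint convexity of the energy along simultaneous affine combinations. -/
lemma energy_le [BorelSpace E] (h : IsReflectionProfile μ p U a β) (hC : 0 < C) (hp : 1 < p)
    {t₁ t₂ : ℝ} (ht₁ : t₁ ∈ Icc (-1 : ℝ) 1) (ht₂ : t₂ ∈ Icc (-1 : ℝ) 1) (y₁ y₂ y : E) (s₁ s₂ : ℝ)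
    {l m : ℝ} (hl : 0 ≤ l) (hm : 0 ≤ m) (hlm : l + m = 1)
    (ha : ∀ z, a (l * t₁ + m * t₂) z y = l * a t₁ z y₁ + m * a t₂ z y₂) :
    profileEnergy μ C p U a β (l * t₁ + m * t₂) y (l * s₁ + m * s₂) ≤
      l * profileEnergy μ C p U a β t₁ y₁ s₁ + m * profileEnergy μ C p U a β t₂ y₂ s₂ := by
  have ht : l * t₁ + m * t₂ ∈ Icc (-1 : ℝ) 1 := convex_Icc _ _ ht₁ ht₂ hl hm hlm
  have key : ∫ z in U, |(l * s₁ + m * s₂) - a (l * t₁ + m * t₂) z y| ^ p *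
      β (l * t₁ + m * t₂) z ^ (1 - p) ∂μ ≤
      ∫ z in U, (l * (|s₁ - a t₁ z y₁| ^ p * β t₁ z ^ (1 - p)) +
        m * (|s₂ - a t₂ z y₂| ^ p * β t₂ z ^ (1 - p))) ∂μ := by
    refine setIntegral_mono_on (h.integrable _ ht _ _)
      (((h.integrable _ ht₁ _ _).const_mul l).add ((h.integrable _ ht₂ _ _).const_mul m))
      h.isOpen.measurableSet fun z hz => ?_
    -- Hypothesis `ha` makes both arguments of the perspective combine affinely. It covers moving y
    -- at fixed t and moving t at fixed y; the pairing of a_t with y is not affine when both move.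
    have := (convexOn_abs_rpow_perspective hp).2
      (show (s₁ - a t₁ z y₁, β t₁ z) ∈ univ ×ˢ Ioi 0 from ⟨mem_univ _, h.pos _ ht₁ z hz⟩)
      (show (s₂ - a t₂ z y₂, β t₂ z) ∈ univ ×ˢ Ioi 0 from ⟨mem_univ _, h.pos _ ht₂ z hz⟩)
      hl hm hlm
    simp only [Prod.smul_mk, Prod.mk_add_mk, smul_eq_mul] at this
    rw [ha, h.affine_right z _ _ _ _ hlm]
    convert this using 3
    ring_nf
  rw [integral_add ((h.integrable _ ht₁ _ _).const_mul l) ((h.integrable _ ht₂ _ _).const_mul m),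
    integral_const_mul, integral_const_mul] at key
  have := mul_le_mul_of_nonneg_left key hC.le
  simp only [profileEnergy]
  linarith

lemma convexOn_energy [BorelSpace E] (h : IsReflectionProfile μ p U a β) (hC : 0 < C) (hp : 1 < p)
    {t : ℝ} (ht : t ∈ Icc (-1 : ℝ) 1) :
    ConvexOn ℝ univ fun z : E × ℝ => profileEnergy μ C p U a β t z.1 z.2 := by
  refine ⟨convex_univ, fun z _ w _ l m hl hm hlm => ?_⟩
  have e : l * t + m * t = t := by rw [← add_mul, hlm, one_mul]
  have := h.energy_le hC hp ht ht z.1 w.1 (l • z.1 + m • w.1) z.2 w.2 hl hm hlm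
    (fun x => by rw [e, map_add, map_smul, map_smul, smul_eq_mul, smul_eq_mul])
  rw [e] at this
  exact this

lemma energy_nonneg [BorelSpace E] (h : IsReflectionProfile μ p U a β) (hC : 0 < C)
    {t : ℝ} (ht : t ∈ Icc (-1 : ℝ) 1) (y : E) (s : ℝ) : 0 ≤ profileEnergy μ C p U a β t y s :=
  mul_nonneg hC.le (setIntegral_nonneg h.isOpen.measurableSet fun _ hz =>
    h.integrand_nonneg ht y s hz)

/-- A zero energy forces s = a_t(z)y for almost every z, which `definite` excludes. Positivity off
the origin gives bounded sublevel sets. -/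
lemma energy_pos [BorelSpace E] (h : IsReflectionProfile μ p U a β) (hC : 0 < C) (hp : 1 < p)
    {t : ℝ} (ht : t ∈ Icc (-1 : ℝ) 1) {y : E} {s : ℝ} (hys : (y, s) ≠ 0) :
    0 < profileEnergy μ C p U a β t y s := by
  refine lt_of_le_of_ne (h.energy_nonneg hC ht y s) fun h0 => hys ?_
  have h1 : ∫ z in U, |s - a t z y| ^ p * β t z ^ (1 - p) ∂μ = 0 :=
    (mul_eq_zero.1 h0.symm).resolve_left hC.ne'
  have hU := ae_restrict_mem (μ := μ) h.isOpen.measurableSet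
  rw [integral_eq_zero_iff_of_nonneg_ae (hU.mono fun z hz => h.integrand_nonneg ht y s hz)
    (h.integrable t ht y s)] at h1
  have h2 := h.definite t ht y s (by
    filter_upwards [h1, hU] with z hz hzU
    rcases mul_eq_zero.1 hz with h3 | h3
    · have h4 := (Real.rpow_eq_zero (abs_nonneg _) (by linarith)).1 h3
      linarith [abs_eq_zero.1 h4]
    · exact absurd h3 (Real.rpow_pos_of_pos (h.pos t ht z hzU) _).ne')
  rw [h2.1, h2.2]; rfl

lemma energy_homog (t : ℝ) (y : E) (s : ℝ) {c : ℝ} (hc : 0 ≤ c) :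
    profileEnergy μ C p U a β t (c • y) (c * s) = c ^ p * profileEnergy μ C p U a β t y s := by
  have : ∀ z, |c * s - a t z (c • y)| ^ p * β t z ^ (1 - p) =
      c ^ p * (|s - a t z y| ^ p * β t z ^ (1 - p)) := fun z => by
    rw [map_smul, smul_eq_mul, ← mul_sub, abs_mul, abs_of_nonneg hc,
      Real.mul_rpow hc (abs_nonneg _), mul_assoc]
  simp only [profileEnergy, this, integral_const_mul]
  ring

lemma energy_neg_time [BorelSpace E] [μ.IsNegInvariant] (h : IsReflectionProfile μ p U a β)
    (t : ℝ) (y : E) (s : ℝ) :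
    profileEnergy μ C p U a β (-t) y s = profileEnergy μ C p U a β t y (-s) := by
  have hpre : Neg.neg ⁻¹' U = U := by
    ext z
    exact ⟨fun hz => by simpa using h.neg_mem _ hz, fun hz => h.neg_mem z hz⟩
  have := (Measure.measurePreserving_neg μ).setIntegral_preimage_emb
    (MeasurableEquiv.neg E).measurableEmbedding
    (fun z => |-s - a t z y| ^ p * β t z ^ (1 - p)) U
  rw [hpre] at this
  simp only [profileEnergy, ← this]
  congr 1
  refine integral_congr_ae (Filter.Eventually.of_forall fun z => ?_)
  simp only [h.neg_left, h.neg_right, neg_apply]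
  congr 2
  rw [← abs_neg]
  congr 1; ring

/-- The integrand is strictly convex in s at every z ∈ U, and U has positive measure. -/
lemma strictConvexOn_energy [BorelSpace E] [μ.IsOpenPosMeasure] (h : IsReflectionProfile μ p U a β)
    (hC : 0 < C) (hp : 1 < p) {t : ℝ} (ht : t ∈ Icc (-1 : ℝ) 1) (y : E) :
    StrictConvexOn ℝ univ (profileEnergy μ C p U a β t y) := by
  refine ⟨convex_univ, fun s₁ _ s₂ _ hs l m hl hm hlm => ?_⟩
  simp only [smul_eq_mul, profileEnergy]
  set g : ℝ → E → ℝ := fun s z => |s - a t z y| ^ p * β t z ^ (1 - p) with hg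
  have hI : ∀ s, IntegrableOn (g s) U μ := h.integrable t ht y
  have hlt : ∀ z ∈ U, g (l * s₁ + m * s₂) z < l * g s₁ z + m * g s₂ z := fun z hz => by
    have h1 := (strictConvexOn_abs_rpow hp).2 (mem_univ (s₁ - a t z y)) (mem_univ (s₂ - a t z y))
      (fun he => hs (by linarith)) hl hm hlm
    simp only [smul_eq_mul] at h1
    have e : l * (s₁ - a t z y) + m * (s₂ - a t z y) = l * s₁ + m * s₂ - a t z y := by
      linear_combination (-a t z y) * hlm
    rw [e] at h1
    have h2 := mul_lt_mul_of_pos_right h1 (Real.rpow_pos_of_pos (h.pos t ht z hz) (1 - p))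
    simp only [hg]
    linarith
  have hd : IntegrableOn (fun z => (l * g s₁ z + m * g s₂ z) - g (l * s₁ + m * s₂) z) U μ :=
    (((hI s₁).const_mul l).add ((hI s₂).const_mul m)).sub (hI _)
  have hpos : 0 < ∫ z in U, ((l * g s₁ z + m * g s₂ z) - g (l * s₁ + m * s₂) z) ∂μ := by
    rw [setIntegral_pos_iff_support_of_nonneg_ae
      ((ae_restrict_mem h.isOpen.measurableSet).mono fun z hz => (sub_pos.2 (hlt z hz)).le) hd]
    rw [inter_eq_right.2 fun z hz => Function.mem_support.2 (sub_pos.2 (hlt z hz)).ne']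
    exact h.isOpen.measure_pos μ h.nonempty
  have hsub := integral_sub (((hI s₁).const_mul l).add ((hI s₂).const_mul m))
    (hI (l * s₁ + m * s₂))
  simp only [Pi.add_apply] at hsub
  rw [hsub, integral_add ((hI s₁).const_mul l) ((hI s₂).const_mul m), integral_const_mul,
    integral_const_mul] at hpos
  have := mul_pos hC hpos
  linarith

theorem isReflectionFamily [BorelSpace E] [FiniteDimensional ℝ E] [μ.IsAddHaarMeasure]
    (h : IsReflectionProfile μ p U a β) (hC : 0 < C) (hp : 1 < p) :
    IsReflectionFamily p (profileEnergy μ C p U a β) := by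
  have hcont : ∀ t ∈ Icc (-1 : ℝ) 1,
      Continuous fun z : E × ℝ => profileEnergy μ C p U a β t z.1 z.2 := fun t ht =>
    continuousOn_univ.1 ((h.convexOn_energy hC hp ht).continuousOn isOpen_univ)
  refine
    { continuous := hcont
      convex_space := fun t ht => h.convexOn_energy hC hp ht
      convex_time := fun y => ⟨(convex_Icc _ _).prod convex_univ, ?_⟩
      strict := fun t ht y => h.strictConvexOn_energy hC hp ht y
      neg_time := h.energy_neg_time
      homog := fun t y s c hc => energy_homog t y s hc
      bounded := fun t ht => isBounded_sublevel_of_homogeneous (by linarith) (hcont t ht)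
        (fun w hw => h.energy_pos hC hp ht hw)
        (fun w c hc => energy_homog t w.1 w.2 hc) }
  rintro ⟨t₁, s₁⟩ ⟨ht₁, -⟩ ⟨t₂, s₂⟩ ⟨ht₂, -⟩ l m hl hm hlm
  exact h.energy_le hC hp ht₁ ht₂ y y y s₁ s₂ hl hm hlm fun z => by
    rw [h.affine_left z _ _ _ _ hlm]; simp

end IsReflectionProfile

end LpProjection

/-! ### Definiteness, product coordinates and the energy of the shadow system. -/

namespace LpProjection

variable {n : ℕ} {u : EuclideanSpace ℝ (Fin n)}

namespace IsGraphBody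

variable {L : Set (EuclideanSpace ℝ (Fin n))} {D : Set (ℝ ∙ u)ᗮ} {F : (ℝ ∙ u)ᗮ → ℝ}
  (h : IsGraphBody u L D F)
include h

lemma zero_mem_interior : (0 : (ℝ ∙ u)ᗮ) ∈ interior D := mem_interior_iff_mem_nhds.2 h.base_mem_nhds

/-- The tangent at y passes above the graph at the centre, where F 0 > 0. -/
lemma sub_fderiv_pos {y : (ℝ ∙ u)ᗮ} (hy : y ∈ interior D) : 0 < F y - fderiv ℝ F y y := by
  have h1 := h.pos 0 h.zero_mem_interior
  have h2 := h.le_tangent y hy 0 (interior_subset h.zero_mem_interior)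
  rw [neg_zero] at h1
  rw [zero_sub, map_neg] at h2
  linarith

/-- If the derivative of `F` in direction `y` is almost everywhere equal to `s`, then `F` grows at
most linearly with slope `s` between interior points differing by a multiple of `y`. -/
lemma le_of_ae_fderiv_eq {y : (ℝ ∙ u)ᗮ} {s : ℝ}
    (hae : ∀ᵐ z ∂volume.restrict (interior D), s = fderiv ℝ F z y) {z : (ℝ ∙ u)ᗮ} {τ : ℝ}
    (hz : z ∈ interior D) (hzτ : z + τ • y ∈ interior D) : F (z + τ • y) ≤ F z + τ * s := by
  rw [ae_restrict_iff' isOpen_interior.measurableSet] at hae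
  -- The tangent inequality gives the bound at every base point where the derivative is as
  -- prescribed; these are dense, and F is continuous on the interior.
  have hdense := Measure.dense_of_ae hae
  set W : Set (ℝ ∙ u)ᗮ := interior D ∩ (fun w => w + τ • y) ⁻¹' interior D with hW
  have hWo : IsOpen W := isOpen_interior.inter (isOpen_interior.preimage (by fun_prop))
  have hcl := hdense.open_subset_closure_inter hWo (show z ∈ W from ⟨hz, hzτ⟩)
  have hc1 : ContinuousAt (fun w => F (w + τ • y)) z :=
    ContinuousAt.comp (f := fun w => w + τ • y) (g := F)
      (h.differentiableAt _ hzτ).continuousAt (by fun_prop)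
  have hc2 : ContinuousAt (fun w => F w + τ * s) z :=
    (h.differentiableAt _ hz).continuousAt.add continuousAt_const
  refine ContinuousWithinAt.closure_le hcl hc1.continuousWithinAt hc2.continuousWithinAt ?_
  rintro w ⟨⟨hw, hwτ⟩, hws⟩
  have h1 := h.le_tangent w hw _ (interior_subset hwτ)
  rw [add_sub_cancel_left, map_smul, smul_eq_mul, ← hws hw] at h1
  exact h1

/-- F is affine on the open part of the ray. The endpoint may lie on the boundary of D, where F need
not be continuous, so the limit is taken for points of the closed set L. -/
lemma add_mul_le_of_ae_fderiv_eq (hu : ‖u‖ = 1) {y : (ℝ ∙ u)ᗮ} {s : ℝ}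
    (hae : ∀ᵐ z ∂volume.restrict (interior D), s = fderiv ℝ F z y) {τ : ℝ}
    (hτ : ∀ c ∈ Ico (0 : ℝ) 1, (c * τ) • y ∈ interior D) :
    F 0 + τ * s ≤ F (τ • y) := by
  have h0 := h.zero_mem_interior
  have hmem : ∀ c ∈ Ico (0 : ℝ) 1,
      (((c * τ) • y : (ℝ ∙ u)ᗮ) : EuclideanSpace ℝ (Fin n)) + (F 0 + c * τ * s) • u ∈ L := by
    intro c hc
    have hi := hτ c hc
    have h1 := h.le_of_ae_fderiv_eq hae (z := 0) (τ := c * τ) h0 (by rwa [zero_add])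
    have h2 := h.le_of_ae_fderiv_eq hae (z := (c * τ) • y) (τ := -(c * τ)) hi
      (by rwa [neg_smul, add_neg_cancel])
    rw [neg_smul, add_neg_cancel] at h2
    rw [zero_add] at h1
    have e : F 0 + c * τ * s = F ((c * τ) • y) := by linarith
    rw [e]
    exact h.graphMap_mem hu (interior_subset hi)
  have hlim : (((1 * τ) • y : (ℝ ∙ u)ᗮ) : EuclideanSpace ℝ (Fin n)) + (F 0 + 1 * τ * s) • u ∈ L := by
    have hcont : Continuous fun c : ℝ =>
        (((c * τ) • y : (ℝ ∙ u)ᗮ) : EuclideanSpace ℝ (Fin n)) + (F 0 + c * τ * s) • u := by fun_prop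
    have hcl : (1 : ℝ) ∈ closure (Ico (0 : ℝ) 1) := by
      rw [closure_Ico zero_ne_one]; simp
    have := hcont.continuousWithinAt.mem_closure hcl hmem
    rwa [h.isCompact.isClosed.closure_eq] at this
  rw [one_mul, h.mem_iff, proj_add_smul, inner_add_left, inner_coe_orthogonal, inner_smul_left,
    real_inner_self_eq_norm_sq, hu] at hlim
  simpa using hlim.2.2

/-- If y ≠ 0, F is affine along the chord of D through 0 in direction y. Comparing its opposite ends
gives F(τy) + F(-τy) ≥ 2F(0) > 0, although the sum vanishes on the boundary of D. -/
lemma eq_zero_of_ae_fderiv_eq (hu : ‖u‖ = 1) {y : (ℝ ∙ u)ᗮ} {s : ℝ}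
    (hae : ∀ᵐ z ∂volume.restrict (interior D), s = fderiv ℝ F z y) : y = 0 ∧ s = 0 := by
  have h0 := h.zero_mem_interior
  have hy : y = 0 := by
    by_contra hy
    have hg : 0 < gauge D y := (gauge_pos (absorbent_nhds_zero h.base_mem_nhds)
      ((NormedSpace.isVonNBounded_iff ℝ).2 h.isCompact_base.isBounded)).2 hy
    set τ := (gauge D y)⁻¹ with hτ
    have hτ0 : 0 < τ := inv_pos.2 hg
    have hfr : τ • y ∈ frontier D := by
      rw [← gauge_eq_one_iff_mem_frontier h.convex_base h.base_mem_nhds,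
        gauge_smul_of_nonneg hτ0.le, smul_eq_mul, hτ, inv_mul_cancel₀ hg.ne']
    have hin : ∀ c ∈ Ico (0 : ℝ) 1, (c * τ) • y ∈ interior D := by
      intro c hc
      rw [← gauge_lt_one_iff_mem_interior h.convex_base h.base_mem_nhds,
        gauge_smul_of_nonneg (mul_nonneg hc.1 hτ0.le), smul_eq_mul, mul_assoc, hτ,
        inv_mul_cancel₀ hg.ne', mul_one]
      exact hc.2
    have h1 := h.add_mul_le_of_ae_fderiv_eq hu hae hin
    have h2 := h.add_mul_le_of_ae_fderiv_eq hu hae (τ := -τ)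
      (fun c hc => by rw [mul_neg, neg_smul]; exact h.neg_interior (hin c hc))
    have h3 := h.eq_zero _ hfr
    have h4 := h.pos 0 h0
    rw [neg_smul] at h2
    rw [neg_zero] at h4
    linarith
  subst hy
  refine ⟨rfl, ?_⟩
  have h1 := h.le_of_ae_fderiv_eq hae (z := 0) (τ := 1) h0 (by simpa using h0)
  have h2 := h.le_of_ae_fderiv_eq hae (z := 0) (τ := -1) h0 (by simpa using h0)
  rw [smul_zero, add_zero] at h1 h2
  linarith

end IsGraphBody

/-- The map `(y, s) ↦ y + s u` from `u^⊥ × ℝ` preserves the volume. -/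
lemma measurePreserving_add_smul (hu : ‖u‖ = 1) :
    MeasurePreserving (fun z : (ℝ ∙ u)ᗮ × ℝ => (z.1 : EuclideanSpace ℝ (Fin n)) + z.2 • u)
      (volume.prod volume) volume := by
  let e : WithLp 2 ((ℝ ∙ u)ᗮ × ℝ) ≃ₗᵢ[ℝ] EuclideanSpace ℝ (Fin n) :=
    { toFun := fun z => (z.fst : EuclideanSpace ℝ (Fin n)) + z.snd • u
      map_add' := fun z w => by
        simp only [WithLp.add_fst, WithLp.add_snd, Submodule.coe_add]; module
      map_smul' := fun c z => by
        simp only [WithLp.smul_fst, WithLp.smul_snd, Submodule.coe_smul, RingHom.id_apply,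
          smul_eq_mul]
        module
      invFun := fun x => WithLp.toLp 2 (proj u x, ⟪x, u⟫)
      left_inv := fun z => by
        refine (WithLp.ofLp_injective 2) (Prod.ext ?_ ?_)
        · exact proj_add_smul u z.fst z.snd
        · change ⟪(z.fst : EuclideanSpace ℝ (Fin n)) + z.snd • u, u⟫ = z.snd
          rw [inner_add_left, inner_coe_orthogonal, inner_smul_left, real_inner_self_eq_norm_sq, hu]
          simp
      right_inv := fun x => (eq_proj_add_smul hu x).symm
      norm_map' := fun z => by
        refine (pow_left_inj₀ (norm_nonneg _) (norm_nonneg _) two_ne_zero).1 ?_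
        rw [WithLp.prod_norm_sq_eq_of_L2, Real.norm_eq_abs, sq_abs]
        exact norm_sq_add_smul hu z.fst z.snd }
  exact e.measurePreserving.comp (WithLp.volume_preserving_toLp (ℝ ∙ u)ᗮ ℝ)

variable {K : Set (EuclideanSpace ℝ (Fin n))}

/-- The derivative of the upper boundary function of `K_t` at interior points of the
projection. -/
def shadowGrad (u : EuclideanSpace ℝ (Fin n)) (K : Set (EuclideanSpace ℝ (Fin n))) (t : ℝ)
    (z : (ℝ ∙ u)ᗮ) : (ℝ ∙ u)ᗮ →L[ℝ] ℝ :=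
  ((1 + t) / 2) • fderiv ℝ (upperFn u K) z - ((1 - t) / 2) • fderiv ℝ (upperFn u K) (-z)

/-- The support function of `K_t` at the normal vector `(-∇F, 1)` of the graph bounding `K_t`. -/
def shadowSupport (u : EuclideanSpace ℝ (Fin n)) (K : Set (EuclideanSpace ℝ (Fin n))) (t : ℝ)
    (z : (ℝ ∙ u)ᗮ) : ℝ :=
  shadowFn u K t z - shadowGrad u K t z z

lemma fderiv_shadowFn (hu : ‖u‖ = 1) (hK : IsSymmetricConvexBody K) (hC : IsC2Plus K) (t : ℝ)
    {z : (ℝ ∙ u)ᗮ} (hz : z ∈ interior (proj u '' K)) :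
    fderiv ℝ (shadowFn u K t) z = shadowGrad u K t z :=
  (hasFDerivAt_shadowFn hu hK hC t hz ((isGraphBody_shadowSystem hu hK hC
    (show (0 : ℝ) ∈ Icc (-1 : ℝ) 1 by simp)).neg_interior hz)).fderiv

/-- The integral defining `Π_p K_t` in terms of the profile of `K_t` over `u^⊥`. -/
lemma integral_surfaceAreaMeasure_shadowSystem (hn : 1 ≤ n) (hu : ‖u‖ = 1) {p : ℝ} (hp : 1 < p)
    (hK : IsSymmetricConvexBody K) (hC : IsC2Plus K) {t : ℝ} (ht : t ∈ Icc (-1 : ℝ) 1)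
    (v : EuclideanSpace ℝ (Fin n)) :
    IntegrableOn (fun z => |⟪v, u⟫ - shadowGrad u K t z (proj u v)| ^ p *
        shadowSupport u K t z ^ (1 - p)) (interior (proj u '' K)) ∧
    ∫ θ, |⟪v, θ⟫| ^ p * supportFn (shadowSystem u K t) θ ^ (1 - p)
        ∂(surfaceAreaMeasure (shadowSystem u K t)) =
      2 * ∫ z in interior (proj u '' K), |⟪v, u⟫ - shadowGrad u K t z (proj u v)| ^ p *
        shadowSupport u K t z ^ (1 - p) := by
  obtain ⟨h1, h2⟩ := (isGraphBody_shadowSystem hu hK hC ht).integral_surfaceAreaMeasure hn hu hp v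
  have hcongr : EqOn (fun z => |⟪v, u⟫ - fderiv ℝ (shadowFn u K t) z (proj u v)| ^ p *
      (shadowFn u K t z - fderiv ℝ (shadowFn u K t) z z) ^ (1 - p))
      (fun z => |⟪v, u⟫ - shadowGrad u K t z (proj u v)| ^ p *
        shadowSupport u K t z ^ (1 - p)) (interior (proj u '' K)) := fun z hz => by
    simp only [fderiv_shadowFn hu hK hC t hz, shadowSupport]
  exact ⟨h1.congr_fun hcongr isOpen_interior.measurableSet,
    by rw [h2, setIntegral_congr_fun isOpen_interior.measurableSet hcongr]⟩

/-- `shadowGrad` and `shadowSupport` are explicit formulas rather than derivatives of `shadowFn`, so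
the affine and symmetry identities hold at every z, including points where `upperFn` is not
differentiable. -/
lemma isReflectionProfile_shadowSystem (hn : 1 ≤ n) (hu : ‖u‖ = 1) {p : ℝ} (hp : 1 < p)
    (hK : IsSymmetricConvexBody K) (hC : IsC2Plus K) :
    IsReflectionProfile volume p (interior (proj u '' K)) (shadowGrad u K)
      (shadowSupport u K) := by
  have hG := fun {t : ℝ} (ht : t ∈ Icc (-1 : ℝ) 1) => isGraphBody_shadowSystem hu hK hC ht
  have h0 := hG (show (0 : ℝ) ∈ Icc (-1 : ℝ) 1 by simp)
  refine
    { isOpen := isOpen_interior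
      nonempty := ⟨0, h0.zero_mem_interior⟩
      neg_mem := fun z hz => h0.neg_interior hz
      pos := fun t ht z hz => by
        have := (hG ht).sub_fderiv_pos hz
        rwa [fderiv_shadowFn hu hK hC t hz] at this
      affine_left := fun z t₁ t₂ l m hlm => ?_
      affine_right := fun z t₁ t₂ l m hlm => ?_
      neg_left := fun t z => ?_
      neg_right := fun t z => ?_
      integrable := fun t ht y s => ?_
      definite := fun t ht y s hae => (hG ht).eq_zero_of_ae_fderiv_eq hu ?_ }
  · obtain rfl : l = 1 - m := by linarith
    simp only [shadowGrad]; module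
  · obtain rfl : l = 1 - m := by linarith
    simp only [shadowSupport, shadowGrad, shadowFn, sub_apply, smul_apply, smul_eq_mul]
    ring
  · simp only [shadowGrad, neg_neg]; module
  · simp only [shadowSupport, shadowGrad, shadowFn, neg_neg, sub_apply, smul_apply, smul_eq_mul,
      map_neg]
    ring
  · have := (integral_surfaceAreaMeasure_shadowSystem hn hu hp hK hC ht
      ((y : EuclideanSpace ℝ (Fin n)) + s • u)).1
    rw [proj_add_smul, inner_add_left, inner_coe_orthogonal, inner_smul_left,
      real_inner_self_eq_norm_sq, hu] at this
    simpa using this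
  · filter_upwards [hae, ae_restrict_mem isOpen_interior.measurableSet] with z hz hzU
    rw [fderiv_shadowFn hu hK hC t hzU]
    exact hz

/-- The energy whose sublevel set `{≤ 1}` is the polar `L_p`-projection body of `K_t`, in the
coordinates of `u^⊥ × ℝ`. -/
def shadowEnergy (p : ℝ) (u : EuclideanSpace ℝ (Fin n)) (K : Set (EuclideanSpace ℝ (Fin n))) :
    ℝ → (ℝ ∙ u)ᗮ → ℝ → ℝ :=
  profileEnergy volume (1 / (n * omega n * cConst (n - 2) p) * 2) p (interior (proj u '' K))
    (shadowGrad u K) (shadowSupport u K)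

theorem isReflectionFamily_shadowEnergy (hn : 2 ≤ n) (hu : ‖u‖ = 1) {p : ℝ} (hp : 1 < p)
    (hK : IsSymmetricConvexBody K) (hC : IsC2Plus K) :
    IsReflectionFamily p (shadowEnergy p u K) :=
  (isReflectionProfile_shadowSystem (by omega) hu hp hK hC).isReflectionFamily
    (mul_pos (normalization_pos hn hp) two_pos) hp

lemma polarBody_lpProjectionBody_shadowSystem (hn : 2 ≤ n) (hu : ‖u‖ = 1) {p : ℝ} (hp : 1 < p)
    (hK : IsSymmetricConvexBody K) (hC : IsC2Plus K) {t : ℝ} (ht : t ∈ Icc (-1 : ℝ) 1) :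
    polarBody (lpProjectionBody p (shadowSystem u K t)) =
      {v | shadowEnergy p u K t (proj u v) ⟪v, u⟫ ≤ 1} := by
  have hP := isReflectionProfile_shadowSystem (by omega) hu hp hK hC
  have hQ := isReflectionFamily_shadowEnergy hn hu hp hK hC
  refine polarBody_lpProjectionBody (Φ := fun v => shadowEnergy p u K t (proj u v) ⟪v, u⟫)
    (by linarith) (fun v => ?_) ?_ (fun v => ?_) (fun v c hc => ?_)
  · rw [lpProjectionSupport, (integral_surfaceAreaMeasure_shadowSystem (by omega) hu hp hK hC ht
      v).2, ← mul_assoc]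
    rfl
  · refine ⟨convex_univ, fun v _ w _ l m hl hm hlm => ?_⟩
    have := (hQ.convex_space t ht).2 (mem_univ (proj u v, ⟪v, u⟫)) (mem_univ (proj u w, ⟪w, u⟫))
      hl hm hlm
    simpa [inner_add_left, inner_smul_left] using this
  · exact hP.energy_nonneg (mul_pos (normalization_pos hn hp) two_pos) ht _ _
  · simp only [map_smul, inner_smul_left, RCLike.conj_to_real]
    exact hQ.homog t _ _ c hc

/-- The volume of the polar `L_p`-projection body of `K_t` in the coordinates of `u^⊥ × ℝ`. -/
theorem volPolarLpProjection_shadowSystem (hn : 2 ≤ n) (hu : ‖u‖ = 1) {p : ℝ} (hp : 1 < p)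
    (hK : IsSymmetricConvexBody K) (hC : IsC2Plus K) {t : ℝ} (ht : t ∈ Icc (-1 : ℝ) 1) :
    volPolarLpProjection p (shadowSystem u K t) =
      ((volume : Measure (ℝ ∙ u)ᗮ).prod (volume : Measure ℝ)).real
        {z | shadowEnergy p u K t z.1 z.2 ≤ 1} := by
  have hQ := isReflectionFamily_shadowEnergy hn hu hp hK hC
  have hcont : Continuous fun v : EuclideanSpace ℝ (Fin n) =>
      shadowEnergy p u K t (proj u v) ⟪v, u⟫ :=
    (hQ.continuous t ht).comp (f := fun v : EuclideanSpace ℝ (Fin n) => (proj u v, ⟪v, u⟫))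
      (by fun_prop)
  rw [volPolarLpProjection, polarBody_lpProjectionBody_shadowSystem hn hu hp hK hC ht,
    ← (measurePreserving_add_smul hu).measure_preimage
      (isClosed_le hcont continuous_const).measurableSet.nullMeasurableSet]
  congr 2
  ext z
  have e : ⟪(z.1 : EuclideanSpace ℝ (Fin n)) + z.2 • u, u⟫ = z.2 := by
    rw [inner_add_left, inner_coe_orthogonal, inner_smul_left, real_inner_self_eq_norm_sq, hu]
    simp
  simp only [mem_preimage, mem_ofPred_eq, proj_add_smul, e]

end LpProjection
end

theorem mainTheorem3 (n : ℕ) (hn : 2 ≤ n) (p : ℝ) (hp : 1 < p)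
    (K : Set (EuclideanSpace ℝ (Fin n))) (hK : LpProjection.IsSymmetricConvexBody K)
    (hC : LpProjection.IsC2Plus K) (u : EuclideanSpace ℝ (Fin n)) (hu : ‖u‖ = 1)
    (hderiv : HasDerivWithinAt
      (fun t : ℝ => LpProjection.volPolarLpProjection p (LpProjection.shadowSystem u K t))
      0 (Set.Iio 1) 1) :
    (∃ c : ℝ, ∀ t ∈ Set.Icc (-1 : ℝ) 1,
      LpProjection.volPolarLpProjection p (LpProjection.shadowSystem u K t) = c) ∧
    LpProjection.volPolarLpProjection p K =
      LpProjection.volPolarLpProjection p (LpProjection.steinerSymmetral u K) := by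
  have hone : (1 : ℝ) ∈ Set.Icc (-1 : ℝ) 1 := by simp
  have hvol := fun {t : ℝ} (ht : t ∈ Set.Icc (-1 : ℝ) 1) =>
    LpProjection.volPolarLpProjection_shadowSystem hn hu hp hK hC ht
  -- The product formula for the volume is available only on [-1, 1], which suffices for a left
  -- derivative at 1.
  have hd := hderiv.congr_of_eventuallyEq (f₁ := fun t =>
      ((volume : Measure (ℝ ∙ u)ᗮ).prod (volume : Measure ℝ)).real
        {z | LpProjection.shadowEnergy p u K t z.1 z.2 ≤ 1})
    (by
      filter_upwards [Ico_mem_nhdsLT (show (-1 : ℝ) < 1 by norm_num)] with t ht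
      exact (hvol ⟨ht.1, ht.2.le⟩).symm)
    (hvol hone).symm
  have hconst : ∀ t ∈ Set.Icc (-1 : ℝ) 1,
      LpProjection.volPolarLpProjection p (LpProjection.shadowSystem u K t) =
        LpProjection.volPolarLpProjection p (LpProjection.shadowSystem u K 1) := fun t ht => by
    rw [hvol ht, hvol hone]
    exact (LpProjection.isReflectionFamily_shadowEnergy hn hu hp hK hC).volume_eq volume
      (by linarith) hd ht
  refine ⟨⟨_, hconst⟩, ?_⟩
  -- K_0 is the Steiner symmetral and K_1 is K.
  rw [← LpProjection.shadowSystem_zero hu hK, hconst 0 (by simp),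
    LpProjection.shadowSystem_one hu hK]
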